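/- Let $r_1\mid r_2\mid\dots\mid r_n$ be positive integers, $G=\mathbb Z/r_1\times\dots\times\mathbb Z/r_n$, and let $q$ be a prime power with $q\equiv 1 \pmod{r_n}$. Put $\mathcal R'=\prod_j\{0,\dots,r_j-1\}$, $\mathcal R=\mathcal R'\setminus\{0\}$ and $e(\vec v)=\operatorname{lcm}_j\big(r_j/\gcd(r_j,v_j)\big)$. For each $m\mid r_n$ let $\chi_m$ be a multiplicative character of $\mathbb F_q^*$ of order $m$, with $\chi_m(0)=0$. *Family.* Let $d(\vec\alpha)\ge 0$ ($\vec\alpha\in\mathcal R$) be integers with $\sum_{\vec\alpha}\alpha_jd(\vec\alpha)\equiv 0\pmod{r_j}$ for all $j$. Let $\hat{\mathcal F}_{[\vec d(\vec\alpha)]}$ be the set of $(\vec c,(f_{\vec\alpha})_{\vec\alpha\in\mathcal R})$ with $\vec c\in(\mathbb F_q^*)^n$ and $f_{\vec\alpha}\in\mathbb F_q[X]$ monic, squarefree and pairwise coprime, such that either $\deg f_{\vec\alpha}=d(\vec\alpha)$ for all $\vec\alpha$, or, for some $\vec\beta\in\mathcal R$, $\deg f_{\vec\beta}=d(\vec\beta)-1$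 and $\deg f_{\vec\alpha}=d(\vec\alpha)$ for all $\vec\alpha\ne\vec\beta$. *Values.* Let $(\vec s,\vec\omega)$ range over the pairs of vectors with $s_j\mid r_j$, $1\le\omega_j\le s_j$, $\gcd(\omega_j,s_j)=1$; put $\ell(\vec s)=\operatorname{lcm}(s_1,\dots,s_n)$ and let $\langle a\rangle$ denote the least non-negative residue of $a$ mod $\ell(\vec s)$. Define $$c_{(\vec s)}^{(\vec\omega)}=\prod_j c_j^{\langle \ell(\vec s)\omega_j/s_j\rangle},\qquad F_{(\vec s)}^{(\vec\omega)}(X)=c_{(\vec s)}^{(\vec\omega)}\prod_{\vec\alpha\in\mathcal R}f_{\vec\alpha}(X)^{\langle\sum_j \ell(\vec s)\omega_j\alpha_j/s_j\rangle}.$$ At the point at infinity, $F_{(\vec s)}^{(\vec\omega)}(\infty)=c_{(\vec s)}^{(\vec\omega)}$ if $\sum_j\frac{\ell(\vec s)}{s_j}\omega_j\sum_{\vec\alpha}\alpha_j\deg f_{\vec\alpha}\equiv0\pmod{\ell(\vec s)}$, and $F_{(\vec s)}^{(\vec\omega)}(\infty)=0$ otherwise. Let $x_1,\dots,x_q$ be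 the elements of $\mathbb F_q$ and $x_{q+1}=\infty$. *Admissibility.* A family $(\epsilon_{\vec s,\vec\omega})$ of complex numbers is admissible if there are a member of $\hat{\mathcal F}_{[\vec d(\vec\alpha)]}$ and a point $x\in\mathbb P^1(\mathbb F_q)$ with $\epsilon_{\vec s,\vec\omega}=\chi_{\ell(\vec s)}(F_{(\vec s)}^{(\vec\omega)}(x))$ for all $(\vec s,\vec\omega)$. For $\vec\beta\in\mathcal R'$ let $A_{\vec\beta}$ be the set of $(\vec s,\vec\omega)$ with $\sum_j\frac{\ell(\vec s)}{s_j}\omega_j\beta_j\equiv0\pmod{\ell(\vec s)}$. Write $\vec\beta\sim\vec\beta'$ if $A_{\vec\beta}=A_{\vec\beta'}$, and let $[\vec\beta]$ be the class of $\vec\beta$. An admissible family is $[\vec\beta]$-admissible if $\epsilon_{\vec s,\vec\omega}=0$ exactly for $(\vec s,\vec\omega)\notin A_{\vec\beta}$. *Claim.* For $1\le i\le q+1$ let $(\epsilon_{\vec s,\vec\omega,i})_{\vec s,\vec\omega}$ be admissible, and let $m_{[\vec\beta]}$ be the number of $i\in\{1,\dots,q+1\}$ for which it is $[\vec\beta]$-admissible.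 Let $N$ be the number of $(\vec c,(f_{\vec\alpha}))\in\hat{\mathcal F}_{[\vec d(\vec\alpha)]}$ with $\chi_{\ell(\vec s)}(F_{(\vec s)}^{(\vec\omega)}(x_i))=\epsilon_{\vec s,\vec\omega,i}$ for all $\vec s,\vec\omega$ and all $i=1,\dots,q+1$. Put $$\Delta=\prod_{[\vec\beta]\ne[\vec 0]}\left(\frac{\phi(e(\vec\beta)^2)}{|G|(q+|G|-1)}\right)^{m_{[\vec\beta]}}\left(\frac{q}{|G|(q+|G|-1)}\right)^{m_{[\vec 0]}},$$ the product being over the classes, with $\phi$ Euler's function. Then $$N=\frac{(q-1)^n(q+|G|-1)}{q}\cdot\frac{L_{|G|-2}\,q^{\sum_{\vec\alpha} d(\vec\alpha)}}{\zeta_q(2)^{|G|-1}}\cdot\Delta\cdot\left(1+O\left(q^{-\min d(\vec\alpha)/2}\right)\right)$$ and $$\frac{N}{|\hat{\mathcal F}_{[\vec d(\vec\alpha)]}|}=\Delta\cdot\left(1+O\left(q^{-\min d(\vec\alpha)/2}\right)\right),$$ where $\zeta_q(s)=\sum_{f\text{ monic}}|f|^{-s}$ with $|f|=q^{\deg f}$,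 $L_m=\prod_{j=1}^m\prod_P\left(1-\frac{j}{(|P|+1)(|P|+j)}\right)$ over the monic irreducible $P\in\mathbb F_q[X]$ (an empty product for $m\le 0$), and the implied constants depend only on $q$ and $r_1,\dots,r_n$. In particular, both formulas are the same whatever is prescribed at the point at infinity: it only enters, like any other point, through the numbers $m_{[\vec\beta]}$. (For trivial $G$ the minimum over the empty set is read as $0$.) -/

import Mathlib

open Polynomial

namespace AbelianCovers

/-! Throughout, `G = ℤ/r₁ × ⋯ × ℤ/rₙ` is encoded by `r : Fin n → ℕ` with nonzero entries, `F` is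
the finite field with `q` elements, and the projective line over `F` is `OnePoint F`. -/

section Combinatorics

variable {n : ℕ} (r : Fin n → ℕ)

/-- The set `R' = [0, r₁ - 1] × ⋯ × [0, rₙ - 1]`. -/
abbrev RPrime : Type := (j : Fin n) → Fin (r j)

/-- The set `R` of the nonzero vectors in `R'`. -/
abbrev RIdx [∀ j, NeZero (r j)] : Type := {α : RPrime r // α ≠ 0}

/-- The order `|G| = r₁ ⋯ rₙ`. -/
def groupOrder : ℕ := ∏ j, r j

/-- `e(v) = lcm_j (r_j / gcd (r_j, v_j))`. -/
def ramIndex (v : Fin n → ℕ) : ℕ := Finset.univ.lcm fun j => r j / Nat.gcd (r j) (v j)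

/-- The pairs `(s, ω)` with `s_j ∣ r_j`, `1 ≤ ω_j ≤ s_j` and `gcd (ω_j, s_j) = 1` for all `j`. -/
def SOmega : Type :=
  {p : (Fin n → ℕ) × (Fin n → ℕ) //
    (∀ j, p.1 j ∣ r j) ∧ ∀ j, 1 ≤ p.2 j ∧ p.2 j ≤ p.1 j ∧ Nat.Coprime (p.2 j) (p.1 j)}

variable {r}

/-- The vector `s` of a pair `(s, ω)`. -/
def SOmega.s (p : SOmega r) : Fin n → ℕ := p.1.1

/-- The vector `ω` of a pair `(s, ω)`. -/
def SOmega.ω (p : SOmega r) : Fin n → ℕ := p.1.2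

/-- `ℓ(s) = lcm (s₁, …, sₙ)`. -/
def SOmega.ell (p : SOmega r) : ℕ := Finset.univ.lcm p.s

/-- The pairing `∑_j (ℓ(s) / s_j) ω_j v_j`. -/
def SOmega.pairing (p : SOmega r) (v : Fin n → ℕ) : ℕ := ∑ j, p.ell / p.s j * p.ω j * v j

/-- `A_β`, the set of pairs `(s, ω)` with `∑_j (ℓ(s) / s_j) ω_j β_j ≡ 0 mod ℓ(s)`. -/
def ASet (β : RPrime r) : Set (SOmega r) := {p | p.ell ∣ p.pairing fun j => (β j : ℕ)}

variable (r)

/-- The equivalence relation on `R'`: `β ∼ β'` if and only if `A_β = A_β'`. -/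
def simSetoid : Setoid (RPrime r) := Setoid.ker ASet

/-- The set of classes `[β]`. -/
def RTilde : Type := Quotient (simSetoid r)

noncomputable instance : Fintype (RTilde r) :=
  @Fintype.ofFinite _ (inferInstanceAs (Finite (Quotient (simSetoid r))))

noncomputable instance : DecidableEq (RTilde r) := Classical.decEq _

/-- The class `[0]`. -/
def zeroClass [∀ j, NeZero (r j)] : RTilde r := Quotient.mk (simSetoid r) 0

variable {r}

/-- A representative of a class; the quantities below are evaluated at it, and they depend only on
the class. -/
noncomputable def RTilde.rep (b : RTilde r) : RPrime r := Quotient.out b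

end Combinatorics

section Families

variable {n : ℕ} {r : Fin n → ℕ} [∀ j, NeZero (r j)] (F : Type*) [Field F]

/-- The monic, squarefree, pairwise coprime tuples with `deg f_α = d(α)`. -/
def tuples (d : RIdx r → ℕ) : Set (RIdx r → F[X]) :=
  {f | (∀ α, (f α).Monic ∧ Squarefree (f α) ∧ (f α).natDegree = d α) ∧
    ∀ α β, α ≠ β → IsCoprime (f α) (f β)}

/-- The same tuples, with the degree of `f_β` equal to `d(β) - 1` instead of `d(β)`
(there are none if `d(β) = 0`). -/
def tuplesDrop (d : RIdx r → ℕ) (β : RIdx r) : Set (RIdx r → F[X]) :=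
  {f | (∀ α, (f α).Monic ∧ Squarefree (f α)) ∧ (f β).natDegree + 1 = d β ∧
    (∀ α, α ≠ β → (f α).natDegree = d α) ∧ ∀ α γ, α ≠ γ → IsCoprime (f α) (f γ)}

/-- The full family: a leading-coefficient vector `c ∈ (F^*)ⁿ`, together with a tuple whose degrees
are either `d` or `d` lowered by one in exactly one coordinate. -/
def fullFamily (d : RIdx r → ℕ) : Set ((Fin n → Fˣ) × (RIdx r → F[X])) :=
  {cf | cf.2 ∈ tuples F d ∪ ⋃ β, tuplesDrop F d β}

variable {F}

/-- `c_(s)^(ω) = ∏_j c_j ^ ((ℓ(s) / s_j) ω_j mod ℓ(s))`. -/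
def leadCoeff (c : Fin n → Fˣ) (p : SOmega r) : F :=
  ∏ j, (c j : F) ^ (p.ell / p.s j * p.ω j % p.ell)

/-- `F_(s)^(ω)(X) = c_(s)^(ω) ∏_α f_α ^ (∑_j (ℓ(s) / s_j) ω_j α_j mod ℓ(s))`. -/
noncomputable def FPoly (c : Fin n → Fˣ) (f : RIdx r → F[X]) (p : SOmega r) : F[X] :=
  C (leadCoeff c p) * ∏ α : RIdx r, f α ^ ((p.pairing fun j => (α.1 j : ℕ)) % p.ell)

/-- `deg F_j = ∑_α α_j deg f_α`. -/
noncomputable def degF (f : RIdx r → F[X]) (j : Fin n) : ℕ :=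
  ∑ α : RIdx r, (α.1 j : ℕ) * (f α).natDegree

open Classical in
/-- The value of `F_(s)^(ω)` at a point of the projective line. At infinity it is `c_(s)^(ω)` if
`∑_j (ℓ(s) / s_j) ω_j deg F_j ≡ 0 mod ℓ(s)`, and `0` otherwise. -/
noncomputable def valueAt (c : Fin n → Fˣ) (f : RIdx r → F[X]) (p : SOmega r) : OnePoint F → F
  | some x => (FPoly c f p).eval x
  | none => if p.ell ∣ p.pairing (degF f) then leadCoeff c p else 0

/-- The family `ε` of prescribed values at one point is admissible if it is attained by some member
of the full family at some point of the projective line. -/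
def IsAdmissible (χ : ℕ → MulChar F ℂ) (d : RIdx r → ℕ) (ε : SOmega r → ℂ) : Prop :=
  ∃ cf ∈ fullFamily F d, ∃ x : OnePoint F, ∀ p, ε p = χ p.ell (valueAt cf.1 cf.2 p x)

/-- `[β]`-admissibility: an admissible family that vanishes exactly outside `A_β`. -/
def IsBetaAdmissible (χ : ℕ → MulChar F ℂ) (d : RIdx r → ℕ) (β : RPrime r)
    (ε : SOmega r → ℂ) : Prop :=
  IsAdmissible χ d ε ∧ ∀ p, ε p = 0 ↔ p ∉ ASet β

/-- `m_[β]`, the number of points of the projective line at which the prescription is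
`[β]`-admissible. -/
noncomputable def mult (χ : ℕ → MulChar F ℂ) (d : RIdx r → ℕ) (ε : OnePoint F → SOmega r → ℂ)
    (b : RTilde r) : ℕ :=
  {x : OnePoint F | IsBetaAdmissible χ d b.rep (ε x)}.ncard

/-- The members of the full family that attain the prescription at all points of the projective
line, including infinity. -/
def attaining (χ : ℕ → MulChar F ℂ) (d : RIdx r → ℕ) (ε : OnePoint F → SOmega r → ℂ) :
    Set ((Fin n → Fˣ) × (RIdx r → F[X])) :=
  {cf ∈ fullFamily F d | ∀ (x : OnePoint F) (p : SOmega r),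
    χ p.ell (valueAt cf.1 cf.2 p x) = ε x p}

/-- `∏_{[β] ≠ [0]} (φ(e(β)²) / (|G| (q + |G| - 1))) ^ m_[β] · (q / (|G| (q + |G| - 1))) ^ m_[0]`. -/
noncomputable def density [Fintype F] (χ : ℕ → MulChar F ℂ) (d : RIdx r → ℕ)
    (ε : OnePoint F → SOmega r → ℂ) : ℝ :=
  (∏ b ∈ ({zeroClass r}ᶜ : Finset (RTilde r)),
    ((Nat.totient (ramIndex r (fun j => (b.rep j : ℕ)) ^ 2) : ℝ) /
      (groupOrder r * (Fintype.card F + groupOrder r - 1))) ^ mult χ d ε b) *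
  ((Fintype.card F : ℝ) / (groupOrder r * (Fintype.card F + groupOrder r - 1))) ^
    mult χ d ε (zeroClass r)

end Families

section Constants

variable (F : Type*) [Field F] [Fintype F]

/-- The norm `|f| = q ^ deg f`. -/
noncomputable def polyNorm (f : F[X]) : ℝ := (Fintype.card F : ℝ) ^ f.natDegree

/-- The zeta function `ζ_q(s) = ∑ |f| ^ (-s)` of `F[X]`, the sum being over the monic `f`. -/
noncomputable def zetaF (s : ℝ) : ℝ := ∑' f : {f : F[X] // f.Monic}, polyNorm F f.1 ^ (-s)

/-- `L_m = ∏_{j=1}^m ∏_P (1 - j / ((|P| + 1) (|P| + j)))`, with `P` over the monic irreducibles. -/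
noncomputable def LConst (m : ℕ) : ℝ :=
  ∏ j ∈ Finset.Icc 1 m, ∏' P : {P : F[X] // P.Monic ∧ Irreducible P},
    (1 - (j : ℝ) / ((polyNorm F P.1 + 1) * (polyNorm F P.1 + j)))

/-- `((q - 1)ⁿ (q + |G| - 1) / q) · L_{|G| - 2} q ^ (∑ d(α)) / ζ_q(2) ^ (|G| - 1)`.
For the trivial group `L_{|G| - 2}` is the empty product. -/
noncomputable def mainSize {n : ℕ} {r : Fin n → ℕ} [∀ j, NeZero (r j)] (d : RIdx r → ℕ) : ℝ :=
  ((Fintype.card F : ℝ) - 1) ^ n * (Fintype.card F + groupOrder r - 1) / Fintype.card F *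
    (LConst F (groupOrder r - 2) * (Fintype.card F : ℝ) ^ (∑ α, d α) /
      zetaF F 2 ^ (groupOrder r - 1))

end Constants

end AbelianCovers

/-!
The values of a member at the `q + 1` points of the projective line depend only on local data: the
leading coefficients `c`, the ramification vector at each point (the `α` with `f_α(x) = 0`; at `∞`
the index whose degree drops), and the values at the points of `F` of the rootless parts, that is,
of the `f_α` with their linear factors removed. Tuples of coprime squarefree rootless polynomials
are equidistributed, with square-root error, among the prescribed degrees and nonzero values: their
generating series is an Euler product, a convolution of the one for all monic polynomials with
absolutely convergent correction factors. A ramified point lowers one degree by one and so costs a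
factor `q`.

Discrete logarithms turn the values at a point into the pairing of `G` with its dual. By duality,
prescribing them at a point of class `[β]` says that the ramification vector generates the same
cyclic group as `β`, which leaves `φ(e(β))` choices, and that the vector of logarithms of the unit
part lies in a given coset of that group, a proportion `e(β) / |G|`. This gives the weight
`φ(e) e / (|G| q) = φ(e²) / (|G| q)` out of a total `1 + (|G| - 1) / q` per point, at `∞` as
everywhere else.
-/

open Filter Topology

namespace AbelianCovers

/-! ### Euler products over finitely supported functions -/

section EulerProduct

theorem tendsto_of_tendsto_prod_of_tendsto {α β X : Type*} [TopologicalSpace X] [RegularSpace X]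
    {l : Filter α} {m : Filter β} [m.NeBot] {f : α → β → X} {g : α → X} {x : X}
    (h : Tendsto (fun z : α × β => f z.1 z.2) (l ×ˢ m) (𝓝 x))
    (hg : ∀ a, Tendsto (f a) m (𝓝 (g a))) : Tendsto g l (𝓝 x) := by
  rw [(closed_nhds_basis x).tendsto_right_iff] at h ⊢
  intro s hs
  filter_upwards [(h s hs).curry] with a ha
  exact hs.2.mem_of_tendsto (hg a) ha

theorem tendsto_insert_atTop {V : Type*} [DecidableEq V] (v : V) :
    Tendsto (fun W : Finset V => insert v W) atTop atTop :=
  tendsto_atTop_finset_of_monotone (fun _ _ h => Finset.insert_subset_insert _ h)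
    fun x => ⟨{x}, Finset.mem_insert_of_mem (Finset.mem_singleton_self x)⟩

variable {J V : Type*} [AddCommMonoid V]

theorem tendsto_finsupp_insert_zero_atTop [DecidableEq V] :
    Tendsto (fun z : Finset J × Finset V => z.1.finsupp fun _ => insert 0 z.2) atTop atTop := by
  refine tendsto_atTop_finset_of_monotone (fun z w hzw D hD => ?_) fun D => ?_
  · rw [Finset.mem_finsupp_iff] at hD ⊢
    refine ⟨hD.1.trans hzw.1, fun P _ => ?_⟩
    by_cases hP : D P = 0
    · exact hP ▸ Finset.mem_insert_self _ _
    · exact Finset.insert_subset_insert _ hzw.2 (hD.2 P (hD.1 (Finsupp.mem_support_iff.2 hP)))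
  · exact ⟨(D.support, D.support.image D), Finset.mem_finsupp_iff.2
      ⟨subset_rfl, fun P hP => Finset.mem_insert_of_mem (Finset.mem_image_of_mem _ hP)⟩⟩

theorem sum_finsupp_prod_apply {R : Type*} [CommSemiring R] (a : J → V → R) (T : Finset J)
    (W : J → Finset V) :
    ∑ D ∈ T.finsupp W, ∏ P ∈ T, a P (D P) = ∏ P ∈ T, ∑ d ∈ W P, a P d := by
  classical
  rw [Finset.prod_sum, Finset.finsupp, Finset.sum_map]
  refine Finset.sum_congr rfl fun x _ => ?_
  change ∏ P ∈ T, a P (Finsupp.indicator T x P) = _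
  rw [← Finset.prod_attach T]
  exact Finset.prod_congr rfl fun P _ => by rw [Finsupp.indicator_of_mem P.2]

theorem sum_finsupp_prod_eq_prod_sum {R : Type*} [CommSemiring R] {a : J → V → R}
    (ha : ∀ P, a P 0 = 1) (T : Finset J) (W : J → Finset V) :
    ∑ D ∈ T.finsupp W, D.prod a = ∏ P ∈ T, ∑ d ∈ W P, a P d := by
  rw [← sum_finsupp_prod_apply]
  exact Finset.sum_congr rfl fun D hD => Finsupp.prod_of_support_subset _
    (Finset.mem_finsupp_iff.1 hD).1 _ fun P _ => ha P

variable {a : J → V → ℝ}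

theorem sum_insert_zero_abs_eq [DecidableEq V] (ha : ∀ P, a P 0 = 1) (W : Finset V) (P : J) :
    ∑ d ∈ insert 0 W, |a P d| = 1 + ∑ d ∈ W.subtype (· ≠ 0), |a P d.1| := by
  rw [Finset.sum_subtype_eq_sum_filter (s := W) (p := (· ≠ 0)) (f := fun d => |a P d|),
    Finset.filter_ne', ← Finset.add_sum_erase _ _ (Finset.mem_insert_self 0 W),
    Finset.erase_insert_eq_erase, ha, abs_one]

theorem summable_finsupp_prod (ha : ∀ P, a P 0 = 1)
    (hs : Summable fun z : J × {d : V // d ≠ 0} => |a z.1 z.2|) :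
    Summable fun D : J →₀ V => D.prod a := by
  classical
  rw [← summable_abs_iff]
  refine summable_of_sum_le (c := Real.exp (∑' z : J × {d : V // d ≠ 0}, |a z.1 z.2|))
    (fun _ => abs_nonneg _) fun u => ?_
  obtain ⟨⟨T, W⟩, hu⟩ := (tendsto_finsupp_insert_zero_atTop.eventually_ge_atTop u).exists
  have hnonneg : ∀ P, 0 ≤ ∑ d ∈ W.subtype (· ≠ 0), |a P d.1| := fun P =>
    Finset.sum_nonneg fun _ _ => abs_nonneg _
  calc ∑ D ∈ u, |D.prod a|
      = ∑ D ∈ u, D.prod fun P d => |a P d| := by simp only [Finsupp.prod, Finset.abs_prod]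
    _ ≤ ∑ D ∈ T.finsupp fun _ => insert 0 W, D.prod fun P d => |a P d| :=
        Finset.sum_le_sum_of_subset_of_nonneg hu fun D _ _ =>
          Finset.prod_nonneg fun _ _ => abs_nonneg _
    _ = ∏ P ∈ T, (1 + ∑ d ∈ W.subtype (· ≠ 0), |a P d.1|) := by
        rw [sum_finsupp_prod_eq_prod_sum (by simp [ha])]
        simp only [sum_insert_zero_abs_eq ha]
    _ ≤ Real.exp (∑ P ∈ T, ∑ d ∈ W.subtype (· ≠ 0), |a P d.1|) :=
        Real.prod_one_add_le_exp_sum T hnonneg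
    _ ≤ Real.exp (∑' z : J × {d : V // d ≠ 0}, |a z.1 z.2|) := by
        rw [← Finset.sum_product' T (W.subtype (· ≠ 0)) fun P d => |a P d.1|]
        exact Real.exp_le_exp.2 (hs.sum_le_tsum _ fun _ _ => abs_nonneg _)

theorem hasProd_tsum_finsupp_prod (ha : ∀ P, a P 0 = 1)
    (hs : Summable fun z : J × {d : V // d ≠ 0} => |a z.1 z.2|) :
    HasProd (fun P => ∑' d, a P d) (∑' D : J →₀ V, D.prod a) := by
  classical
  have hlocal : ∀ P, Summable (a P) := fun P => by
    have hne : Summable fun d : {d : V // d ≠ 0} => a P d :=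
      Summable.of_abs (hs.comp_injective (Prod.mk_right_injective P))
    exact (Finset.summable_compl_iff {(0 : V)}).1
      ((Equiv.subtypeEquivRight (by simp)).summable_iff.1 hne)
  have hbox := (summable_finsupp_prod ha hs).hasSum.comp tendsto_finsupp_insert_zero_atTop
  simp only [Function.comp_def, sum_finsupp_prod_eq_prod_sum ha] at hbox
  rw [← prod_atTop_atTop_eq] at hbox
  exact tendsto_of_tendsto_prod_of_tendsto
    (f := fun T W => ∏ P ∈ T, ∑ d ∈ insert 0 W, a P d) hbox
    fun T => tendsto_finsetProd _ fun P _ => (hlocal P).hasSum.comp (tendsto_insert_atTop 0)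

end EulerProduct

section Pi

variable {ι V : Type*} [Fintype ι] {a : ι → V → ℝ}

theorem summable_pi_prod (hs : ∀ i, Summable (a i)) :
    Summable fun d : ι → V => ∏ i, a i (d i) := by
  classical
  rw [← summable_abs_iff]
  refine summable_of_sum_le (c := ∏ i, ∑' d, |a i d|) (fun _ => abs_nonneg _) fun u => ?_
  simp only [Finset.abs_prod]
  have hu : u ⊆ Fintype.piFinset fun i => u.image fun d => d i := fun d hd =>
    Fintype.mem_piFinset.2 fun i => Finset.mem_image_of_mem _ hd
  calc ∑ d ∈ u, ∏ i, |a i (d i)|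
      ≤ ∑ d ∈ Fintype.piFinset fun i => u.image fun d => d i, ∏ i, |a i (d i)| :=
        Finset.sum_le_sum_of_subset_of_nonneg hu fun _ _ _ =>
          Finset.prod_nonneg fun _ _ => abs_nonneg _
    _ = ∏ i, ∑ d ∈ u.image fun d => d i, |a i d| :=
        (Finset.prod_univ_sum _ fun i d => |a i d|).symm
    _ ≤ ∏ i, ∑' d, |a i d| := Finset.prod_le_prod
        (fun i _ => Finset.sum_nonneg fun _ _ => abs_nonneg _)
        fun i _ => (hs i).abs.sum_le_tsum _ fun _ _ => abs_nonneg _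

theorem tsum_pi_prod (hs : ∀ i, Summable (a i)) :
    ∑' d : ι → V, ∏ i, a i (d i) = ∏ i, ∑' d, a i d := by
  classical
  have hboxes : Tendsto (fun W : ι → Finset V => Fintype.piFinset W) atTop atTop :=
    tendsto_atTop_finset_of_monotone (fun _ _ h => Fintype.piFinset_subset _ _ h)
      fun d => ⟨fun i => {d i}, by simp⟩
  have hsum := (summable_pi_prod hs).hasSum.comp hboxes
  simp only [Function.comp_def, ← Finset.prod_univ_sum] at hsum
  exact tendsto_nhds_unique hsum (tendsto_finsetProd _ fun i _ =>
    (hs i).hasSum.comp (tendsto_atTop_atTop.2 fun b =>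
      ⟨fun _ => b, fun _ h => h i⟩))

end Pi

section Convolution

theorem sum_sum_Icc_eq_sum_sum_add_mem {M R : Type*} [AddCommMonoid M] [PartialOrder M]
    [CanonicallyOrderedAdd M] [Sub M] [OrderedSub M] [AddLeftReflectLE M] [LocallyFiniteOrder M]
    [DecidableEq M] [AddCommMonoid R] (φ : M → M → R) {U B : Finset M}
    (hB : ∀ D E, D + E ∈ U → D ∈ B) :
    ∑ g ∈ U, ∑ D ∈ Finset.Icc 0 g, φ D (g - D) = ∑ D ∈ B, ∑ E ∈ B with D + E ∈ U, φ D E := by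
  rw [Finset.sum_sigma', Finset.sum_sigma']
  refine Finset.sum_bij' (fun x _ => ⟨x.2, x.1 - x.2⟩) (fun x _ => ⟨x.1 + x.2, x.1⟩)
    ?_ ?_ ?_ ?_ fun _ _ => rfl
  · rintro ⟨g, D⟩ h
    obtain ⟨hg, hD⟩ : g ∈ U ∧ D ≤ g := by simpa using h
    have hadd : D + (g - D) = g := add_tsub_cancel_of_le hD
    have hD' : D ∈ B := hB D (g - D) (by rwa [hadd])
    have hE' : g - D ∈ B := hB (g - D) D (by rwa [add_comm, hadd])
    simpa [hadd] using ⟨hD', hE', hg⟩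
  · rintro ⟨D, E⟩ h
    simp only [Finset.mem_sigma, Finset.mem_filter] at h
    simpa using h.2.2
  · rintro ⟨g, D⟩ h
    obtain ⟨-, hD⟩ : g ∈ U ∧ D ≤ g := by simpa using h
    simp [add_tsub_cancel_of_le hD]
  · rintro ⟨D, E⟩ -
    simp

variable {J V R : Type*} [AddCommMonoid V] [PartialOrder V] [CanonicallyOrderedAdd V] [Sub V]
  [OrderedSub V] [LocallyFiniteOrder V] [CommSemiring R] {b s h : V → R}

theorem sum_Icc_finsupp_prod_mul_prod_tsub [DecidableEq J] [DecidableEq V]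
    (hb : b 0 = 1) (hs : s 0 = 1)
    (hconv : ∀ v, ∑ d ∈ Finset.Icc 0 v, b d * s (v - d) = h v) (g : J →₀ V) :
    ∑ D ∈ Finset.Icc 0 g, (D.prod fun _ d => b d) * ((g - D).prod fun _ d => s d) =
      g.prod fun _ v => h v := by
  rw [Finsupp.Icc_eq, Finsupp.support_zero, Finset.empty_union, Finsupp.prod,
    ← Finset.prod_congr rfl fun P _ => hconv (g P)]
  refine Eq.trans ?_ (sum_finsupp_prod_apply (fun P d => b d * s (g P - d)) _ _)
  refine Finset.sum_congr rfl fun D hD => ?_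
  rw [Finsupp.prod_of_support_subset _ (Finset.mem_finsupp_iff.1 hD).1 _ fun _ _ => hb,
    Finsupp.prod_of_support_subset _ Finsupp.support_tsub _ fun _ _ => hs,
    ← Finset.prod_mul_distrib]
  rfl

theorem sum_finsupp_prod_eq_sum_mul_sum [AddLeftReflectLE V]
    [DecidableEq J] [DecidableEq V] (hb : b 0 = 1) (hs : s 0 = 1)
    (hconv : ∀ v, ∑ d ∈ Finset.Icc 0 v, b d * s (v - d) = h v) {U B : Finset (J →₀ V)}
    (hB : ∀ D E, D + E ∈ U → D ∈ B) :
    ∑ g ∈ U, (g.prod fun _ v => h v) =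
      ∑ D ∈ B, (D.prod fun _ d => b d) * ∑ E ∈ B with D + E ∈ U, E.prod fun _ d => s d := by
  simp only [← sum_Icc_finsupp_prod_mul_prod_tsub hb hs hconv, Finset.mul_sum]
  exact sum_sum_Icc_eq_sum_sum_add_mem
    (fun D E => (D.prod fun _ d => b d) * E.prod fun _ d => s d) hB

end Convolution

/-! ### Coefficients of the local factors -/

section LocalCoefficients

/-- The coefficients of `1 - t²`, which inverts the full generating series `1 / (1 - t)` of the
exponents of one prime into the squarefree one `1 + t`. -/
def sqCoeff (n : ℕ) : ℝ := if n = 0 then 1 else if n = 2 then -1 else 0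

/-- The indicator function of the exponents at most one, with generating series `1 + t`. -/
def sqfreeInd (n : ℕ) : ℝ := if n ≤ 1 then 1 else 0

theorem sqCoeff_zero : sqCoeff 0 = 1 := rfl

theorem sum_sqCoeff (v : ℕ) : ∑ d ∈ Finset.Icc 0 v, sqCoeff d = sqfreeInd v := by
  match v with
  | 0 => simp [sqCoeff, sqfreeInd]
  | 1 => simp [sqCoeff, sqfreeInd, ← Nat.range_succ_eq_Icc_zero, Finset.sum_range_succ]
  | n + 2 =>
    have hsub : ({0, 2} : Finset ℕ) ⊆ Finset.Icc 0 (n + 2) := by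
      simp [Finset.insert_subset_iff]
    rw [← Finset.sum_subset hsub fun d _ hd => by simp_all [sqCoeff]]
    simp [sqCoeff, sqfreeInd]

theorem sum_mul_sqfreeInd_tsub (a : ℕ → ℝ) (v : ℕ) :
    ∑ d ∈ Finset.Icc 0 (v + 1), a d * sqfreeInd (v + 1 - d) = a v + a (v + 1) := by
  rw [← Nat.range_succ_eq_Icc_zero, Finset.sum_range_succ, Finset.sum_range_succ,
    Finset.sum_eq_zero fun d hd => ?_]
  · simp [sqfreeInd]
  · rw [Finset.mem_range] at hd
    simp [sqfreeInd, show ¬ v + 1 - d ≤ 1 by omega]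

theorem sum_neg_one_pow_mul_sqfreeInd (v : ℕ) :
    ∑ d ∈ Finset.Icc 0 v, (-1) ^ d * sqfreeInd (v - d) = if v = 0 then 1 else 0 := by
  cases v with
  | zero => simp [sqfreeInd]
  | succ v => rw [sum_mul_sqfreeInd_tsub, pow_succ]; simp

variable {ι : Type*}

section CrossFactor

variable [DecidableEq ι]

/-- The coefficients of `t / (1 + t)` for `j = i` and of `1 / (1 + t)` for `j ≠ i`. -/
def crossFactor (i j : ι) (n : ℕ) : ℝ :=
  if j = i then (if n = 0 then 0 else -(-1) ^ n) else (-1) ^ n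

theorem sum_crossFactor_mul_sqfreeInd (i j : ι) (v : ℕ) :
    ∑ d ∈ Finset.Icc 0 v, crossFactor i j d * sqfreeInd (v - d) =
      if v = Pi.single (M := fun _ => ℕ) i 1 j then 1 else 0 := by
  by_cases hj : j = i
  · subst hj
    match v with
    | 0 => simp [crossFactor]
    | 1 => rw [sum_mul_sqfreeInd_tsub _ 0]; simp [crossFactor]
    | n + 2 => rw [sum_mul_sqfreeInd_tsub _ (n + 1)]; simp [crossFactor, pow_succ]
  · simpa [crossFactor, hj] using sum_neg_one_pow_mul_sqfreeInd v

theorem hasSum_neg_one_pow_mul_pow {x : ℝ} (h0 : 0 ≤ x) (h1 : x < 1) :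
    HasSum (fun n : ℕ => (-1) ^ n * x ^ n) (1 + x)⁻¹ := by
  simpa [← mul_pow] using
    hasSum_geometric_of_abs_lt_one (r := -x) (by rwa [abs_neg, abs_of_nonneg h0])

theorem hasSum_crossFactor_mul_pow {x : ℝ} (h0 : 0 ≤ x) (h1 : x < 1) (i j : ι) :
    HasSum (fun n : ℕ => crossFactor i j n * x ^ n)
      ((1 + x)⁻¹ * if j = i then x else 1) := by
  have hgeom := hasSum_neg_one_pow_mul_pow h0 h1
  by_cases hj : j = i
  · subst hj
    have hcoeff : (fun n : ℕ => crossFactor j j n * x ^ n) =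
        fun n => (if n = 0 then 1 else 0) - (-1) ^ n * x ^ n := by
      ext n
      by_cases hn : n = 0 <;> simp [crossFactor, hn]
    have hval : (1 + x)⁻¹ * x = 1 - (1 + x)⁻¹ := by field_simp; ring
    simpa only [hcoeff, if_true, hval] using (hasSum_ite_eq 0 1).sub hgeom
  · simpa only [crossFactor, hj, if_false, mul_one] using hgeom

end CrossFactor

variable [Fintype ι]

theorem sum_eq_one_iff_exists_single [DecidableEq ι] (v : ι → ℕ) :
    ∑ i, v i = 1 ↔ ∃ i, v = Pi.single i 1 := by
  simpa [Finsupp.sum_fintype, Equiv.symm_apply_eq, Finsupp.equivFunOnFinite_single] using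
    Finsupp.sum_eq_one_iff (Finsupp.equivFunOnFinite.symm v)

theorem ite_zero_add_sum_ite_single [DecidableEq ι] (v : ι → ℕ) :
    (if v = 0 then 1 else 0) + ∑ i, (if v = Pi.single i 1 then 1 else 0) =
      if ∑ i, v i ≤ 1 then (1 : ℝ) else 0 := by
  by_cases hone : ∑ i, v i = 1
  · obtain ⟨i, rfl⟩ := (sum_eq_one_iff_exists_single v).1 hone
    have hinj : ∀ j, Pi.single (M := fun _ => ℕ) i 1 = Pi.single j 1 ↔ i = j := fun j =>
      ⟨fun h => by_contra fun hij => by simpa [hij] using congrFun h i, fun h => h ▸ rfl⟩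
    simp [hinj]
  · have hsingle : ∀ i, v ≠ Pi.single i 1 := fun i hi =>
      hone ((sum_eq_one_iff_exists_single v).2 ⟨i, hi⟩)
    have hzero : ∑ i, v i ≤ 1 ↔ v = 0 := by
      rw [Nat.le_one_iff_eq_zero_or_eq_one, or_iff_left hone]
      simp [funext_iff]
    simp [hsingle, hzero]

variable [DecidableEq ι]

/-- The coefficients of `(1 + ∑ᵢ tᵢ) / ∏ᵢ (1 + tᵢ)`, which sieves the pairwise coprime tuples out
of the tuples of squarefree elements. -/
def crossCoeff (d : ι → ℕ) : ℝ := ∏ j, (-1) ^ d j + ∑ i, ∏ j, crossFactor i j (d j)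

theorem prod_crossFactor (d : ι → ℕ) (i : ι) :
    ∏ j, crossFactor i j (d j) = if d i ≠ 0 then -∏ j, (-1 : ℝ) ^ d j else 0 := by
  have hrest : ∏ j ∈ Finset.univ.erase i, crossFactor i j (d j) =
      ∏ j ∈ Finset.univ.erase i, (-1 : ℝ) ^ d j :=
    Finset.prod_congr rfl fun j hj => by simp [crossFactor, Finset.ne_of_mem_erase hj]
  rw [← Finset.mul_prod_erase _ _ (Finset.mem_univ i), hrest,
    ← Finset.mul_prod_erase _ (fun j => (-1 : ℝ) ^ d j) (Finset.mem_univ i)]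
  by_cases hi : d i = 0 <;> simp [crossFactor, hi]

theorem crossCoeff_eq (d : ι → ℕ) :
    crossCoeff d = (∏ j, (-1) ^ d j) * (1 - (Finset.univ.filter fun i => d i ≠ 0).card) := by
  rw [crossCoeff, Finset.sum_congr rfl fun i _ => prod_crossFactor d i, ← Finset.sum_filter,
    Finset.sum_const, nsmul_eq_mul]
  ring

theorem crossCoeff_zero : crossCoeff (0 : ι → ℕ) = 1 := by simp [crossCoeff_eq]

theorem abs_crossCoeff_le (d : ι → ℕ) : |crossCoeff d| ≤ Fintype.card ι + 1 := by
  have hcard : ((Finset.univ.filter fun i => d i ≠ 0).card : ℝ) ≤ Fintype.card ι := by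
    exact_mod_cast Finset.card_le_univ _
  rw [crossCoeff_eq, abs_mul, Finset.abs_prod]
  simp only [abs_pow, abs_neg, abs_one, one_pow, Finset.prod_const_one, one_mul]
  rw [abs_le]
  constructor <;> linarith [Nat.cast_nonneg (α := ℝ) (Finset.univ.filter fun i => d i ≠ 0).card]

theorem crossCoeff_eq_zero {d : ι → ℕ} {i : ι} (hi : d i ≠ 0) (h : ∀ j, j ≠ i → d j = 0) :
    crossCoeff d = 0 := by
  have hsupp : (Finset.univ.filter fun j => d j ≠ 0) = {i} := by
    ext j
    simp only [Finset.mem_filter, Finset.mem_univ, true_and, Finset.mem_singleton]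
    exact ⟨not_imp_comm.1 (h j), fun hj => hj ▸ hi⟩
  simp [crossCoeff_eq, hsupp]

theorem sum_prod_mul_prod_sqfreeInd (a : ι → ℕ → ℝ) (v : ι → ℕ) :
    ∑ d ∈ Finset.Icc 0 v, (∏ j, a j (d j)) * ∏ j, sqfreeInd ((v - d) j) =
      ∏ j, ∑ d ∈ Finset.Icc 0 (v j), a j d * sqfreeInd (v j - d) := by
  rw [Finset.prod_univ_sum]
  exact Finset.sum_congr rfl fun d _ => Finset.prod_mul_distrib.symm

theorem sum_crossCoeff (v : ι → ℕ) :
    ∑ d ∈ Finset.Icc 0 v, crossCoeff d * ∏ i, sqfreeInd ((v - d) i) =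
      if ∑ i, v i ≤ 1 then 1 else 0 := by
  have hfactor : ∀ i, ∏ j, ∑ d ∈ Finset.Icc 0 (v j), crossFactor i j d * sqfreeInd (v j - d) =
      if v = Pi.single i 1 then 1 else 0 := fun i => by
    simp [sum_crossFactor_mul_sqfreeInd, Fintype.prod_ite_zero, funext_iff]
  have hgeom : ∏ j, ∑ d ∈ Finset.Icc 0 (v j), (-1) ^ d * sqfreeInd (v j - d) =
      if v = 0 then 1 else 0 := by
    simp [sum_neg_one_pow_mul_sqfreeInd, Fintype.prod_ite_zero, funext_iff]
  simp only [crossCoeff, add_mul, Finset.sum_mul, Finset.sum_add_distrib]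
  rw [Finset.sum_comm, sum_prod_mul_prod_sqfreeInd fun _ d => (-1) ^ d, hgeom,
    Finset.sum_congr rfl fun i _ => (sum_prod_mul_prod_sqfreeInd (crossFactor i) v).trans
      (hfactor i), ite_zero_add_sum_ite_single]

theorem tsum_crossCoeff {x : ℝ} (h0 : 0 ≤ x) (h1 : x < 1) :
    ∑' d : ι → ℕ, crossCoeff d * ∏ i, x ^ d i =
      (1 + Fintype.card ι * x) / (1 + x) ^ Fintype.card ι := by
  have hgeom := hasSum_neg_one_pow_mul_pow h0 h1
  have hcross := hasSum_crossFactor_mul_pow (ι := ι) h0 h1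
  have hsummable := summable_pi_prod (ι := ι) (a := fun _ n => (-1) ^ n * x ^ n)
    fun _ => hgeom.summable
  have hsummable' := fun i => summable_pi_prod (a := fun j n => crossFactor i j n * x ^ n)
    fun j => (hcross i j).summable
  have htsum : ∀ i, ∑' d : ι → ℕ, ∏ j, (crossFactor i j (d j) * x ^ d j) =
      (1 + x)⁻¹ ^ Fintype.card ι * x := fun i => by
    rw [tsum_pi_prod (a := fun j n => crossFactor i j n * x ^ n) fun j => (hcross i j).summable]
    simp only [(hcross i _).tsum_eq, Finset.prod_mul_distrib]
    simp
  calc ∑' d : ι → ℕ, crossCoeff d * ∏ i, x ^ d i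
      = ∑' d : ι → ℕ, ((∏ j, (-1) ^ d j * x ^ d j) +
          ∑ i, ∏ j, (crossFactor i j (d j) * x ^ d j)) := by
        simp only [crossCoeff, add_mul, Finset.sum_mul, Finset.prod_mul_distrib]
    _ = (1 + x)⁻¹ ^ Fintype.card ι + ∑ _i : ι, (1 + x)⁻¹ ^ Fintype.card ι * x := by
        rw [hsummable.tsum_add (summable_sum fun i _ => hsummable' i),
          Summable.tsum_finsetSum fun i _ => hsummable' i,
          tsum_pi_prod (a := fun _ n => (-1) ^ n * x ^ n) fun _ => hgeom.summable]
        simp [htsum, hgeom.tsum_eq]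
    _ = (1 + Fintype.card ι * x) / (1 + x) ^ Fintype.card ι := by
        rw [Finset.sum_const, Finset.card_univ, nsmul_eq_mul, inv_pow]
        ring

end LocalCoefficients

/-! ### Two estimates for series -/

theorem abs_tsum_mul_sub_tsum_mul_le {ι : Type*} {b x y w : ι → ℝ}
    (hxy : ∀ i, |x i - y i| ≤ w i) (hw : Summable fun i => |b i| * w i)
    (hy : Summable fun i => b i * y i) :
    |∑' i, b i * x i - ∑' i, b i * y i| ≤ ∑' i, |b i| * w i := by
  have hbound (i : ι) : ‖b i * (x i - y i)‖ ≤ |b i| * w i := by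
    rw [Real.norm_eq_abs, abs_mul]
    exact mul_le_mul_of_nonneg_left (hxy i) (abs_nonneg _)
  have hx : Summable fun i => b i * x i :=
    ((Summable.of_norm_bounded hw hbound).add hy).congr fun i => by ring
  rw [← hx.tsum_sub hy, ← Real.norm_eq_abs]
  exact tsum_of_norm_bounded hw.hasSum fun i => by rw [← mul_sub]; exact hbound i

theorem sum_range_succ_pow_le {q : ℝ} (hq : 2 ≤ q) (n : ℕ) :
    ∑ m ∈ Finset.range (n + 1), q ^ m ≤ 2 * q ^ n := by
  induction n with
  | zero => simp
  | succ n ih =>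
    rw [Finset.sum_range_succ, pow_succ]
    nlinarith [pow_pos (by linarith : 0 < q) n]

theorem summable_inv_pow {q : ℝ} (hq : 1 < q) : Summable fun m : ℕ => q⁻¹ ^ m :=
  summable_geometric_of_lt_one (by positivity) (inv_lt_one_of_one_lt₀ hq)

theorem tsum_inv_pow_le {q : ℝ} (hq : 2 ≤ q) : ∑' m : ℕ, q⁻¹ ^ m ≤ 2 := by
  have hinv : q⁻¹ ≤ 2⁻¹ := inv_anti₀ two_pos hq
  rw [tsum_geometric_of_lt_one (by positivity) (by linarith), inv_le_comm₀ (by linarith) two_pos]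
  linarith

theorem pow_mul_min_div_le {q : ℝ} (hq : 0 < q) (e m : ℕ) :
    q ^ m * min 1 (q ^ e / q ^ (2 * m)) ≤ q ^ e * q⁻¹ ^ m := by
  refine (mul_le_mul_of_nonneg_left (min_le_right _ _) (by positivity)).trans_eq ?_
  rw [inv_pow, two_mul, pow_add]
  field_simp

theorem summable_pow_mul_min_div {q : ℝ} (hq : 1 < q) (e : ℕ) :
    Summable fun m : ℕ => q ^ m * min 1 (q ^ e / q ^ (2 * m)) :=
  .of_nonneg_of_le (fun m => by positivity) (pow_mul_min_div_le (by positivity) e)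
    ((summable_inv_pow hq).mul_left _)

theorem tsum_pow_mul_min_div_le {q : ℝ} (hq : 2 ≤ q) (e : ℕ) :
    ∑' m : ℕ, q ^ m * min 1 (q ^ e / q ^ (2 * m)) ≤ 4 * √q ^ e := by
  have hq_pos : 0 < q := by linarith
  have hsqrt : 1 ≤ √q := Real.one_le_sqrt.2 (by linarith)
  have hsqrt_pow (m : ℕ) : √q ^ (2 * m) = q ^ m := by rw [pow_mul, Real.sq_sqrt hq_pos.le]
  have hsummable := summable_pow_mul_min_div (by linarith : 1 < q) e
  set M := e / 2
  have hhead : ∑ m ∈ Finset.range (M + 1), q ^ m * min 1 (q ^ e / q ^ (2 * m)) ≤ 2 * √q ^ e :=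
    calc ∑ m ∈ Finset.range (M + 1), q ^ m * min 1 (q ^ e / q ^ (2 * m))
        ≤ ∑ m ∈ Finset.range (M + 1), q ^ m := Finset.sum_le_sum fun m _ =>
          mul_le_of_le_one_right (by positivity) (min_le_left _ _)
      _ ≤ 2 * √q ^ (2 * M) := (sum_range_succ_pow_le hq M).trans_eq (by rw [hsqrt_pow])
      _ ≤ 2 * √q ^ e := by gcongr; omega
  have htail_term (m : ℕ) : q ^ (m + (M + 1)) * min 1 (q ^ e / q ^ (2 * (m + (M + 1)))) ≤
      √q ^ e * q⁻¹ ^ m := by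
    refine (pow_mul_min_div_le hq_pos e _).trans ?_
    rw [pow_add, mul_comm (q⁻¹ ^ m), ← mul_assoc]
    refine mul_le_mul_of_nonneg_right ?_ (by positivity)
    rw [inv_pow, ← div_eq_mul_inv, div_le_iff₀ (by positivity), ← hsqrt_pow, ← hsqrt_pow, ← pow_add]
    exact pow_le_pow_right₀ hsqrt (by omega)
  have htail : ∑' m : ℕ, q ^ (m + (M + 1)) * min 1 (q ^ e / q ^ (2 * (m + (M + 1)))) ≤
      √q ^ e * 2 :=
    calc ∑' m : ℕ, q ^ (m + (M + 1)) * min 1 (q ^ e / q ^ (2 * (m + (M + 1))))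
        ≤ ∑' m : ℕ, √q ^ e * q⁻¹ ^ m :=
          ((summable_nat_add_iff _).2 hsummable).tsum_le_tsum htail_term
            ((summable_inv_pow (by linarith)).mul_left _)
      _ = √q ^ e * ∑' m : ℕ, q⁻¹ ^ m := tsum_mul_left
      _ ≤ √q ^ e * 2 := by gcongr; exact tsum_inv_pow_le hq
  rw [← hsummable.sum_add_tsum_nat_add (M + 1)]
  linarith

/-! ### Systems of primes -/

section ExponentVectors

variable {J Γ : Type*} [CommGroup Γ]

/-- The degree of an exponent vector `φ`, which stands for the product of the primes `P : J` with
multiplicities `φ P`, when the prime `P` has degree `deg P`. -/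
def expDeg (deg : J → ℕ) (φ : J →₀ ℕ) : ℕ := φ.sum fun P n => n * deg P

/-- The class in `Γ` of an exponent vector, when the prime `P` has class `cl P`. -/
def expCls (cl : J → Γ) (φ : J →₀ ℕ) : Γ := φ.prod fun P n => cl P ^ n

/-- The exponent vectors of degree `e` and class `γ`. -/
def expFiber (deg : J → ℕ) (cl : J → Γ) (e : ℕ) (γ : Γ) : Set (J →₀ ℕ) :=
  {φ | expDeg deg φ = e ∧ expCls cl φ = γ}

theorem expDeg_add (deg : J → ℕ) (φ ψ : J →₀ ℕ) :
    expDeg deg (φ + ψ) = expDeg deg φ + expDeg deg ψ := by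
  classical
  exact Finsupp.sum_add_index' (by simp) fun P m n => add_mul m n (deg P)

theorem expCls_add (cl : J → Γ) (φ ψ : J →₀ ℕ) :
    expCls cl (φ + ψ) = expCls cl φ * expCls cl ψ := by
  classical
  exact Finsupp.prod_add_index' (by simp) fun P m n => pow_add (cl P) m n

theorem pow_expDeg {R : Type*} [CommMonoid R] (deg : J → ℕ) (y : R) (φ : J →₀ ℕ) :
    y ^ expDeg deg φ = φ.prod fun P n => (y ^ deg P) ^ n := by
  rw [expDeg, Finsupp.sum, ← Finset.prod_pow_eq_pow_sum]
  exact Finset.prod_congr rfl fun P _ => by dsimp only; rw [← pow_mul, mul_comm]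

theorem expDeg_le_of_add_mem_expFiber {deg : J → ℕ} {cl : J → Γ} {e : ℕ} {γ : Γ} {D E : J →₀ ℕ}
    (h : D + E ∈ expFiber deg cl e γ) : expDeg deg D ≤ e := by
  have := h.1
  rw [expDeg_add] at this
  omega

theorem add_mem_expFiber_iff {deg : J → ℕ} {cl : J → Γ} {e : ℕ} {γ : Γ} {D E : J →₀ ℕ}
    (hD : expDeg deg D ≤ e) : D + E ∈ expFiber deg cl e γ ↔
      E ∈ expFiber deg cl (e - expDeg deg D) (γ * (expCls cl D)⁻¹) := by
  simp only [expFiber, Set.mem_ofPred_eq, expDeg_add, expCls_add, eq_mul_inv_iff_mul_eq,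
    mul_comm (expCls cl E)]
  exact and_congr_left' (by omega)

end ExponentVectors

/-- A system of primes with degrees and classes in which the exponent vectors of given degree are
equidistributed over the classes up to a bounded error: `c` is the density of each class. -/
structure PrimeSystem {J Γ : Type*} [CommGroup Γ] (deg : J → ℕ) (cl : J → Γ) (q c : ℝ) :
    Prop where
  two_le_q : 2 ≤ q
  two_le_deg : ∀ P, 2 ≤ deg P
  finite : ∀ e γ, (expFiber deg cl e γ).Finite
  c_nonneg : 0 ≤ c
  c_le_one : c ≤ 1
  count : ∀ e γ, |((expFiber deg cl e γ).ncard : ℝ) - c * q ^ e| ≤ 1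

namespace PrimeSystem

variable {J Γ : Type*} [CommGroup Γ] {deg : J → ℕ} {cl : J → Γ} {q c : ℝ}

theorem q_pos (H : PrimeSystem deg cl q c) : 0 < q := by linarith [H.two_le_q]

theorem sqrt_sq (H : PrimeSystem deg cl q c) : √q ^ 2 = q := Real.sq_sqrt H.q_pos.le

theorem sqrt_pow (H : PrimeSystem deg cl q c) (m : ℕ) : √q ^ (2 * m) = q ^ m := by
  rw [pow_mul, H.sqrt_sq]

theorem one_lt_sqrt (H : PrimeSystem deg cl q c) : 1 < √q := by
  rw [Real.lt_sqrt one_pos.le]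
  linarith [H.two_le_q]

theorem inv_pow_eq_inv_sqrt_pow_sq (H : PrimeSystem deg cl q c) (m : ℕ) :
    (q ^ m)⁻¹ = ((√q)⁻¹ ^ m) ^ 2 := by
  rw [← H.sqrt_pow, ← inv_pow, ← pow_mul, mul_comm]

theorem inv_sqrt_pow_deg_le (H : PrimeSystem deg cl q c) (P : J) : (√q)⁻¹ ^ deg P ≤ 1 / 2 :=
  calc (√q)⁻¹ ^ deg P
      ≤ (√q)⁻¹ ^ 2 := pow_le_pow_of_le_one (by positivity)
        (inv_le_one_of_one_le₀ H.one_lt_sqrt.le) (H.two_le_deg P)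
    _ = q⁻¹ := by rw [inv_pow, H.sqrt_sq]
    _ ≤ 1 / 2 := by rw [one_div]; exact inv_anti₀ two_pos H.two_le_q

theorem inv_pow_deg_le_inv_sqrt_pow_deg (H : PrimeSystem deg cl q c) (P : J) :
    (q ^ deg P)⁻¹ ≤ (√q)⁻¹ ^ deg P := by
  rw [H.inv_pow_eq_inv_sqrt_pow_sq]
  exact pow_le_of_le_one (by positivity) (by linarith [H.inv_sqrt_pow_deg_le P]) two_ne_zero

theorem inv_sqrt_pow_deg_mul_inv_pow_deg (H : PrimeSystem deg cl q c) (P : J) :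
    (√q)⁻¹ ^ deg P * (q ^ deg P)⁻¹ = ((√q)⁻¹ ^ 3) ^ deg P := by
  rw [H.inv_pow_eq_inv_sqrt_pow_sq]
  ring

theorem ncard_expFiber_le (H : PrimeSystem deg cl q c) (e : ℕ) (γ : Γ) :
    ((expFiber deg cl e γ).ncard : ℝ) ≤ 2 * q ^ e := by
  have hcount := (abs_le.1 (H.count e γ)).2
  have hpow : 1 ≤ q ^ e := one_le_pow₀ (by linarith [H.two_le_q])
  nlinarith [H.c_le_one]

theorem abs_ncard_add_mem_expFiber_sub_le (H : PrimeSystem deg cl q c) (e : ℕ) (γ : Γ)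
    (D : J →₀ ℕ) :
    |({E | D + E ∈ expFiber deg cl e γ}.ncard : ℝ) - c * (q ^ e / q ^ expDeg deg D)| ≤
      min 1 (q ^ e / q ^ expDeg deg D) := by
  have hq := H.two_le_q
  have hq_pos := H.q_pos
  by_cases hD : expDeg deg D ≤ e
  · have hratio : q ^ e / q ^ expDeg deg D = q ^ (e - expDeg deg D) := by
      rw [pow_sub₀ _ hq_pos.ne' hD, div_eq_mul_inv]
    simp only [add_mem_expFiber_iff hD, Set.ofPred_mem_eq, hratio]
    rw [min_eq_left (one_le_pow₀ (by linarith))]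
    exact H.count _ _
  · have hempty : {E | D + E ∈ expFiber deg cl e γ} = ∅ :=
      Set.eq_empty_of_forall_notMem fun E hE => hD (expDeg_le_of_add_mem_expFiber hE)
    have hratio : q ^ e / q ^ expDeg deg D ≤ 1 :=
      div_le_one_of_le₀ (pow_le_pow_right₀ (by linarith) (by omega)) (by positivity)
    rw [hempty, Set.ncard_empty, Nat.cast_zero, zero_sub, abs_neg, min_eq_right hratio,
      abs_of_nonneg (mul_nonneg H.c_nonneg (by positivity))]
    exact mul_le_of_le_one_left (by positivity) H.c_le_one

section FiniteClasses

variable [Finite Γ]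

theorem finite_deg_eq (H : PrimeSystem deg cl q c) (e : ℕ) :
    {φ : J →₀ ℕ | expDeg deg φ = e}.Finite :=
  (Set.finite_iUnion fun γ => H.finite e γ).subset fun φ hφ =>
    Set.mem_iUnion.2 ⟨expCls cl φ, hφ, rfl⟩

theorem finite_deg_le (H : PrimeSystem deg cl q c) (e : ℕ) :
    {φ : J →₀ ℕ | expDeg deg φ ≤ e}.Finite :=
  ((Set.finite_Iic e).biUnion fun m _ => H.finite_deg_eq m).subset fun _ hφ =>
    Set.mem_biUnion (Set.mem_Iic.2 hφ) rfl

theorem ncard_deg_eq_le (H : PrimeSystem deg cl q c) (e : ℕ) :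
    ({φ : J →₀ ℕ | expDeg deg φ = e}.ncard : ℝ) ≤ 2 * Nat.card Γ * q ^ e := by
  have := Fintype.ofFinite Γ
  have hunion : {φ : J →₀ ℕ | expDeg deg φ = e} =
      ⋃ γ ∈ (Finset.univ : Finset Γ), expFiber deg cl e γ := by
    ext φ; simp [expFiber]
  calc ({φ : J →₀ ℕ | expDeg deg φ = e}.ncard : ℝ)
      ≤ ∑ γ : Γ, ((expFiber deg cl e γ).ncard : ℝ) := by
        rw [hunion]; exact_mod_cast Finset.set_ncard_biUnion_le _ _
    _ ≤ ∑ _γ : Γ, 2 * q ^ e := Finset.sum_le_sum fun γ _ => H.ncard_expFiber_le e γ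
    _ = 2 * Nat.card Γ * q ^ e := by
        rw [Finset.sum_const, Finset.card_univ, nsmul_eq_mul, Nat.card_eq_fintype_card]; ring

theorem sum_deg_le (H : PrimeSystem deg cl q c) {w : ℕ → ℝ} (hw : ∀ m, 0 ≤ w m)
    (hs : Summable fun m => q ^ m * w m) (u : Finset (J →₀ ℕ)) :
    ∑ φ ∈ u, w (expDeg deg φ) ≤ 2 * Nat.card Γ * ∑' m, q ^ m * w m := by
  classical
  have hq := H.q_pos
  have hfiber (m : ℕ) : ∑ φ ∈ u with expDeg deg φ = m, w (expDeg deg φ) ≤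
      2 * Nat.card Γ * (q ^ m * w m) := by
    have hcard : ((u.filter (expDeg deg · = m)).card : ℝ) ≤ 2 * Nat.card Γ * q ^ m := by
      refine le_trans ?_ (H.ncard_deg_eq_le m)
      rw [← Set.ncard_coe_finset]
      exact Nat.cast_le.2
        (Set.ncard_le_ncard (fun φ hφ => (Finset.mem_filter.1 hφ).2) (H.finite_deg_eq m))
    rw [Finset.sum_congr rfl fun φ hφ => by rw [(Finset.mem_filter.1 hφ).2], Finset.sum_const,
      nsmul_eq_mul, ← mul_assoc]
    exact mul_le_mul_of_nonneg_right hcard (hw m)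
  rw [← Finset.sum_fiberwise_of_maps_to (t := u.image (expDeg deg)) (g := expDeg deg)
    fun φ hφ => Finset.mem_image_of_mem _ hφ, ← tsum_mul_left]
  refine (Finset.sum_le_sum fun m _ => hfiber m).trans
    ((hs.mul_left _).sum_le_tsum _ fun m _ => ?_)
  have := hw m
  positivity

theorem summable_deg (H : PrimeSystem deg cl q c) {w : ℕ → ℝ} (hw : ∀ m, 0 ≤ w m)
    (hs : Summable fun m => q ^ m * w m) : Summable fun φ : J →₀ ℕ => w (expDeg deg φ) :=
  summable_of_sum_le (fun _ => hw _) (H.sum_deg_le hw hs)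

theorem tsum_deg_le (H : PrimeSystem deg cl q c) {w : ℕ → ℝ} (hw : ∀ m, 0 ≤ w m)
    (hs : Summable fun m => q ^ m * w m) :
    ∑' φ : J →₀ ℕ, w (expDeg deg φ) ≤ 2 * Nat.card Γ * ∑' m, q ^ m * w m :=
  (H.summable_deg hw hs).tsum_le_of_sum_le (H.sum_deg_le hw hs)

theorem summable_primes (H : PrimeSystem deg cl q c) :
    Summable fun P => ((√q)⁻¹ ^ 3) ^ deg P := by
  have hvectors : Summable fun φ : J →₀ ℕ => ((√q)⁻¹ ^ 3) ^ expDeg deg φ := by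
    refine H.summable_deg (w := fun m => ((√q)⁻¹ ^ 3) ^ m) (fun m => by positivity) ?_
    refine (summable_inv_pow H.one_lt_sqrt).congr fun m => ?_
    have hsqrt_pos : 0 < √q := by linarith [H.one_lt_sqrt]
    have hbase : (√q)⁻¹ = √q ^ 2 * (√q)⁻¹ ^ 3 := by field_simp
    rw [← mul_pow, ← H.sqrt_sq, Real.sqrt_sq (Real.sqrt_nonneg q), ← hbase]
  refine (hvectors.comp_injective (i := fun P : J => Finsupp.single P 1)
    (Finsupp.single_left_injective one_ne_zero)).congr fun P => ?_
  simp [expDeg]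

end FiniteClasses

/-! ### Squarefree exponent vectors -/

theorem exists_two_nsmul_eq_of_prod_sqCoeff_ne_zero {D : J →₀ ℕ}
    (hD : (D.prod fun _ d => sqCoeff d) ≠ 0) : ∃ E : J →₀ ℕ, 2 • E = D := by
  refine ⟨D.mapRange (· / 2) (by simp), Finsupp.ext fun P => ?_⟩
  simp only [Finsupp.smul_apply, Finsupp.mapRange_apply, smul_eq_mul]
  by_cases hP : P ∈ D.support
  · have hcoeff : sqCoeff (D P) ≠ 0 := Finset.prod_ne_zero_iff.1 hD P hP
    rw [Finsupp.mem_support_iff] at hP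
    have : D P = 2 := by
      by_contra h
      simp [sqCoeff, hP, h] at hcoeff
    omega
  · rw [Finsupp.notMem_support_iff] at hP
    omega

theorem abs_prod_sqCoeff_le (D : J →₀ ℕ) : |D.prod fun _ d => sqCoeff d| ≤ 1 := by
  rw [Finsupp.prod, Finset.abs_prod]
  refine Finset.prod_le_one (fun _ _ => abs_nonneg _) fun P _ => ?_
  unfold sqCoeff
  split_ifs <;> simp

theorem prod_sqCoeff_mul_pow (deg : J → ℕ) (q : ℝ) (D : J →₀ ℕ) :
    (D.prod fun P d => sqCoeff d * (q ^ deg P)⁻¹ ^ d) =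
      (D.prod fun _ d => sqCoeff d) * (q ^ expDeg deg D)⁻¹ := by
  rw [← inv_pow, pow_expDeg, ← Finsupp.prod_mul]
  simp only [inv_pow]

theorem summable_sqCoeff_primes [Finite Γ] (H : PrimeSystem deg cl q c) :
    Summable fun z : J × {d : ℕ // d ≠ 0} => |sqCoeff z.2.1 * (q ^ deg z.1)⁻¹ ^ z.2.1| := by
  have hq := H.q_pos
  have hgeom : Summable fun d : {d : ℕ // d ≠ 0} => (1 / 2 : ℝ) ^ d.1 :=
    summable_geometric_two.comp_injective Subtype.val_injective
  refine .of_nonneg_of_le (fun _ => abs_nonneg _) ?_ ((H.summable_primes.mul_left 4).mul_of_nonneg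
    hgeom (fun P => by positivity) (fun d => by positivity))
  rintro ⟨P, d, hd⟩
  dsimp only
  by_cases hd_two : d = 2
  · subst hd_two
    have hsq : (q ^ deg P)⁻¹ ^ 2 ≤ ((√q)⁻¹ ^ 3) ^ deg P := by
      rw [← H.inv_sqrt_pow_deg_mul_inv_pow_deg, sq]
      exact mul_le_mul_of_nonneg_right (H.inv_pow_deg_le_inv_sqrt_pow_deg P) (by positivity)
    have hcoeff : |sqCoeff 2 * (q ^ deg P)⁻¹ ^ 2| = (q ^ deg P)⁻¹ ^ 2 := by
      simp [sqCoeff, abs_of_pos hq]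
    rw [hcoeff]
    linarith
  · simp only [sqCoeff, hd, hd_two, if_false, zero_mul, abs_zero]
    positivity

/-- The density `∏ P, (1 - q ^ (-2 * deg P))` of the squarefree exponent vectors, as the sum of the
expanded product. -/
noncomputable def sqfreeDensity (deg : J → ℕ) (q : ℝ) : ℝ :=
  ∑' D : J →₀ ℕ, D.prod fun P d => sqCoeff d * (q ^ deg P)⁻¹ ^ d

theorem hasProd_sqfreeDensity [Finite Γ] (H : PrimeSystem deg cl q c) :
    HasProd (fun P => 1 - (q ^ deg P)⁻¹ ^ 2) (sqfreeDensity deg q) := by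
  have hexpand : HasProd _ (sqfreeDensity deg q) :=
    hasProd_tsum_finsupp_prod (a := fun P d => sqCoeff d * (q ^ deg P)⁻¹ ^ d)
      (by simp [sqCoeff]) H.summable_sqCoeff_primes
  convert hexpand using 2 with P
  rw [tsum_eq_sum (s := {0, 2}) fun d hd => ?_]
  · simp [sqCoeff]; ring
  · simp only [Finset.mem_insert, Finset.mem_singleton, not_or] at hd
    simp [sqCoeff, hd.1, hd.2]

/-- The squarefree exponent vectors of degree `e` and class `γ`. -/
def sqfreeSet (deg : J → ℕ) (cl : J → Γ) (e : ℕ) (γ : Γ) : Set (J →₀ ℕ) :=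
  {φ ∈ expFiber deg cl e γ | ∀ P, φ P ≤ 1}

theorem prod_sqfreeInd (φ : J →₀ ℕ) [Decidable (∀ P, φ P ≤ 1)] :
    (φ.prod fun _ d => sqfreeInd d) = if ∀ P, φ P ≤ 1 then 1 else 0 := by
  by_cases h : ∀ P, φ P ≤ 1
  · rw [if_pos h]
    exact Finset.prod_eq_one fun P _ => by simp [sqfreeInd, h P]
  · rw [if_neg h]
    push Not at h
    obtain ⟨P, hP⟩ := h
    exact Finset.prod_eq_zero (Finsupp.mem_support_iff.2 (by omega)) (i := P)
      (by simp [sqfreeInd, hP])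

theorem ncard_sqfree_eq_sum {A : Set (J →₀ ℕ)} (hA : A.Finite) :
    ({φ ∈ A | ∀ P, φ P ≤ 1}.ncard : ℝ) = ∑ φ ∈ hA.toFinset, φ.prod fun _ d => sqfreeInd d := by
  classical
  simp only [prod_sqfreeInd]
  rw [Finset.sum_boole, ← Set.ncard_coe_finset]
  congr 2
  ext φ
  simp

theorem ncard_sqfreeSet_le (H : PrimeSystem deg cl q c) (e : ℕ) (γ : Γ) :
    ((sqfreeSet deg cl e γ).ncard : ℝ) ≤ 2 * q ^ e :=
  le_trans (Nat.cast_le.2 (Set.ncard_le_ncard (fun _ h => h.1) (H.finite e γ)))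
    (H.ncard_expFiber_le e γ)

theorem ncard_sqfreeSet_eq_tsum [Finite Γ] (H : PrimeSystem deg cl q c) (e : ℕ) (γ : Γ) :
    ((sqfreeSet deg cl e γ).ncard : ℝ) = ∑' D : J →₀ ℕ,
      (D.prod fun _ d => sqCoeff d) * {E | D + E ∈ expFiber deg cl e γ}.ncard := by
  classical
  have hdivisor (D E : J →₀ ℕ) (h : D + E ∈ (H.finite e γ).toFinset) :
      D ∈ (H.finite_deg_le e).toFinset := by
    rw [Set.Finite.mem_toFinset] at h ⊢
    exact expDeg_le_of_add_mem_expFiber h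
  rw [sqfreeSet, ncard_sqfree_eq_sum (H.finite e γ),
    sum_finsupp_prod_eq_sum_mul_sum (b := sqCoeff) (s := fun _ => 1) sqCoeff_zero rfl
      (by simpa only [mul_one] using sum_sqCoeff) hdivisor,
    tsum_eq_sum (s := (H.finite_deg_le e).toFinset) fun D hD => ?_]
  · refine Finset.sum_congr rfl fun D _ => ?_
    simp only [Finsupp.prod, Finset.prod_const_one, Finset.sum_const, nsmul_eq_mul, mul_one]
    rw [← Set.ncard_coe_finset]
    congr 3
    ext E
    simp only [Finset.coe_filter, Set.mem_ofPred_eq, Set.Finite.mem_toFinset]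
    exact ⟨And.right, fun h => ⟨expDeg_le_of_add_mem_expFiber (add_comm D E ▸ h), h⟩⟩
  · have hempty : {E | D + E ∈ expFiber deg cl e γ} = ∅ :=
      Set.eq_empty_of_forall_notMem fun E hE =>
        hD (hdivisor D E ((H.finite e γ).mem_toFinset.2 hE))
    rw [hempty, Set.ncard_empty, Nat.cast_zero, mul_zero]

-- Only the doubles `2 • E` contribute, which is why the error is the square root of the main term.
theorem summable_and_tsum_abs_prod_sqCoeff_mul_min_le [Finite Γ] (H : PrimeSystem deg cl q c)
    (e : ℕ) :
    (Summable fun D : J →₀ ℕ =>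
      |D.prod fun _ d => sqCoeff d| * min 1 (q ^ e / q ^ expDeg deg D)) ∧
    ∑' D : J →₀ ℕ, |D.prod fun _ d => sqCoeff d| * min 1 (q ^ e / q ^ expDeg deg D) ≤
      8 * Nat.card Γ * √q ^ e := by
  have hq := H.q_pos
  set w : ℕ → ℝ := fun m => min 1 (q ^ e / q ^ m)
  have hw (m : ℕ) : 0 ≤ w m := by positivity
  set f : (J →₀ ℕ) → ℝ := fun D => |D.prod fun _ d => sqCoeff d| * w (expDeg deg D)
  have hdouble : Function.Injective fun E : J →₀ ℕ => 2 • E := nsmul_right_injective two_ne_zero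
  have hsupport : Function.support f ⊆ Set.range fun E : J →₀ ℕ => 2 • E := fun D hD =>
    exists_two_nsmul_eq_of_prod_sqCoeff_ne_zero fun h => hD (by simp [f, h])
  have hbound (E : J →₀ ℕ) : f (2 • E) ≤ w (2 * expDeg deg E) := by
    rw [two_mul, ← expDeg_add, ← two_nsmul]
    exact mul_le_of_le_one_left (hw _) (abs_prod_sqCoeff_le _)
  have hweights := summable_pow_mul_min_div (by linarith [H.two_le_q] : 1 < q) e
  have hsummable_weights := H.summable_deg (w := fun m => w (2 * m)) (fun m => hw _) hweights
  have hsummable_double : Summable fun E : J →₀ ℕ => f (2 • E) :=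
    .of_nonneg_of_le (fun E => mul_nonneg (abs_nonneg _) (hw _)) hbound hsummable_weights
  refine ⟨(hdouble.summable_iff fun D hD => by_contra fun h => hD (hsupport h)).1
    hsummable_double, ?_⟩
  calc ∑' D, f D = ∑' E : J →₀ ℕ, f (2 • E) := (hdouble.tsum_eq hsupport).symm
    _ ≤ ∑' E : J →₀ ℕ, w (2 * expDeg deg E) := hsummable_double.tsum_le_tsum hbound
        hsummable_weights
    _ ≤ 2 * Nat.card Γ * ∑' m, q ^ m * w (2 * m) :=
        H.tsum_deg_le (w := fun m => w (2 * m)) (fun m => hw _) hweights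
    _ ≤ 2 * Nat.card Γ * (4 * √q ^ e) := by gcongr; exact tsum_pow_mul_min_div_le H.two_le_q e
    _ = 8 * Nat.card Γ * √q ^ e := by ring

theorem abs_ncard_sqfreeSet_sub_le [Finite Γ] (H : PrimeSystem deg cl q c) (e : ℕ) (γ : Γ) :
    |((sqfreeSet deg cl e γ).ncard : ℝ) - c * sqfreeDensity deg q * q ^ e| ≤
      8 * Nat.card Γ * √q ^ e := by
  obtain ⟨hsummable, hbound⟩ := H.summable_and_tsum_abs_prod_sqCoeff_mul_min_le e
  have hmain_term (D : J →₀ ℕ) :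
      (D.prod fun _ d => sqCoeff d) * (c * (q ^ e / q ^ expDeg deg D)) =
        c * q ^ e * D.prod fun P d => sqCoeff d * (q ^ deg P)⁻¹ ^ d := by
    rw [prod_sqCoeff_mul_pow]; ring
  have hmain_summable : Summable fun D : J →₀ ℕ =>
      (D.prod fun _ d => sqCoeff d) * (c * (q ^ e / q ^ expDeg deg D)) := by
    simp only [hmain_term]
    exact (summable_finsupp_prod (a := fun P d => sqCoeff d * (q ^ deg P)⁻¹ ^ d)
      (by simp [sqCoeff]) H.summable_sqCoeff_primes).mul_left _
  have hmain : c * sqfreeDensity deg q * q ^ e = ∑' D : J →₀ ℕ,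
      (D.prod fun _ d => sqCoeff d) * (c * (q ^ e / q ^ expDeg deg D)) := by
    simp only [hmain_term, tsum_mul_left, sqfreeDensity]
    ring
  rw [H.ncard_sqfreeSet_eq_tsum, hmain]
  exact (abs_tsum_mul_sub_tsum_mul_le (H.abs_ncard_add_mem_expFiber_sub_le e γ) hsummable
    hmain_summable).trans hbound

end PrimeSystem

/-! ### Coprime tuples of squarefree exponent vectors -/

theorem prod_pow_le_mul_of_ne {ι : Type*} [Fintype ι] {u : ι → ℝ} (hu : ∀ l, 0 ≤ u l)
    (hu_le : ∀ l, u l ≤ 1) {d : ι → ℕ} {i j : ι} (hij : j ≠ i) (hi : d i ≠ 0)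
    (hj : d j ≠ 0) : ∏ l, u l ^ d l ≤ u i * u j := by
  classical
  have hrest : ∏ l ∈ (Finset.univ.erase i).erase j, u l ^ d l ≤ 1 :=
    Finset.prod_le_one (fun l _ => pow_nonneg (hu l) _) fun l _ => pow_le_one₀ (hu l) (hu_le l)
  rw [← Finset.mul_prod_erase _ _ (Finset.mem_univ i),
    ← Finset.mul_prod_erase _ _ (Finset.mem_erase.2 ⟨hij, Finset.mem_univ j⟩), ← mul_assoc]
  calc u i ^ d i * u j ^ d j * ∏ l ∈ (Finset.univ.erase i).erase j, u l ^ d l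
      ≤ u i ^ d i * u j ^ d j :=
        mul_le_of_le_one_right (mul_nonneg (pow_nonneg (hu i) _) (pow_nonneg (hu j) _)) hrest
    _ ≤ u i * u j := mul_le_mul (pow_le_of_le_one (hu i) (hu_le i) hi)
        (pow_le_of_le_one (hu j) (hu_le j) hj) (pow_nonneg (hu j) _) (hu i)

section RealProducts

variable {ι : Type*} [DecidableEq ι]

theorem abs_prod_sub_prod_le (s : Finset ι) {x y M : ι → ℝ}
    (hx : ∀ i, |x i| ≤ M i) (hy : ∀ i, |y i| ≤ M i) :
    |∏ i ∈ s, x i - ∏ i ∈ s, y i| ≤ ∑ i ∈ s, |x i - y i| * ∏ j ∈ s.erase i, M j := by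
  induction s using Finset.induction_on with
  | empty => simp
  | insert a s ha ih =>
    have hsplit : x a * ∏ i ∈ s, x i - y a * ∏ i ∈ s, y i =
        (x a - y a) * ∏ i ∈ s, x i + y a * (∏ i ∈ s, x i - ∏ i ∈ s, y i) := by ring
    rw [Finset.prod_insert ha, Finset.prod_insert ha, Finset.sum_insert ha,
      Finset.erase_insert ha, hsplit]
    refine (abs_add_le _ _).trans (add_le_add ?_ ?_)
    · rw [abs_mul, Finset.abs_prod]
      exact mul_le_mul_of_nonneg_left (Finset.prod_le_prod (fun _ _ => abs_nonneg _)
        fun i _ => hx i) (abs_nonneg _)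
    · rw [abs_mul]
      refine (mul_le_mul (hy a) ih (abs_nonneg _) ((abs_nonneg _).trans (hx a))).trans_eq ?_
      rw [Finset.mul_sum]
      refine Finset.sum_congr rfl fun i hi => ?_
      rw [Finset.erase_insert_of_ne (ne_of_mem_of_not_mem hi ha).symm,
        Finset.prod_insert (by simp [ha])]
      ring

variable [Fintype ι]

theorem abs_prod_sub_prod_mul_sq_le {x z : ι → ℝ} {κ C : ℝ}
    (hx : ∀ i, |x i| ≤ 2 * z i ^ 2) (hxz : ∀ i, |x i - κ * z i ^ 2| ≤ C * z i) :
    |∏ i, x i - ∏ i, κ * z i ^ 2| ≤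
      ∑ i, C * (2 + |κ|) ^ Fintype.card ι * (z i * ∏ j ∈ Finset.univ.erase i, z j ^ 2) := by
  have hκ := abs_nonneg κ
  have hx_le (i : ι) : |x i| ≤ (2 + |κ|) * z i ^ 2 := by nlinarith [hx i, sq_nonneg (z i)]
  have hmain_le (i : ι) : |κ * z i ^ 2| ≤ (2 + |κ|) * z i ^ 2 := by
    rw [abs_mul, abs_of_nonneg (sq_nonneg (z i))]
    gcongr
    linarith
  refine (abs_prod_sub_prod_le Finset.univ hx_le hmain_le).trans (Finset.sum_le_sum fun i _ => ?_)
  have herase : ∏ j ∈ Finset.univ.erase i, (2 + |κ|) * z j ^ 2 ≤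
      (2 + |κ|) ^ Fintype.card ι * ∏ j ∈ Finset.univ.erase i, z j ^ 2 := by
    rw [Finset.prod_mul_distrib, Finset.prod_const]
    exact mul_le_mul_of_nonneg_right (pow_le_pow_right₀ (by linarith) (Finset.card_le_univ _))
      (Finset.prod_nonneg fun j _ => sq_nonneg _)
  calc |x i - κ * z i ^ 2| * ∏ j ∈ Finset.univ.erase i, (2 + |κ|) * z j ^ 2
      ≤ (C * z i) * ((2 + |κ|) ^ Fintype.card ι * ∏ j ∈ Finset.univ.erase i, z j ^ 2) :=
        mul_le_mul (hxz i) herase (Finset.prod_nonneg fun j _ => by positivity)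
          ((abs_nonneg _).trans (hxz i))
    _ = C * (2 + |κ|) ^ Fintype.card ι * (z i * ∏ j ∈ Finset.univ.erase i, z j ^ 2) := by ring

theorem mul_pow_mul_prod_erase_sq {r : ℝ} (hr : r ≠ 0) (e : ι → ℕ) (y : ι → ℝ) (i : ι) :
    r ^ e i * y i * ∏ j ∈ Finset.univ.erase i, (r ^ e j * y j) ^ 2 =
      ((r ^ 2) ^ (∑ j, e j) * r⁻¹ ^ e i) * (y i * ∏ j ∈ Finset.univ.erase i, y j ^ 2) := by
  have hpow : (r ^ 2) ^ (∑ j, e j) * r⁻¹ ^ e i =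
      r ^ e i * ∏ j ∈ Finset.univ.erase i, (r ^ e j) ^ 2 := by
    rw [← Finset.add_sum_erase _ _ (Finset.mem_univ i), pow_add, ← Finset.prod_pow_eq_pow_sum]
    simp only [← pow_mul, mul_comm 2]
    rw [pow_mul, inv_pow]
    field_simp
  simp only [mul_pow, Finset.prod_mul_distrib]
  rw [hpow]
  ring

theorem abs_crossCoeff_mul_prod_pow_le {w : ι → ℝ} {t : ℝ} (hw : ∀ i, 0 ≤ w i)
    (hw_le : ∀ i, w i ≤ 1 / 2) (ht : 0 ≤ t) (hwt : ∀ i j, i ≠ j → w i * w j ≤ t) {d : ι → ℕ}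
    (hd : d ≠ 0) :
    |crossCoeff d * ∏ i, w i ^ d i| ≤
      4 * ((Fintype.card ι : ℝ) + 1) * t * ∏ i, (1 / 2 : ℝ) ^ d i := by
  obtain ⟨i, hi⟩ : ∃ i, d i ≠ 0 := Function.ne_iff.1 hd
  by_cases hj : ∀ j, j ≠ i → d j = 0
  · rw [crossCoeff_eq_zero hi hj, zero_mul, abs_zero]
    positivity
  push Not at hj
  obtain ⟨j, hji, hj⟩ := hj
  have hpow (l : ι) : w l ^ d l = (2 * w l) ^ d l * (1 / 2) ^ d l := by
    rw [← mul_pow]; congr 1; ring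
  have hprod : ∏ l, w l ^ d l ≤ 4 * t * ∏ l, (1 / 2 : ℝ) ^ d l := by
    rw [Finset.prod_congr rfl fun l _ => hpow l, Finset.prod_mul_distrib]
    gcongr
    have := prod_pow_le_mul_of_ne (u := fun l => 2 * w l) (fun l => by linarith [hw l])
      (fun l => by linarith [hw_le l]) hji hi hj
    linarith [hwt i j hji.symm]
  have hprod_nonneg : 0 ≤ ∏ l, w l ^ d l := Finset.prod_nonneg fun l _ => pow_nonneg (hw l) _
  rw [abs_mul, abs_of_nonneg hprod_nonneg]
  refine (mul_le_mul (abs_crossCoeff_le d) hprod hprod_nonneg (by positivity)).trans_eq ?_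
  ring

end RealProducts

section Tuples

variable {J ι : Type*} [Fintype ι]

/-- Exponent vectors with values in tuples are tuples of exponent vectors. -/
noncomputable def tupleEquiv (J ι : Type*) [Fintype ι] : (J →₀ (ι → ℕ)) ≃ (ι → J →₀ ℕ) where
  toFun D i := D.mapRange (fun v => v i) rfl
  invFun φ := by
    classical
    exact Finsupp.onFinset (Finset.univ.biUnion fun i => (φ i).support) (fun P i => φ i P)
      fun P hP => by
        obtain ⟨i, hi⟩ := Function.ne_iff.1 hP
        exact Finset.mem_biUnion.2 ⟨i, Finset.mem_univ i, Finsupp.mem_support_iff.2 hi⟩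
  left_inv D := by ext P i; simp
  right_inv φ := by ext i P; simp

@[simp]
theorem tupleEquiv_apply (D : J →₀ (ι → ℕ)) (i : ι) (P : J) : tupleEquiv J ι D i P = D P i := by
  simp [tupleEquiv]

theorem tupleEquiv_add (D E : J →₀ (ι → ℕ)) (i : ι) :
    tupleEquiv J ι (D + E) i = tupleEquiv J ι D i + tupleEquiv J ι E i := by
  ext P; simp

theorem prod_tupleEquiv_prod {R : Type*} [CommMonoid R] {y : ι → J → ℕ → R}
    (hy : ∀ i P, y i P 0 = 1) (D : J →₀ (ι → ℕ)) :
    ∏ i, (tupleEquiv J ι D i).prod (y i) = D.prod fun P d => ∏ i, y i P (d i) := by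
  rw [Finsupp.prod, Finset.prod_comm]
  refine Finset.prod_congr rfl fun i _ => ?_
  rw [Finsupp.prod_of_support_subset (s := D.support) _ ?_ _ fun P _ => hy i P]
  · simp
  · intro P hP
    rw [Finsupp.mem_support_iff] at hP ⊢
    intro h
    simp [h] at hP

theorem prod_ite_sum_le_one (g : J →₀ (ι → ℕ)) [Decidable (∀ P, ∑ i, g P i ≤ 1)] :
    (g.prod fun _ v => if ∑ i, v i ≤ 1 then (1 : ℝ) else 0) =
      if ∀ P, ∑ i, g P i ≤ 1 then 1 else 0 := by
  by_cases h : ∀ P, ∑ i, g P i ≤ 1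
  · rw [if_pos h]
    exact Finset.prod_eq_one fun P _ => by simp [h P]
  · rw [if_neg h]
    push Not at h
    obtain ⟨P, hP⟩ := h
    refine Finset.prod_eq_zero (Finsupp.mem_support_iff.2 fun hzero => ?_) (i := P)
      (by simp [hP])
    simp [hzero] at hP

theorem finite_setOf_tupleEquiv_mem {A : ι → Set (J →₀ ℕ)} (hA : ∀ i, (A i).Finite) :
    {g : J →₀ (ι → ℕ) | ∀ i, tupleEquiv J ι g i ∈ A i}.Finite :=
  ((Set.Finite.pi' hA).preimage (tupleEquiv J ι).injective.injOn).subset fun _ hg => hg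

theorem prod_crossCoeff_mul_prod_pow [DecidableEq ι] (w : ι → J → ℝ) (D : J →₀ (ι → ℕ)) :
    (D.prod fun P d => crossCoeff d * ∏ i, w i P ^ d i) =
      (D.prod fun _ d => crossCoeff d) * ∏ i, (tupleEquiv J ι D i).prod fun P n => w i P ^ n := by
  rw [prod_tupleEquiv_prod (by simp), ← Finsupp.prod_mul]

end Tuples

namespace PrimeSystem

variable {J Γ : Type*} [CommGroup Γ] {deg : J → ℕ} {cl : J → Γ} {q c : ℝ}

/-- The squarefree exponent vectors `E` for which `D + E` has degree `e` and class `γ`. -/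
def sqfreeCofactors (deg : J → ℕ) (cl : J → Γ) (e : ℕ) (γ : Γ) (D : J →₀ ℕ) : Set (J →₀ ℕ) :=
  {E ∈ {E | D + E ∈ expFiber deg cl e γ} | ∀ P, E P ≤ 1}

theorem sqfreeCofactors_eq_sqfreeSet {e : ℕ} {D : J →₀ ℕ} (hD : expDeg deg D ≤ e) (γ : Γ) :
    sqfreeCofactors deg cl e γ D =
      sqfreeSet deg cl (e - expDeg deg D) (γ * (expCls cl D)⁻¹) := by
  ext E
  simp only [sqfreeCofactors, sqfreeSet, Set.mem_ofPred_eq, add_mem_expFiber_iff hD]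

theorem sqfreeCofactors_eq_empty {e : ℕ} {D : J →₀ ℕ} (hD : ¬ expDeg deg D ≤ e) (γ : Γ) :
    sqfreeCofactors deg cl e γ D = ∅ :=
  Set.eq_empty_of_forall_notMem fun _ hE => hD (expDeg_le_of_add_mem_expFiber hE.1)

theorem sqrt_pow_mul_inv_sqrt_pow_eq (H : PrimeSystem deg cl q c) {e m : ℕ} (hm : m ≤ e) :
    √q ^ e * (√q)⁻¹ ^ m = √q ^ (e - m) := by
  rw [pow_sub₀ _ (by linarith [H.one_lt_sqrt] : √q ≠ 0) hm, inv_pow]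

theorem ncard_sqfreeCofactors_le (H : PrimeSystem deg cl q c) (e : ℕ) (γ : Γ) (D : J →₀ ℕ) :
    ((sqfreeCofactors deg cl e γ D).ncard : ℝ) ≤ 2 * (√q ^ e * (√q)⁻¹ ^ expDeg deg D) ^ 2 := by
  by_cases hD : expDeg deg D ≤ e
  · rw [sqfreeCofactors_eq_sqfreeSet hD, H.sqrt_pow_mul_inv_sqrt_pow_eq hD, ← pow_mul, mul_comm _ 2,
      H.sqrt_pow]
    exact H.ncard_sqfreeSet_le _ _
  · rw [sqfreeCofactors_eq_empty hD, Set.ncard_empty, Nat.cast_zero]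
    positivity

theorem abs_ncard_sqfreeCofactors_sub_le [Finite Γ] (H : PrimeSystem deg cl q c) (e : ℕ) (γ : Γ)
    (D : J →₀ ℕ) :
    |((sqfreeCofactors deg cl e γ D).ncard : ℝ) -
        c * sqfreeDensity deg q * (√q ^ e * (√q)⁻¹ ^ expDeg deg D) ^ 2| ≤
      (8 * Nat.card Γ + |c * sqfreeDensity deg q|) * (√q ^ e * (√q)⁻¹ ^ expDeg deg D) := by
  have hκ := abs_nonneg (c * sqfreeDensity deg q)
  have hsqrt := H.one_lt_sqrt
  by_cases hD : expDeg deg D ≤ e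
  · rw [sqfreeCofactors_eq_sqfreeSet hD, H.sqrt_pow_mul_inv_sqrt_pow_eq hD, ← pow_mul, mul_comm _ 2,
      H.sqrt_pow]
    refine (H.abs_ncard_sqfreeSet_sub_le _ _).trans ?_
    gcongr
    linarith
  · have hscale_le : √q ^ e * (√q)⁻¹ ^ expDeg deg D ≤ 1 := by
      rw [inv_pow, ← div_eq_mul_inv, div_le_one (by positivity)]
      exact pow_le_pow_right₀ hsqrt.le (by omega)
    rw [sqfreeCofactors_eq_empty hD, Set.ncard_empty, Nat.cast_zero, zero_sub, abs_neg, abs_mul,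
      abs_sq]
    gcongr
    · linarith [(Nat.cast_nonneg _ : (0 : ℝ) ≤ Nat.card Γ)]
    · exact pow_le_of_le_one (by positivity) hscale_le two_ne_zero

variable {ι : Type*} [Fintype ι]

/-- The tuples of pairwise coprime squarefree exponent vectors of degrees `e` and classes `a`:
the condition on `∑ i, g P i` says that the product of the members is squarefree. -/
def sqfreeTuples (deg : J → ℕ) (cl : J → Γ) (e : ι → ℕ) (a : ι → Γ) : Set (J →₀ (ι → ℕ)) :=
  {g | (∀ P, ∑ i, g P i ≤ 1) ∧ ∀ i, tupleEquiv J ι g i ∈ expFiber deg cl (e i) (a i)}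

theorem finite_add_mem_expFiber (H : PrimeSystem deg cl q c) (e : ℕ) (γ : Γ) (D : J →₀ ℕ) :
    {E | D + E ∈ expFiber deg cl e γ}.Finite :=
  (H.finite e γ).preimage (add_right_injective D).injOn

theorem ncard_sqfreeTuples_eq_sum {e : ι → ℕ} {a : ι → Γ}
    (hfin : {g : J →₀ (ι → ℕ) | ∀ i, tupleEquiv J ι g i ∈ expFiber deg cl (e i) (a i)}.Finite) :
    ((sqfreeTuples deg cl e a).ncard : ℝ) =
      ∑ g ∈ hfin.toFinset, g.prod fun _ v => if ∑ i, v i ≤ 1 then (1 : ℝ) else 0 := by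
  classical
  simp only [prod_ite_sum_le_one]
  rw [Finset.sum_boole, ← Set.ncard_coe_finset]
  congr 2
  ext g
  simp [sqfreeTuples, and_comm]

theorem prod_inv_pow_deg_pow_eq (H : PrimeSystem deg cl q c) (φ : J →₀ ℕ) :
    (φ.prod fun P n => (q ^ deg P)⁻¹ ^ n) = ((√q)⁻¹ ^ expDeg deg φ) ^ 2 := by
  rw [← H.inv_pow_eq_inv_sqrt_pow_sq, ← inv_pow, pow_expDeg]
  simp only [inv_pow]

theorem prod_crossCoeff_mul_prod_main_eq [DecidableEq ι] (H : PrimeSystem deg cl q c) (κ : ℝ)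
    (e : ι → ℕ) (D : J →₀ (ι → ℕ)) :
    (D.prod fun _ d => crossCoeff d) *
        ∏ i, κ * (√q ^ e i * (√q)⁻¹ ^ expDeg deg (tupleEquiv J ι D i)) ^ 2 =
      κ ^ Fintype.card ι * q ^ (∑ i, e i) *
        D.prod fun P d => crossCoeff d * ∏ i, (q ^ deg P)⁻¹ ^ d i := by
  have hpow (m : ℕ) : (√q ^ m) ^ 2 = q ^ m := by rw [← pow_mul, mul_comm, H.sqrt_pow]
  rw [prod_crossCoeff_mul_prod_pow fun _ P => (q ^ deg P)⁻¹]
  simp only [H.prod_inv_pow_deg_pow_eq]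
  simp only [mul_pow, Finset.prod_mul_distrib, Finset.prod_const, Finset.card_univ, hpow,
    Finset.prod_pow_eq_pow_sum]
  ring

variable [DecidableEq ι] [Finite Γ]

theorem ncard_sqfreeTuples_eq_tsum (H : PrimeSystem deg cl q c) (e : ι → ℕ) (a : ι → Γ) :
    ((sqfreeTuples deg cl e a).ncard : ℝ) = ∑' D : J →₀ (ι → ℕ), (D.prod fun _ d => crossCoeff d) *
      ∏ i, ((sqfreeCofactors deg cl (e i) (a i) (tupleEquiv J ι D i)).ncard : ℝ) := by
  classical
  have hmem_fin := finite_setOf_tupleEquiv_mem fun i => H.finite (e i) (a i)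
  have hdivisor_fin := finite_setOf_tupleEquiv_mem fun i => H.finite_deg_le (e i)
  have hdivisor (D E : J →₀ (ι → ℕ)) (h : D + E ∈ hmem_fin.toFinset) :
      D ∈ hdivisor_fin.toFinset := by
    simp only [Set.Finite.mem_toFinset, Set.mem_ofPred_eq, tupleEquiv_add] at h ⊢
    exact fun i => expDeg_le_of_add_mem_expFiber (h i)
  rw [ncard_sqfreeTuples_eq_sum hmem_fin, sum_finsupp_prod_eq_sum_mul_sum (b := crossCoeff)
    (s := fun v => ∏ i, sqfreeInd (v i)) crossCoeff_zero (by simp [sqfreeInd]) sum_crossCoeff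
    hdivisor, tsum_eq_sum (s := hdivisor_fin.toFinset) fun D hD => ?_]
  · refine Finset.sum_congr rfl fun D _ => ?_
    simp only [sqfreeCofactors, ncard_sqfree_eq_sum (H.finite_add_mem_expFiber _ _ _)]
    rw [Finset.prod_univ_sum]
    congr 1
    refine Finset.sum_equiv (tupleEquiv J ι) (fun E => ?_) fun E _ =>
      (prod_tupleEquiv_prod (y := fun _ _ n => sqfreeInd n) (by simp [sqfreeInd]) E).symm
    simp only [Finset.mem_filter, Set.Finite.mem_toFinset, Set.mem_ofPred_eq, tupleEquiv_add,
      Fintype.mem_piFinset]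
    exact ⟨And.right, fun h =>
      ⟨fun i => expDeg_le_of_add_mem_expFiber (add_comm (tupleEquiv J ι D i) _ ▸ h i), h⟩⟩
  · simp only [Set.Finite.mem_toFinset, Set.mem_ofPred_eq, not_forall] at hD
    obtain ⟨i, hi⟩ := hD
    rw [Finset.prod_eq_zero (Finset.mem_univ i), mul_zero]
    rw [sqfreeCofactors_eq_empty hi, Set.ncard_empty, Nat.cast_zero]

theorem summable_crossCoeff_primes (H : PrimeSystem deg cl q c) {w : ι → J → ℝ}
    (hw : ∀ i P, 0 ≤ w i P) (hw_le : ∀ i P, w i P ≤ 1 / 2)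
    (hw_mul : ∀ i j P, i ≠ j → w i P * w j P ≤ ((√q)⁻¹ ^ 3) ^ deg P) :
    Summable fun z : J × {d : ι → ℕ // d ≠ 0} =>
      |crossCoeff z.2.1 * ∏ i, w i z.1 ^ z.2.1 i| := by
  have hgeom : Summable fun d : {d : ι → ℕ // d ≠ 0} => ∏ i, (1 / 2 : ℝ) ^ d.1 i :=
    (summable_pi_prod (ι := ι) (a := fun _ n => (1 / 2 : ℝ) ^ n)
      fun _ => summable_geometric_two).comp_injective Subtype.val_injective
  have hmajorant := (H.summable_primes.mul_left (4 * ((Fintype.card ι : ℝ) + 1))).mul_of_nonneg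
    hgeom (fun P => by positivity) (fun d => by positivity)
  refine .of_nonneg_of_le (fun _ => abs_nonneg _) ?_ hmajorant
  rintro ⟨P, d, hd⟩
  exact abs_crossCoeff_mul_prod_pow_le (fun i => hw i P) (fun i => hw_le i P) (by positivity)
    (fun i j => hw_mul i j P) hd

theorem summable_crossCoeff_mul_prod_inv_pow (H : PrimeSystem deg cl q c) :
    Summable fun z : J × {d : ι → ℕ // d ≠ 0} =>
      |crossCoeff z.2.1 * ∏ i, (q ^ deg z.1)⁻¹ ^ z.2.1 i| := by
  have hq := H.q_pos
  refine H.summable_crossCoeff_primes (w := fun _ P => (q ^ deg P)⁻¹) (fun _ P => by positivity)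
    (fun _ P => (H.inv_pow_deg_le_inv_sqrt_pow_deg P).trans (H.inv_sqrt_pow_deg_le P))
    (fun _ _ P _ => ?_)
  rw [← H.inv_sqrt_pow_deg_mul_inv_pow_deg]
  gcongr
  exact H.inv_pow_deg_le_inv_sqrt_pow_deg P

/-- The weights in the error term that arises when the count of the `i`-th members of the tuples
is replaced by its main term: a square root is lost at the index `i` only. -/
noncomputable def errWeight (q : ℝ) (deg : J → ℕ) (i j : ι) (P : J) : ℝ :=
  if j = i then (√q)⁻¹ ^ deg P else (q ^ deg P)⁻¹

theorem summable_crossCoeff_mul_prod_errWeight_pow (H : PrimeSystem deg cl q c) (i : ι) :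
    Summable fun z : J × {d : ι → ℕ // d ≠ 0} =>
      |crossCoeff z.2.1 * ∏ j, errWeight q deg i j z.1 ^ z.2.1 j| := by
  have hq := H.q_pos
  have hle (j : ι) (P : J) : errWeight q deg i j P ≤ (√q)⁻¹ ^ deg P := by
    unfold errWeight
    split_ifs
    exacts [le_rfl, H.inv_pow_deg_le_inv_sqrt_pow_deg P]
  have hnonneg (j : ι) (P : J) : 0 ≤ errWeight q deg i j P := by
    unfold errWeight; split_ifs <;> positivity
  refine H.summable_crossCoeff_primes hnonneg
    (fun j P => (hle j P).trans (H.inv_sqrt_pow_deg_le P)) fun j l P hjl => ?_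
  rw [← H.inv_sqrt_pow_deg_mul_inv_pow_deg]
  by_cases hj : j = i
  · have hl : errWeight q deg i l P = (q ^ deg P)⁻¹ := if_neg (hj ▸ hjl.symm)
    rw [hl]
    exact mul_le_mul_of_nonneg_right (hle j P) (by positivity)
  · have hj' : errWeight q deg i j P = (q ^ deg P)⁻¹ := if_neg hj
    rw [hj', mul_comm]
    exact mul_le_mul_of_nonneg_right (hle l P) (by positivity)

/-- The density of the pairwise coprime squarefree tuples indexed by `ι`. -/
noncomputable def tupleDensity (ι : Type*) [Fintype ι] [DecidableEq ι] (deg : J → ℕ) (q : ℝ) : ℝ :=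
  sqfreeDensity deg q ^ Fintype.card ι *
    ∑' D : J →₀ (ι → ℕ), D.prod fun P d => crossCoeff d * ∏ i, (q ^ deg P)⁻¹ ^ d i

theorem hasProd_tupleDensity (H : PrimeSystem deg cl q c) :
    HasProd (fun P => (1 - (q ^ deg P)⁻¹) ^ Fintype.card ι * (1 + Fintype.card ι * (q ^ deg P)⁻¹))
      (tupleDensity ι deg q) := by
  have hsqfree := H.hasProd_sqfreeDensity.map (powMonoidHom (Fintype.card ι))
    (continuous_pow (Fintype.card ι))
  have hcross := hasProd_tsum_finsupp_prod
    (a := fun P (d : ι → ℕ) => crossCoeff d * ∏ i, (q ^ deg P)⁻¹ ^ d i)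
    (by simp [crossCoeff_zero]) H.summable_crossCoeff_mul_prod_inv_pow
  convert! hsqfree.mul hcross using 1
  ext P
  have hx_nonneg : 0 ≤ (q ^ deg P)⁻¹ := inv_nonneg.2 (pow_nonneg H.q_pos.le _)
  have hx_lt : (q ^ deg P)⁻¹ < 1 := by
    linarith [H.inv_pow_deg_le_inv_sqrt_pow_deg P, H.inv_sqrt_pow_deg_le P]
  rw [tsum_crossCoeff hx_nonneg hx_lt]
  simp only [Function.comp_apply, powMonoidHom_apply]
  set x := (q ^ deg P)⁻¹
  have : 0 < 1 + x := by linarith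
  rw [show 1 - x ^ 2 = (1 - x) * (1 + x) by ring, mul_pow]
  field_simp

/-- The size `|Dᵢ| ^ (-1 / 2) * ∏ j ≠ i, |Dⱼ| ^ (-1)` of the error at the index `i`, where
`|Dⱼ| = q ^ deg Dⱼ`. -/
noncomputable def errScale (q : ℝ) (deg : J → ℕ) (i : ι) (D : J →₀ (ι → ℕ)) : ℝ :=
  (√q)⁻¹ ^ expDeg deg (tupleEquiv J ι D i) *
    ∏ j ∈ Finset.univ.erase i, ((√q)⁻¹ ^ expDeg deg (tupleEquiv J ι D j)) ^ 2

theorem errScale_nonneg (q : ℝ) (deg : J → ℕ) (i : ι) (D : J →₀ (ι → ℕ)) :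
    0 ≤ errScale q deg i D :=
  mul_nonneg (by positivity) (Finset.prod_nonneg fun _ _ => sq_nonneg _)

theorem summable_abs_prod_crossCoeff_mul_errScale (H : PrimeSystem deg cl q c) (i : ι) :
    Summable fun D : J →₀ (ι → ℕ) => |D.prod fun _ d => crossCoeff d| * errScale q deg i D := by
  refine (summable_finsupp_prod (a := fun P d => crossCoeff d * ∏ j, errWeight q deg i j P ^ d j)
    (by simp [crossCoeff_zero]) (H.summable_crossCoeff_mul_prod_errWeight_pow i)).abs.congr
    fun D => ?_
  have hself : ((tupleEquiv J ι D i).prod fun P n => errWeight q deg i i P ^ n) =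
      (√q)⁻¹ ^ expDeg deg (tupleEquiv J ι D i) := by
    simp only [pow_expDeg, errWeight, if_true]
  have hother : ∀ j ∈ Finset.univ.erase i,
      ((tupleEquiv J ι D j).prod fun P n => errWeight q deg i j P ^ n) =
        ((√q)⁻¹ ^ expDeg deg (tupleEquiv J ι D j)) ^ 2 := fun j hj => by
    simp only [errWeight, if_neg (Finset.ne_of_mem_erase hj), ← H.prod_inv_pow_deg_pow_eq]
  rw [prod_crossCoeff_mul_prod_pow (errWeight q deg i), abs_mul,
    ← Finset.mul_prod_erase _ _ (Finset.mem_univ i), hself, Finset.prod_congr rfl hother,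
    ← errScale, abs_of_nonneg (errScale_nonneg q deg i D)]

theorem abs_prod_ncard_sqfreeCofactors_sub_le (H : PrimeSystem deg cl q c) (e : ι → ℕ) (a : ι → Γ)
    (D : J →₀ (ι → ℕ)) :
    |∏ i, ((sqfreeCofactors deg cl (e i) (a i) (tupleEquiv J ι D i)).ncard : ℝ) -
        ∏ i, c * sqfreeDensity deg q *
          (√q ^ e i * (√q)⁻¹ ^ expDeg deg (tupleEquiv J ι D i)) ^ 2| ≤
      ∑ i, (8 * Nat.card Γ + |c * sqfreeDensity deg q|) *
        (2 + |c * sqfreeDensity deg q|) ^ Fintype.card ι *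
          ((q ^ (∑ j, e j) * (√q)⁻¹ ^ e i) * errScale q deg i D) := by
  have hsqrt : √q ≠ 0 := by linarith [H.one_lt_sqrt]
  refine (abs_prod_sub_prod_mul_sq_le (fun i => ?_) fun i =>
    H.abs_ncard_sqfreeCofactors_sub_le _ _ _).trans_eq (Finset.sum_congr rfl fun i _ => ?_)
  · rw [Nat.abs_cast]
    exact H.ncard_sqfreeCofactors_le _ _ _
  · rw [mul_pow_mul_prod_erase_sq hsqrt e
      (fun j => (√q)⁻¹ ^ expDeg deg (tupleEquiv J ι D j)), H.sqrt_sq, errScale]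

theorem hasSum_prod_crossCoeff_mul_prod_main (H : PrimeSystem deg cl q c) (e : ι → ℕ) :
    HasSum (fun D : J →₀ (ι → ℕ) => (D.prod fun _ d => crossCoeff d) *
        ∏ i, c * sqfreeDensity deg q *
          (√q ^ e i * (√q)⁻¹ ^ expDeg deg (tupleEquiv J ι D i)) ^ 2)
      (c ^ Fintype.card ι * tupleDensity ι deg q * q ^ ∑ i, e i) := by
  have hsum := ((summable_finsupp_prod
    (a := fun P (d : ι → ℕ) => crossCoeff d * ∏ i, (q ^ deg P)⁻¹ ^ d i) (by simp [crossCoeff_zero])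
    H.summable_crossCoeff_mul_prod_inv_pow).hasSum).mul_left
      ((c * sqfreeDensity deg q) ^ Fintype.card ι * q ^ ∑ i, e i)
  simp only [← H.prod_crossCoeff_mul_prod_main_eq] at hsum
  rw [tupleDensity]
  convert! hsum using 1
  ring

theorem exists_abs_ncard_sqfreeTuples_sub_le (H : PrimeSystem deg cl q c) (ι : Type*) [Fintype ι]
    [DecidableEq ι] :
    ∃ C : ℝ, 0 ≤ C ∧ ∀ (e : ι → ℕ) (a : ι → Γ),
      |((sqfreeTuples deg cl e a).ncard : ℝ) -
          c ^ Fintype.card ι * tupleDensity ι deg q * q ^ ∑ i, e i| ≤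
        C * q ^ (∑ i, e i) * ∑ i, (√q)⁻¹ ^ e i := by
  have hq := H.q_pos
  set κ := c * sqfreeDensity deg q
  set K := (8 * Nat.card Γ + |κ|) * (2 + |κ|) ^ Fintype.card ι
  set err : ι → (J →₀ (ι → ℕ)) → ℝ := fun i D =>
    |D.prod fun _ d => crossCoeff d| * errScale q deg i D
  have herr_summable (i : ι) : Summable (err i) := H.summable_abs_prod_crossCoeff_mul_errScale i
  have herr_nonneg (i : ι) : 0 ≤ ∑' D, err i D := tsum_nonneg fun D =>
    mul_nonneg (abs_nonneg _) (errScale_nonneg q deg i D)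
  refine ⟨K * ∑ i, ∑' D, err i D,
    mul_nonneg (by positivity) (Finset.sum_nonneg fun i _ => herr_nonneg i), fun e a => ?_⟩
  have hmain := H.hasSum_prod_crossCoeff_mul_prod_main e
  have hbound (D : J →₀ (ι → ℕ)) : |D.prod fun _ d => crossCoeff d| *
      ∑ i, K * ((q ^ (∑ j, e j) * (√q)⁻¹ ^ e i) * errScale q deg i D) =
        ∑ i, K * (q ^ (∑ j, e j) * (√q)⁻¹ ^ e i) * err i D := by
    rw [Finset.mul_sum]
    exact Finset.sum_congr rfl fun i _ => by ring
  rw [H.ncard_sqfreeTuples_eq_tsum, ← hmain.tsum_eq]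
  refine (abs_tsum_mul_sub_tsum_mul_le (H.abs_prod_ncard_sqfreeCofactors_sub_le e a)
    ((summable_sum fun i _ => (herr_summable i).mul_left _).congr fun D => (hbound D).symm)
    hmain.summable).trans ?_
  rw [tsum_congr hbound, Summable.tsum_finsetSum fun i _ => (herr_summable i).mul_left _,
    Finset.mul_sum]
  refine Finset.sum_le_sum fun i _ => ?_
  rw [tsum_mul_left]
  calc K * (q ^ (∑ i, e i) * (√q)⁻¹ ^ e i) * ∑' D, err i D
      ≤ K * (q ^ (∑ i, e i) * (√q)⁻¹ ^ e i) * ∑ i, ∑' D, err i D := by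
        gcongr
        exact Finset.single_le_sum (f := fun i => ∑' D, err i D) (fun i _ => herr_nonneg i)
          (Finset.mem_univ i)
    _ = _ := by ring

end PrimeSystem

/-! ### Factorizations and the rootless primes -/

section Factorization

open UniqueFactorizationMonoid

variable {F J : Type*} [Field F]

/-- The monic polynomial with given exponents at the monic irreducibles `v P`. -/
noncomputable def polyOf (v : J → F[X]) (φ : J →₀ ℕ) : F[X] := φ.prod fun P n => v P ^ n

variable {v : J → F[X]}

theorem polyOf_add (φ ψ : J →₀ ℕ) : polyOf v (φ + ψ) = polyOf v φ * polyOf v ψ := by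
  classical
  exact Finsupp.prod_add_index' (by simp) fun P m n => pow_add (v P) m n

theorem monic_polyOf (hm : ∀ P, (v P).Monic) (φ : J →₀ ℕ) : (polyOf v φ).Monic :=
  monic_prod_of_monic _ _ fun P _ => (hm P).pow _

theorem natDegree_polyOf (hm : ∀ P, (v P).Monic) (φ : J →₀ ℕ) :
    (polyOf v φ).natDegree = expDeg (fun P => (v P).natDegree) φ := by
  rw [polyOf, Finsupp.prod, natDegree_prod_of_monic _ _ fun P _ => (hm P).pow _]
  exact Finset.sum_congr rfl fun P _ => (hm P).natDegree_pow _

theorem polyOf_eq_multiset_prod (φ : J →₀ ℕ) : polyOf v φ = (φ.toMultiset.map v).prod := by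
  rw [Finsupp.toMultiset_map, Finsupp.prod_toMultiset, Finsupp.prod_mapDomain_index (by simp)
    fun _ m n => pow_add _ m n, polyOf]

open Classical in
theorem normalizedFactors_polyOf (hm : ∀ P, (v P).Monic) (hi : ∀ P, Irreducible (v P))
    (φ : J →₀ ℕ) : normalizedFactors (polyOf v φ) = φ.toMultiset.map v := by
  rw [polyOf_eq_multiset_prod, normalizedFactors_prod_eq, Multiset.map_map]
  · exact Multiset.map_congr rfl fun P _ => (hm P).normalize_eq_self
  · intro a ha
    obtain ⟨P, _, rfl⟩ := Multiset.mem_map.1 ha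
    exact hi P

theorem polyOf_injective (hv : Function.Injective v) (hm : ∀ P, (v P).Monic)
    (hi : ∀ P, Irreducible (v P)) : Function.Injective (polyOf v) := by
  classical
  intro φ ψ h
  have hfactors := congrArg normalizedFactors h
  rw [normalizedFactors_polyOf hm hi, normalizedFactors_polyOf hm hi] at hfactors
  exact Multiset.toFinsupp.symm.injective (Multiset.map_injective hv hfactors)

theorem squarefree_polyOf_iff (hv : Function.Injective v) (hm : ∀ P, (v P).Monic)
    (hi : ∀ P, Irreducible (v P)) (φ : J →₀ ℕ) : Squarefree (polyOf v φ) ↔ ∀ P, φ P ≤ 1 := by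
  classical
  rw [squarefree_iff_nodup_normalizedFactors (monic_polyOf hm φ).ne_zero,
    normalizedFactors_polyOf hm hi, Multiset.nodup_map_iff_of_injective hv,
    Multiset.nodup_iff_count_le_one]
  simp only [Finsupp.count_toMultiset]

open Classical in
theorem monic_of_mem_normalizedFactors {f P : F[X]} (hP : P ∈ normalizedFactors f) : P.Monic :=
  normalize_normalized_factor P hP ▸ monic_normalize (irreducible_of_normalized_factor P hP).ne_zero

theorem exists_polyOf_eq {f : F[X]} (hf : f.Monic)
    (h : ∀ P : F[X], P.Monic → Irreducible P → P ∣ f → ∃ Q, v Q = P) : ∃ φ, polyOf v φ = f := by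
  classical
  have hlift (P : F[X]) (hP : P ∈ normalizedFactors f) : ∃ Q, v Q = P :=
    h P (monic_of_mem_normalizedFactors hP) (irreducible_of_normalized_factor P hP)
      (dvd_of_mem_normalizedFactors hP)
  obtain ⟨m, hm⟩ : ∃ m : Multiset J, m.map v = normalizedFactors f := by
    choose u hu using hlift
    refine ⟨(normalizedFactors f).attach.map fun P => u P.1 P.2, ?_⟩
    rw [Multiset.map_map]
    exact (Multiset.map_congr rfl fun P _ => hu P.1 P.2).trans (Multiset.attach_map_val _)
  refine ⟨Multiset.toFinsupp m, ?_⟩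
  rw [polyOf_eq_multiset_prod, Multiset.toFinsupp_toMultiset]
  refine eq_of_monic_of_associated ?_ hf (hm ▸ prod_normalizedFactors hf.ne_zero)
  exact monic_multiset_prod_of_monic _ _ fun Q hQ =>
    monic_of_mem_normalizedFactors (hm ▸ Multiset.mem_map_of_mem v hQ)

end Factorization

section RootlessPrimes

variable (F : Type*) [Field F]

/-- The monic irreducible polynomials without a root in `F`. -/
abbrev RootlessPrime : Type _ := {P : F[X] // P.Monic ∧ Irreducible P ∧ ∀ x, P.eval x ≠ 0}

variable {F}

/-- The values of a polynomial without roots, as units. -/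
def RootlessPrime.values (P : RootlessPrime F) : F → Fˣ := fun x => Units.mk0 _ (P.2.2.2 x)

theorem RootlessPrime.two_le_natDegree (P : RootlessPrime F) : 2 ≤ P.1.natDegree := by
  by_contra! h
  have hpos := P.2.2.1.natDegree_pos
  obtain ⟨x, hx⟩ := exists_root_of_degree_eq_one
    ((degree_eq_iff_natDegree_eq_of_pos one_pos).2 (show P.1.natDegree = 1 by lia))
  exact P.2.2.2 x hx

/-- The polynomial attached to an exponent vector at the rootless primes. -/
noncomputable abbrev rootlessPoly (φ : RootlessPrime F →₀ ℕ) : F[X] :=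
  polyOf (fun P : RootlessPrime F => P.1) φ

theorem monic_rootlessPoly (φ : RootlessPrime F →₀ ℕ) : (rootlessPoly φ).Monic :=
  monic_polyOf (fun P => P.2.1) φ

theorem rootlessPoly_injective : Function.Injective (rootlessPoly (F := F)) :=
  polyOf_injective Subtype.val_injective (fun P => P.2.1) fun P => P.2.2.1

theorem eval_rootlessPoly (φ : RootlessPrime F →₀ ℕ) (x : F) :
    (rootlessPoly φ).eval x = expCls RootlessPrime.values φ x := by
  rw [rootlessPoly, polyOf, expCls, Finsupp.prod, Finsupp.prod, eval_prod, Finset.prod_apply,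
    Units.coe_prod]
  exact Finset.prod_congr rfl fun P _ => by simp [RootlessPrime.values]

theorem exists_rootlessPoly_eq {f : F[X]} (hf : f.Monic) (h : ∀ x, f.eval x ≠ 0) :
    ∃ φ, rootlessPoly φ = f :=
  exists_polyOf_eq hf fun P hP hPi hPf =>
    ⟨⟨P, hP, hPi, fun x hx => h x (eval_eq_zero_of_dvd_of_eval_eq_zero hPf hx)⟩, rfl⟩

/-- The monic polynomials of degree `e` whose value at each `x` is `γ x`. -/
def monicsWithValues (e : ℕ) (γ : F → F) : Set F[X] :=
  {f | f.Monic ∧ f.natDegree = e ∧ ∀ x, f.eval x = γ x}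

theorem bijOn_rootlessPoly (e : ℕ) (γ : F → Fˣ) :
    Set.BijOn rootlessPoly
      (expFiber (fun P : RootlessPrime F => P.1.natDegree) RootlessPrime.values e γ)
      (monicsWithValues e fun x => γ x) := by
  refine ⟨?_, rootlessPoly_injective.injOn, ?_⟩
  · rintro φ ⟨hdeg, hcls⟩
    refine ⟨monic_rootlessPoly φ, ?_, fun x => by rw [eval_rootlessPoly, hcls]⟩
    rw [natDegree_polyOf fun P => P.2.1, hdeg]
  · rintro f ⟨hmonic, hdeg, heval⟩
    obtain ⟨φ, rfl⟩ := exists_rootlessPoly_eq hmonic fun x => heval x ▸ (γ x).ne_zero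
    refine ⟨φ, ⟨?_, funext fun x => Units.ext ?_⟩, rfl⟩
    · rw [← hdeg, natDegree_polyOf fun P => P.2.1]
    · rw [← eval_rootlessPoly, heval]

end RootlessPrimes

/-! ### Monic polynomials with prescribed values -/

section Counting

variable (F : Type*) [Field F] [Fintype F]

theorem ncard_monic (m : ℕ) :
    {f : F[X] | f.Monic ∧ f.natDegree = m}.ncard = Fintype.card F ^ m := by
  rw [← Nat.card_coe_set_eq]
  have e := (monicEquivDegreeLT (R := F) m).trans (degreeLTEquiv F m).toEquiv
  exact (Nat.card_congr e).trans (by simp)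

variable {F}

theorem finite_monic (F : Type*) [Field F] [Finite F] (m : ℕ) :
    {f : F[X] | f.Monic ∧ f.natDegree = m}.Finite := by
  have := Fintype.ofFinite F
  refine Set.finite_of_ncard_pos ?_
  rw [ncard_monic]
  exact pow_pos Fintype.card_pos m

theorem finite_monicsWithValues {F : Type*} [Field F] [Finite F] (e : ℕ) (γ : F → F) :
    (monicsWithValues e γ).Finite :=
  (finite_monic F e).subset fun _ hf => ⟨hf.1, hf.2.1⟩

theorem eval_nodal_univ (x : F) : (Lagrange.nodal Finset.univ (id : F → F)).eval x = 0 :=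
  Lagrange.eval_nodal_at_node (v := id) (Finset.mem_univ x)

theorem natDegree_nodal_univ :
    (Lagrange.nodal Finset.univ (id : F → F)).natDegree = Fintype.card F := by
  rw [Lagrange.natDegree_nodal, Finset.card_univ]

theorem modByMonic_nodal_univ [DecidableEq F] (f : F[X]) :
    f %ₘ Lagrange.nodal Finset.univ id = Lagrange.interpolate Finset.univ id fun x => f.eval x := by
  refine Lagrange.eq_interpolate_of_eval_eq _ Function.injective_id.injOn ?_ fun x _ => ?_
  · simpa only [Lagrange.degree_nodal] using
      degree_modByMonic_lt f (Lagrange.nodal_monic (s := Finset.univ) (v := (id : F → F)))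
  · simpa only [id, eval_add, eval_mul, eval_nodal_univ, zero_mul, add_zero] using
      congrArg (eval x) (modByMonic_add_div f (Lagrange.nodal Finset.univ id))

theorem bijOn_nodal_mul_add_interpolate [DecidableEq F] (m : ℕ) (γ : F → F) :
    Set.BijOn (fun h => Lagrange.nodal Finset.univ id * h + Lagrange.interpolate Finset.univ id γ)
      {h : F[X] | h.Monic ∧ h.natDegree = m} (monicsWithValues (Fintype.card F + m) γ) := by
  set M : F[X] := Lagrange.nodal Finset.univ id
  set R : F[X] := Lagrange.interpolate Finset.univ id γ
  have hM : M.Monic := Lagrange.nodal_monic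
  have hR_eval (x : F) : R.eval x = γ x :=
    Lagrange.eval_interpolate_at_node γ Function.injective_id.injOn (Finset.mem_univ x)
  have hR_degree : R.degree < M.degree := by
    simpa only [M, Lagrange.degree_nodal] using
      Lagrange.degree_interpolate_lt γ Function.injective_id.injOn
  refine ⟨?_, fun h _ h' _ heq => mul_left_cancel₀ hM.ne_zero (add_right_cancel heq), ?_⟩
  · rintro h ⟨hm, hd⟩
    have hdegree : R.degree < (M * h).degree := by
      rw [degree_mul]
      exact hR_degree.trans_le (le_add_of_nonneg_right (zero_le_degree_iff.2 hm.ne_zero))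
    refine ⟨(hM.mul hm).add_of_left hdegree, ?_, fun x => by simp [M, eval_nodal_univ, hR_eval]⟩
    rw [natDegree_add_eq_left_of_degree_lt hdegree, hM.natDegree_mul hm, natDegree_nodal_univ, hd]
  · rintro f ⟨hm, hd, heval⟩
    have hmod : f %ₘ M = R := by rw [modByMonic_nodal_univ, funext heval]
    have hle : M.degree ≤ f.degree := by
      rw [degree_eq_natDegree hM.ne_zero, degree_eq_natDegree hm.ne_zero, natDegree_nodal_univ, hd]
      exact_mod_cast Nat.le_add_right _ _
    refine ⟨f /ₘ M, ⟨?_, ?_⟩, ?_⟩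
    · rw [Monic, leadingCoeff_divByMonic_of_monic hM hle, hm.leadingCoeff]
    · rw [natDegree_divByMonic f hM, natDegree_nodal_univ, hd, Nat.add_sub_cancel_left]
    · simpa only [hmod, add_comm] using modByMonic_add_div f M

theorem ncard_monicsWithValues (m : ℕ) (γ : F → F) :
    (monicsWithValues (Fintype.card F + m) γ).ncard = Fintype.card F ^ m := by
  classical
  have hbij := bijOn_nodal_mul_add_interpolate m γ
  rw [← hbij.image_eq, hbij.injOn.ncard_image, ncard_monic]

theorem ncard_monicsWithValues_le_one (e : ℕ) (γ : F → F) (he : e ≤ Fintype.card F) :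
    (monicsWithValues e γ).ncard ≤ 1 := by
  refine (Set.ncard_le_one (finite_monicsWithValues e γ)).2 ?_
  rintro f ⟨hf, hfd, hfe⟩ g ⟨hg, hgd, hge⟩
  refine eq_of_degree_sub_lt_of_eval_finset_eq (s := Finset.univ) ?_ fun x _ => by rw [hfe, hge]
  calc (f - g).degree < f.degree := degree_sub_lt_left (by
        rw [degree_eq_natDegree hf.ne_zero, degree_eq_natDegree hg.ne_zero, hfd, hgd]) hf.ne_zero
          (by rw [hf.leadingCoeff, hg.leadingCoeff])
    _ ≤ (Finset.univ : Finset F).card := by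
        rw [degree_eq_natDegree hf.ne_zero, hfd, Finset.card_univ]
        exact_mod_cast he

theorem abs_ncard_monicsWithValues_sub_le (e : ℕ) (γ : F → F) :
    |((monicsWithValues e γ).ncard : ℝ) -
      ((Fintype.card F : ℝ) ^ Fintype.card F)⁻¹ * (Fintype.card F : ℝ) ^ e| ≤ 1 := by
  have hq : (1 : ℝ) ≤ Fintype.card F := by exact_mod_cast Fintype.card_pos
  rcases le_total (Fintype.card F) e with he | he
  · obtain ⟨m, rfl⟩ := Nat.exists_eq_add_of_le he
    rw [ncard_monicsWithValues, pow_add, inv_mul_cancel_left₀ (by positivity)]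
    simp
  · have hcard : ((monicsWithValues e γ).ncard : ℝ) ≤ 1 := by
      exact_mod_cast ncard_monicsWithValues_le_one e γ he
    have hmain : ((Fintype.card F : ℝ) ^ Fintype.card F)⁻¹ * (Fintype.card F : ℝ) ^ e ≤ 1 := by
      rw [inv_mul_le_one₀ (by positivity)]
      exact pow_le_pow_right₀ hq he
    exact abs_sub_le_of_nonneg_of_le (Nat.cast_nonneg _) hcard (by positivity) hmain

theorem primeSystem_rootlessPrime :
    PrimeSystem (fun P : RootlessPrime F => P.1.natDegree) RootlessPrime.values (Fintype.card F)
      ((Fintype.card F : ℝ) ^ Fintype.card F)⁻¹ where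
  two_le_q := by exact_mod_cast Fintype.one_lt_card
  two_le_deg := RootlessPrime.two_le_natDegree
  finite e γ := by
    refine Set.Finite.of_finite_image ?_ (bijOn_rootlessPoly e γ).injOn
    rw [(bijOn_rootlessPoly e γ).image_eq]
    exact finite_monicsWithValues e _
  c_nonneg := by positivity
  c_le_one := inv_le_one_of_one_le₀ (one_le_pow₀ (by exact_mod_cast Fintype.card_pos))
  count e γ := by
    have hncard := (bijOn_rootlessPoly e γ).injOn.ncard_image
    rw [(bijOn_rootlessPoly e γ).image_eq] at hncard
    simpa only [hncard] using abs_ncard_monicsWithValues_sub_le e fun x => (γ x : F)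

end Counting

/-! ### The constants `ζ_q(2)` and `L_m` -/

theorem tprod_one_add_pos {I : Type*} {f : I → ℝ} (hf : Summable f) (h : ∀ i, 0 < 1 + f i) :
    0 < ∏' i, (1 + f i) := by
  rw [← Real.rexp_tsum_eq_tprod h (Real.summable_log_one_add_of_summable hf)]
  exact Real.exp_pos _

section EulerProducts

variable (F : Type*) [Field F]

/-- The monic irreducible polynomials. -/
abbrev MonicPrime : Type _ := {P : F[X] // P.Monic ∧ Irreducible P}

/-- The splitting of the monic irreducible polynomials into the linear and the rootless ones. -/
noncomputable def sumEquivMonicPrime : F ⊕ RootlessPrime F ≃ MonicPrime F :=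
  Equiv.ofBijective (Sum.elim (fun x => ⟨X - C x, monic_X_sub_C x, irreducible_X_sub_C x⟩)
    fun P => ⟨P.1, P.2.1, P.2.2.1⟩) (by
    constructor
    · rintro (x | P) (y | Q) h <;> simp only [Sum.elim_inl, Sum.elim_inr, Subtype.mk.injEq] at h
      · rw [C_injective (sub_right_injective h)]
      · exact absurd (by simp [← h]) (Q.2.2.2 x)
      · exact absurd (by simp [h]) (P.2.2.2 y)
      · rw [Subtype.ext h]
    · rintro ⟨P, hm, hi⟩
      by_cases! h : ∃ x, P.eval x = 0
      · obtain ⟨x, hx⟩ := h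
        refine ⟨Sum.inl x, Subtype.ext ?_⟩
        exact eq_of_monic_of_associated (monic_X_sub_C x) hm
          ((irreducible_X_sub_C x).associated_of_dvd hi (dvd_iff_isRoot.2 hx))
      · exact ⟨Sum.inr ⟨P, hm, hi, h⟩, rfl⟩)

/-- Unique factorization of monic polynomials. -/
noncomputable def finsuppEquivMonic : (MonicPrime F →₀ ℕ) ≃ {f : F[X] // f.Monic} :=
  Equiv.ofBijective (fun φ => ⟨polyOf (fun P : MonicPrime F => P.1) φ,
    monic_polyOf (fun P => P.2.1) φ⟩) <| by
    constructor
    · intro φ ψ h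
      exact polyOf_injective Subtype.val_injective (fun P : MonicPrime F => P.2.1)
        (fun P => P.2.2) (congrArg Subtype.val h)
    · rintro ⟨f, hf⟩
      obtain ⟨φ, hφ⟩ := exists_polyOf_eq (v := fun P : MonicPrime F => P.1) hf
        fun P hm hi _ => ⟨⟨P, hm, hi⟩, rfl⟩
      exact ⟨φ, Subtype.ext hφ⟩

variable [Fintype F]

theorem two_le_polyNorm (P : MonicPrime F) : 2 ≤ polyNorm F P.1 := by
  have hq : (2 : ℝ) ≤ Fintype.card F := by exact_mod_cast Fintype.one_lt_card
  exact hq.trans (le_self_pow₀ (by linarith) P.2.2.natDegree_pos.ne')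

theorem inv_polyNorm_sq_le (P : MonicPrime F) : (polyNorm F P.1)⁻¹ ^ 2 ≤ 1 / 2 := by
  have hle : (polyNorm F P.1)⁻¹ ≤ 2⁻¹ := inv_anti₀ two_pos (two_le_polyNorm F P)
  have hnonneg : 0 ≤ (polyNorm F P.1)⁻¹ := inv_nonneg.2 (by linarith [two_le_polyNorm F P])
  nlinarith

theorem summable_inv_polyNorm_sq : Summable fun P : MonicPrime F => (polyNorm F P.1)⁻¹ ^ 2 := by
  have H := primeSystem_rootlessPrime (F := F)
  rw [← (sumEquivMonicPrime F).summable_iff]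
  have hrootless : Summable fun P : RootlessPrime F => (polyNorm F P.1)⁻¹ ^ 2 := by
    refine Summable.of_nonneg_of_le (fun P => by positivity) (fun P => ?_) H.summable_primes
    rw [polyNorm, H.inv_pow_eq_inv_sqrt_pow_sq, ← pow_mul, ← pow_mul, ← pow_mul]
    exact pow_le_pow_of_le_one (by positivity) (inv_le_one_of_one_le₀ H.one_lt_sqrt.le) (by lia)
  exact (HasSum.sum (hasSum_fintype _) hrootless.hasSum).summable

theorem summable_abs_inv_polyNorm_sq_pow :
    Summable fun z : MonicPrime F × {d : ℕ // d ≠ 0} => |((polyNorm F z.1.1)⁻¹ ^ 2) ^ z.2.1| := by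
  have hgeom : Summable fun d : {d : ℕ // d ≠ 0} => (1 / 2 : ℝ) ^ d.1 :=
    summable_geometric_two.comp_injective Subtype.val_injective
  refine Summable.of_nonneg_of_le (fun _ => abs_nonneg _) ?_
    (((summable_inv_polyNorm_sq F).mul_left 2).mul_of_nonneg hgeom (fun P => by positivity)
      fun d => by positivity)
  rintro ⟨P, d, hd⟩
  obtain ⟨m, rfl⟩ := Nat.exists_eq_succ_of_ne_zero hd
  set x := (polyNorm F P.1)⁻¹ ^ 2
  have hx : 0 ≤ x := sq_nonneg _
  have hpow := pow_le_pow_left₀ hx (inv_polyNorm_sq_le F P) m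
  calc |x ^ m.succ| = x * x ^ m := by rw [abs_of_nonneg (pow_nonneg hx _), pow_succ']
    _ ≤ x * (1 / 2) ^ m := by gcongr
    _ = 2 * x * (1 / 2) ^ m.succ := by rw [Nat.succ_eq_add_one, pow_succ]; ring

theorem polyNorm_rpow_neg_two_finsuppEquivMonic (φ : MonicPrime F →₀ ℕ) :
    polyNorm F (finsuppEquivMonic F φ).1 ^ (-2 : ℝ) =
      φ.prod fun P d => ((polyNorm F P.1)⁻¹ ^ 2) ^ d := by
  have hcoe : (finsuppEquivMonic F φ).1 = polyOf (fun P : MonicPrime F => P.1) φ := rfl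
  simp only [hcoe, polyNorm]
  rw [natDegree_polyOf fun P : MonicPrime F => P.2.1, Real.rpow_neg (by positivity),
    show (2 : ℝ) = (2 : ℕ) by norm_num, Real.rpow_natCast, ← inv_pow, ← inv_pow, pow_right_comm,
    pow_expDeg]
  refine Finset.prod_congr rfl fun P _ => ?_
  simp only [← inv_pow, ← pow_mul]
  ring_nf

theorem hasProd_zetaF_two :
    HasProd (fun P : MonicPrime F => (1 - (polyNorm F P.1)⁻¹ ^ 2)⁻¹) (zetaF F 2) := by
  have heuler := hasProd_tsum_finsupp_prod
    (a := fun (P : MonicPrime F) d => ((polyNorm F P.1)⁻¹ ^ 2) ^ d) (by simp)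
    (summable_abs_inv_polyNorm_sq_pow F)
  have hgeom (P : MonicPrime F) :
      ∑' d : ℕ, ((polyNorm F P.1)⁻¹ ^ 2) ^ d = (1 - (polyNorm F P.1)⁻¹ ^ 2)⁻¹ :=
    tsum_geometric_of_lt_one (sq_nonneg _) (by linarith [inv_polyNorm_sq_le F P])
  simp only [hgeom] at heuler
  rwa [zetaF, ← (finsuppEquivMonic F).tsum_eq,
    tsum_congr (polyNorm_rpow_neg_two_finsuppEquivMonic F)]

theorem zetaF_two_pos : 0 < zetaF F 2 := by
  have hsummable := (summable_inv_polyNorm_sq F).neg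
  have hpos := tprod_one_add_pos hsummable fun P => by linarith [inv_polyNorm_sq_le F P]
  have hinv := (Real.multipliable_one_add_of_summable hsummable).hasProd.inv₀ hpos.ne'
  simp only [← sub_eq_add_neg] at hinv hpos
  rw [(hasProd_zetaF_two F).unique hinv]
  exact inv_pos.2 hpos

theorem summable_LConst_term (j : ℕ) : Summable fun P : MonicPrime F =>
    (j : ℝ) / ((polyNorm F P.1 + 1) * (polyNorm F P.1 + j)) := by
  refine Summable.of_nonneg_of_le (fun P => ?_) (fun P => ?_)
    ((summable_inv_polyNorm_sq F).mul_left (j : ℝ))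
  · have := two_le_polyNorm F P
    positivity
  · have hnorm := two_le_polyNorm F P
    have : 0 < polyNorm F P.1 := by linarith
    rw [inv_pow, ← div_eq_mul_inv]
    refine div_le_div_of_nonneg_left j.cast_nonneg (by positivity) ?_
    nlinarith [(j.cast_nonneg : (0 : ℝ) ≤ j)]

theorem multipliable_LConst_factor (j : ℕ) : Multipliable fun P : MonicPrime F =>
    (1 - (j : ℝ) / ((polyNorm F P.1 + 1) * (polyNorm F P.1 + j))) := by
  simpa only [sub_eq_add_neg] using
    Real.multipliable_one_add_of_summable (summable_LConst_term F j).neg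

theorem LConst_pos (m : ℕ) : 0 < LConst F m := by
  refine Finset.prod_pos fun j _ => ?_
  simp only [sub_eq_add_neg]
  refine tprod_one_add_pos (summable_LConst_term F j).neg fun P => ?_
  have hnorm := two_le_polyNorm F P
  rw [← sub_eq_add_neg, sub_pos, div_lt_one (by positivity)]
  nlinarith [(j.cast_nonneg : (0 : ℝ) ≤ j)]

theorem prod_LConst_factor {p : ℝ} (hp : 0 < p) (m : ℕ) :
    ∏ j ∈ Finset.Icc 1 m, (1 - (j : ℝ) / ((p + 1) * (p + j))) =
      p ^ m * (p + (m + 1)) / (p + 1) ^ (m + 1) := by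
  induction m with
  | zero => simp; field_simp
  | succ m ih =>
    rw [Finset.prod_Icc_succ_top (by lia), ih]
    push_cast
    have : p + (m + 1) ≠ 0 := by positivity
    field_simp
    ring

theorem prod_LConst_factor_mul_pow {p : ℝ} (hp : 0 < p) (k : ℕ) :
    (∏ j ∈ Finset.Icc 1 (k - 1), (1 - (j : ℝ) / ((p + 1) * (p + j)))) * (1 - p⁻¹ ^ 2) ^ k =
      (1 - p⁻¹) ^ k * (1 + k * p⁻¹) := by
  rcases k with _ | m
  · simp
  · have hfactor : 1 - p⁻¹ ^ 2 = (1 - p⁻¹) * ((p + 1) / p) := by field_simp; ring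
    rw [Nat.add_sub_cancel, prod_LConst_factor hp, hfactor, mul_pow, div_pow]
    push_cast
    generalize (1 - p⁻¹) ^ (m + 1) = A
    field_simp
    ring

theorem hasProd_LConst_div_zetaF_pow (k : ℕ) :
    HasProd (fun P : MonicPrime F => (1 - (polyNorm F P.1)⁻¹) ^ k * (1 + k * (polyNorm F P.1)⁻¹))
      (LConst F (k - 1) / zetaF F 2 ^ k) := by
  have hzeta := ((hasProd_zetaF_two F).inv₀ (zetaF_two_pos F).ne').map (powMonoidHom k)
    (continuous_pow k)
  have hL : HasProd (fun P : MonicPrime F => ∏ j ∈ Finset.Icc 1 (k - 1),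
      (1 - (j : ℝ) / ((polyNorm F P.1 + 1) * (polyNorm F P.1 + j)))) (LConst F (k - 1)) :=
    hasProd_prod fun j _ => (multipliable_LConst_factor F j).hasProd
  convert hL.mul hzeta using 2 with P
  · have hnorm : 0 < polyNorm F P.1 := by linarith [two_le_polyNorm F P]
    simp only [Function.comp_apply, powMonoidHom_apply, inv_inv, prod_LConst_factor_mul_pow hnorm]
  · rw [powMonoidHom_apply, inv_pow, div_eq_mul_inv]

theorem linear_factor_mul_tupleDensity (ι : Type*) [Fintype ι] [DecidableEq ι] :
    ((1 - (Fintype.card F : ℝ)⁻¹) ^ Fintype.card ι *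
        (1 + Fintype.card ι * (Fintype.card F : ℝ)⁻¹)) ^ Fintype.card F *
      PrimeSystem.tupleDensity ι (fun P : RootlessPrime F => P.1.natDegree) (Fintype.card F) =
    LConst F (Fintype.card ι - 1) / zetaF F 2 ^ Fintype.card ι := by
  refine HasProd.unique (HasProd.sum ?_ primeSystem_rootlessPrime.hasProd_tupleDensity)
    ((sumEquivMonicPrime F).hasProd_iff.2 (hasProd_LConst_div_zetaF_pow F (Fintype.card ι)))
  have hlinear := hasProd_fintype (fun _ : F => (1 - (Fintype.card F : ℝ)⁻¹) ^ Fintype.card ι *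
    (1 + Fintype.card ι * (Fintype.card F : ℝ)⁻¹))
  rw [Finset.prod_const, Finset.card_univ] at hlinear
  convert hlinear using 2 with x
  have hdeg : ((sumEquivMonicPrime F (Sum.inl x)).1).natDegree = 1 := natDegree_X_sub_C x
  simp only [Function.comp_apply, polyNorm, hdeg, pow_one]

end EulerProducts

/-! ### The group `R'` and its characters -/

section GroupTheory

theorem fin_val_nsmul {m : ℕ} [NeZero m] (k : ℕ) (y : Fin m) :
    ((k • y : Fin m) : ℕ) = k * y % m := by
  induction k with
  | zero => simp
  | succ k ih => rw [succ_nsmul, Fin.val_add, ih, Nat.mod_add_mod, add_mul, one_mul]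

theorem totient_sq {e : ℕ} (he : 0 < e) : Nat.totient (e ^ 2) = Nat.totient e * e := by
  have h := Nat.totient_gcd_mul_totient_mul e e
  rw [Nat.gcd_self, ← sq, mul_assoc] at h
  exact Nat.eq_of_mul_eq_mul_left (Nat.totient_pos.2 he) h

theorem ncard_zmultiples_eq {G : Type*} [AddCommGroup G] [Finite G] (β : G) :
    {γ : G | AddSubgroup.zmultiples γ = AddSubgroup.zmultiples β}.ncard =
      Nat.totient (addOrderOf β) := by
  classical
  have := Fintype.ofFinite G
  set H := AddSubgroup.zmultiples β
  have hcard : Fintype.card H = addOrderOf β := Fintype.card_zmultiples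
  rw [← IsAddCyclic.card_addOrderOf_eq_totient (α := H) (d := addOrderOf β) (by rw [hcard]),
    ← Set.ncard_coe_finset, ← Set.ncard_image_of_injective _ Subtype.val_injective]
  congr 1
  ext γ
  simp only [Set.mem_ofPred_eq, Set.mem_image, Finset.coe_filter, Finset.mem_univ, true_and,
    Subtype.exists, exists_and_right, exists_eq_right]
  constructor
  · intro h
    refine ⟨h ▸ AddSubgroup.mem_zmultiples γ, ?_⟩
    rw [← AddSubgroup.addOrderOf_coe, ← Nat.card_zmultiples, h, Nat.card_zmultiples]
  · rintro ⟨hmem, horder⟩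
    refine AddSubgroup.eq_of_le_of_card_ge ((AddSubgroup.zmultiples_le).2 hmem) ?_
    rw [← AddSubgroup.addOrderOf_coe] at horder
    rw [Nat.card_zmultiples, Nat.card_zmultiples, horder]

theorem div_gcd_dvd_iff {m b k : ℕ} (hm : 0 < m) : m / Nat.gcd m b ∣ k ↔ m ∣ k * b := by
  rw [Nat.div_dvd_iff_dvd_mul (Nat.gcd_dvd_left m b) (Nat.gcd_pos_of_pos_left b hm)]
  constructor
  · intro h
    rw [mul_comm k]
    exact h.trans (Nat.mul_dvd_mul_right (Nat.gcd_dvd_right m b) k)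
  · intro h
    rw [← Nat.gcd_mul_right]
    exact Nat.dvd_gcd (dvd_mul_right m k) (by rwa [mul_comm])

theorem exists_coprime_primitiveRoot_pow_eq {R : Type*} [CommRing R] [IsDomain R] {ζ z : R}
    {ell : ℕ} (hζ : IsPrimitiveRoot ζ ell) (hell : 0 < ell) (hz : orderOf z ∣ ell) :
    ∃ w : ℕ, (1 ≤ w ∧ w ≤ orderOf z ∧ w.Coprime (orderOf z)) ∧ ζ ^ (ell / orderOf z * w) = z := by
  have hpos : 0 < orderOf z := Nat.pos_of_dvd_of_pos hz hell
  have : NeZero (orderOf z) := ⟨hpos.ne'⟩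
  have hroot : IsPrimitiveRoot (ζ ^ (ell / orderOf z)) (orderOf z) :=
    hζ.pow hell (Nat.div_mul_cancel hz).symm
  obtain ⟨i, hlt, hcoprime, hpow⟩ := hroot.isPrimitiveRoot_iff.1 (IsPrimitiveRoot.orderOf z)
  rcases Nat.eq_zero_or_pos i with rfl | hi
  · rw [Nat.coprime_zero_left] at hcoprime
    refine ⟨1, ⟨le_rfl, hpos, Nat.coprime_one_left _⟩, ?_⟩
    rw [hcoprime] at hroot ⊢
    rw [mul_one, IsPrimitiveRoot.one_right_iff.1 hroot, ← hpow, pow_zero]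
  · exact ⟨i, ⟨hi, hlt.le, hcoprime⟩, by rw [pow_mul, hpow]⟩

variable {n : ℕ} {r : Fin n → ℕ}

theorem card_RPrime : Fintype.card (RPrime r) = groupOrder r := by simp [groupOrder]

theorem SOmega.s_dvd_ell (p : SOmega r) (j : Fin n) : p.s j ∣ p.ell :=
  Finset.dvd_lcm (Finset.mem_univ j)

theorem SOmega.ell_dvd (p : SOmega r) : p.ell ∣ Finset.univ.lcm r :=
  Finset.lcm_dvd fun j _ => (p.2.1 j).trans (Finset.dvd_lcm (Finset.mem_univ j))

theorem SOmega.ell_pos (p : SOmega r) : 0 < p.ell := by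
  refine Nat.pos_of_ne_zero fun h => ?_
  rw [SOmega.ell, Finset.lcm_eq_zero_iff] at h
  obtain ⟨j, _, hj⟩ := h
  change p.1.1 j = 0 at hj
  have := p.2.2 j
  lia

theorem SOmega.cast_pairing (p : SOmega r) (v : Fin n → ℕ) :
    (p.pairing v : ZMod p.ell) = ∑ j, ((p.ell / p.s j * p.ω j : ℕ) : ZMod p.ell) * v j := by
  simp [SOmega.pairing]

theorem SOmega.cast_mul_r (p : SOmega r) (j : Fin n) :
    ((p.ell / p.s j * p.ω j : ℕ) : ZMod p.ell) * (r j : ℕ) = 0 := by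
  rw [← Nat.cast_mul, ZMod.natCast_eq_zero_iff, mul_right_comm]
  refine Dvd.dvd.mul_right ?_ _
  obtain ⟨t, ht⟩ := p.2.1 j
  change r j = p.s j * t at ht
  rw [ht, ← mul_assoc, Nat.div_mul_cancel (p.s_dvd_ell j)]
  exact dvd_mul_right _ _

theorem SOmega.cast_pairing_mod (p : SOmega r) (v : Fin n → ℕ) :
    (p.pairing (fun j => v j % r j) : ZMod p.ell) = p.pairing v := by
  rw [p.cast_pairing, p.cast_pairing]
  refine Finset.sum_congr rfl fun j _ => ?_
  conv_rhs => rw [← Nat.mod_add_div (v j) (r j), Nat.cast_add, mul_add, Nat.cast_mul (r j),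
    ← mul_assoc, p.cast_mul_r, zero_mul, add_zero]

variable [∀ j, NeZero (r j)]

theorem ramIndex_eq_addOrderOf (β : RPrime r) :
    ramIndex r (fun j => (β j : ℕ)) = addOrderOf β := by
  have hdvd_iff (k : ℕ) : ramIndex r (fun j => (β j : ℕ)) ∣ k ↔ addOrderOf β ∣ k := by
    rw [ramIndex, Finset.lcm_dvd_iff, addOrderOf_dvd_iff_nsmul_eq_zero, funext_iff]
    refine forall_congr' fun j => ?_
    simp only [Finset.mem_univ, true_imp_iff]
    rw [div_gcd_dvd_iff (Nat.pos_of_neZero (r j)), Nat.dvd_iff_mod_eq_zero, ← fin_val_nsmul,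
      ← Fin.val_zero (r j), Fin.val_inj, Pi.smul_apply, Pi.zero_apply]
  exact Nat.dvd_antisymm ((hdvd_iff _).2 dvd_rfl) ((hdvd_iff _).1 dvd_rfl)

theorem card_RIdx_add_one : Fintype.card (RIdx r) + 1 = groupOrder r := by
  have hcard := Fintype.card_subtype_compl (fun α : RPrime r => α = 0)
  have hpos : 0 < Fintype.card (RPrime r) := Fintype.card_pos
  rw [Fintype.card_subtype_eq, card_RPrime] at hcard
  rw [card_RPrime] at hpos
  have : Fintype.card (RIdx r) = groupOrder r - 1 := by convert hcard
  lia

/-- The pairing with `(s, ω)` as a character of the group `R'`. -/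
def pairingHom (p : SOmega r) : RPrime r →+ ZMod p.ell where
  toFun y := (p.pairing fun j => (y j : ℕ) : ℕ)
  map_zero' := by simp [SOmega.pairing]
  map_add' y z := by
    have hval : (fun j => ((y + z) j : ℕ)) = fun j => ((y j : ℕ) + (z j : ℕ)) % r j :=
      funext fun j => Fin.val_add _ _
    rw [hval, p.cast_pairing_mod, p.cast_pairing, p.cast_pairing, p.cast_pairing,
      ← Finset.sum_add_distrib]
    exact Finset.sum_congr rfl fun j _ => by push_cast; ring

theorem mem_ASet_iff (p : SOmega r) (β : RPrime r) : p ∈ ASet β ↔ pairingHom p β = 0 :=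
  (ZMod.natCast_eq_zero_iff _ _).symm

theorem nsmul_single_one (j : Fin n) (k : ℕ) :
    k • (Pi.single j 1 : RPrime r) = Pi.single j (Fin.ofNat (r j) k) := by
  refine (map_nsmul (AddMonoidHom.single (fun j => Fin (r j)) j) k 1).symm.trans
    (congrArg _ (Fin.ext ?_))
  rw [fin_val_nsmul, Fin.val_one', Nat.mul_mod_mod, mul_one, Fin.val_ofNat]

theorem addChar_eq_prod_pow (ψ : AddChar (RPrime r) ℂ) (a : RPrime r) :
    ψ a = ∏ j, ψ (Pi.single j 1) ^ (a j : ℕ) := by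
  have hsum : a = ∑ j, (a j : ℕ) • (Pi.single j 1 : RPrime r) := by
    simp only [nsmul_single_one, Fin.ofNat_val_eq_self, Finset.univ_sum_single]
  simp only [← AddChar.map_nsmul_eq_pow]
  conv_lhs => rw [hsum]
  exact map_prod ψ.toMonoidHom
    (fun j => Multiplicative.ofAdd ((a j : ℕ) • (Pi.single j 1 : RPrime r))) Finset.univ

theorem exists_addChar_eq_pow_pairing (ψ : AddChar (RPrime r) ℂ) :
    ∃ (p : SOmega r) (ζ : ℂ), IsPrimitiveRoot ζ p.ell ∧
      ∀ a : RPrime r, ψ a = ζ ^ p.pairing fun j => (a j : ℕ) := by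
  set z : Fin n → ℂ := fun j => ψ (Pi.single j 1)
  have horder (j : Fin n) : orderOf (z j) ∣ r j := by
    refine orderOf_dvd_of_pow_eq_one ?_
    rw [← AddChar.map_nsmul_eq_pow, nsmul_single_one, Fin.ofNat_self, Pi.single_zero,
      ψ.map_zero_eq_one]
  set ell := Finset.univ.lcm fun j => orderOf (z j)
  have hell : 0 < ell := by
    refine Nat.pos_of_ne_zero fun h => ?_
    obtain ⟨j, _, hj⟩ := Finset.lcm_eq_zero_iff.1 h
    exact (Nat.pos_of_dvd_of_pos (horder j) (Nat.pos_of_neZero _)).ne' hj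
  have hζ := Complex.isPrimitiveRoot_exp ell hell.ne'
  choose w hw hpow using fun j =>
    exists_coprime_primitiveRoot_pow_eq hζ hell (Finset.dvd_lcm (Finset.mem_univ j))
  refine ⟨⟨(fun j => orderOf (z j), w), horder, hw⟩, _, hζ, fun a => ?_⟩
  rw [addChar_eq_prod_pow]
  refine Eq.trans ?_ (Finset.prod_pow_eq_pow_sum ..)
  refine Finset.prod_congr rfl fun j _ => ?_
  rw [pow_mul]
  exact congrArg (· ^ (a j : ℕ)) (hpow j).symm

theorem mem_zmultiples_of_forall_pairing {β y : RPrime r}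
    (h : ∀ p : SOmega r, pairingHom p β = 0 → pairingHom p y = 0) :
    y ∈ AddSubgroup.zmultiples β := by
  by_contra hy
  obtain ⟨ψ, hψ⟩ := AddChar.exists_apply_ne_zero.2
    (mt (QuotientAddGroup.eq_zero_iff (N := AddSubgroup.zmultiples β) y).1 hy)
  set Ψ := ψ.compAddMonoidHom (QuotientAddGroup.mk' (AddSubgroup.zmultiples β))
  obtain ⟨p, ζ, hζ, hpow⟩ := exists_addChar_eq_pow_pairing Ψ
  have hone_iff (a : RPrime r) : Ψ a = 1 ↔ pairingHom p a = 0 := by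
    rw [hpow, hζ.pow_eq_one_iff_dvd]
    exact (ZMod.natCast_eq_zero_iff _ _).symm
  have hβ : Ψ β = 1 := by
    rw [AddChar.compAddMonoidHom_apply, QuotientAddGroup.mk'_apply,
      (QuotientAddGroup.eq_zero_iff β).2 (AddSubgroup.mem_zmultiples β), ψ.map_zero_eq_one]
  exact hψ ((hone_iff y).2 (h p ((hone_iff β).1 hβ)))

theorem ASet_subset_iff (β β' : RPrime r) :
    ASet β ⊆ ASet β' ↔ AddSubgroup.zmultiples β' ≤ AddSubgroup.zmultiples β := by
  rw [AddSubgroup.zmultiples_le]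
  constructor
  · exact fun h => mem_zmultiples_of_forall_pairing fun p hp =>
      (mem_ASet_iff p β').1 (h ((mem_ASet_iff p β).2 hp))
  · intro h p hp
    obtain ⟨k, rfl⟩ := AddSubgroup.mem_zmultiples_iff.1 h
    rw [mem_ASet_iff] at hp ⊢
    rw [map_zsmul, hp, smul_zero]

theorem ASet_eq_iff (β β' : RPrime r) :
    ASet β = ASet β' ↔ AddSubgroup.zmultiples β = AddSubgroup.zmultiples β' := by
  rw [Set.Subset.antisymm_iff, ASet_subset_iff, ASet_subset_iff, le_antisymm_iff, and_comm]

end GroupTheory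

/-! ### Discrete logarithms and character values -/

section Characters

section StateValue

variable {F : Type*} [Field F] {n : ℕ} {r : Fin n → ℕ}

open Classical in
/-- The family of character values attached to a ramification vector `β` and a vector of units:
the values of `F_(s)^(ω)` at a point depend only on these two data. -/
noncomputable def stateValue (χ : ℕ → MulChar F ℂ) (β : RPrime r) (u : Fin n → Fˣ) (p : SOmega r) :
    ℂ :=
  if p ∈ ASet β then χ p.ell (∏ j, (u j : F) ^ (p.ell / p.s j * p.ω j)) else 0

theorem stateValue_eq_zero_iff (χ : ℕ → MulChar F ℂ) (β : RPrime r) (u : Fin n → Fˣ)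
    (p : SOmega r) : stateValue χ β u p = 0 ↔ p ∉ ASet β := by
  have hne (w : Fˣ) : χ p.ell w ≠ 0 := by
    rw [← MulChar.coe_toUnitHom]
    exact Units.ne_zero _
  by_cases h : p ∈ ASet β
  · simp only [stateValue, h, if_true, map_prod, map_pow, not_true, iff_false]
    exact Finset.prod_ne_zero_iff.2 fun j _ => pow_ne_zero _ (hne (u j))
  · simp only [stateValue, h, if_false, not_false_eq_true]

end StateValue

variable (F : Type*) [Field F] [Fintype F]

/-- A generator of the multiplicative group of `F`. -/
noncomputable def unitGen : Fˣ := (IsCyclic.exists_generator (α := Fˣ)).choose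

variable {F}

theorem mem_zpowers_unitGen (u : Fˣ) : u ∈ Subgroup.zpowers (unitGen F) :=
  (IsCyclic.exists_generator (α := Fˣ)).choose_spec u

theorem exists_unitGen_pow_eq (u : Fˣ) : ∃ k : ℕ, unitGen F ^ k = u :=
  mem_powers_iff_mem_zpowers.2 (mem_zpowers_unitGen u)

/-- A discrete logarithm to the base `unitGen F`; only its residue mod `q - 1` is determined. -/
noncomputable def dlog (u : Fˣ) : ℕ := (exists_unitGen_pow_eq u).choose

theorem unitGen_pow_dlog (u : Fˣ) : unitGen F ^ dlog u = u := (exists_unitGen_pow_eq u).choose_spec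

theorem orderOf_unitGen : orderOf (unitGen F) = Fintype.card F - 1 := by
  classical
  rw [orderOf_eq_card_of_forall_mem_zpowers mem_zpowers_unitGen, Nat.card_eq_fintype_card,
    Fintype.card_units]

theorem unitGen_pow_eq_iff (u : Fˣ) (k : ℕ) :
    unitGen F ^ k = u ↔ dlog u ≡ k [MOD Fintype.card F - 1] := by
  rw [← orderOf_unitGen, ← pow_eq_pow_iff_modEq, unitGen_pow_dlog, eq_comm]

theorem dlog_mul_modEq (u w : Fˣ) : dlog (u * w) ≡ dlog u + dlog w [MOD Fintype.card F - 1] := by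
  rw [← unitGen_pow_eq_iff, pow_add, unitGen_pow_dlog, unitGen_pow_dlog]

theorem isPrimitiveRoot_apply_unitGen (χ : MulChar F ℂ) :
    IsPrimitiveRoot (χ (unitGen F : F)) (orderOf χ) := by
  have hpow_iff (k : ℕ) : χ (unitGen F : F) ^ k = 1 ↔ χ ^ k = 1 := by
    rw [← MulChar.pow_apply_coe]
    refine ⟨fun h => MulChar.ext fun u => ?_, fun h => by rw [h, MulChar.one_apply_coe]⟩
    rw [← unitGen_pow_dlog u, Units.val_pow_eq_pow_val, map_pow, map_pow, h, one_pow,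
      MulChar.one_apply_coe, one_pow]
  exact ⟨(hpow_iff _).2 (pow_orderOf_eq_one χ),
    fun k hk => orderOf_dvd_of_pow_eq_one ((hpow_iff k).1 hk)⟩

variable {n : ℕ} {r : Fin n → ℕ}

theorem dvd_card_sub_one (hq : ∀ j, Fintype.card F ≡ 1 [MOD r j]) (j : Fin n) :
    r j ∣ Fintype.card F - 1 :=
  (Nat.modEq_iff_dvd' Fintype.card_pos).1 (hq j).symm

theorem mulChar_prod_pow (χ : MulChar F ℂ) (p : SOmega r) (u : Fin n → Fˣ) :
    χ (∏ j, (u j : F) ^ (p.ell / p.s j * p.ω j)) =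
      χ (unitGen F : F) ^ p.pairing fun j => dlog (u j) := by
  rw [map_prod, SOmega.pairing, ← Finset.prod_pow_eq_pow_sum]
  refine Finset.prod_congr rfl fun j _ => ?_
  conv_lhs => rw [← unitGen_pow_dlog (u j)]
  rw [Units.val_pow_eq_pow_val, map_pow, map_pow, ← pow_mul, mul_comm]

variable [∀ j, NeZero (r j)]

/-- The vector of discrete logarithms, in `R'`. -/
noncomputable def logVec (r : Fin n → ℕ) [∀ j, NeZero (r j)] (u : Fin n → Fˣ) : RPrime r :=
  fun j => Fin.ofNat (r j) (dlog (u j))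

theorem logVec_mul (hq : ∀ j, Fintype.card F ≡ 1 [MOD r j]) (u w : Fin n → Fˣ) :
    logVec r (u * w) = logVec r u + logVec r w := by
  ext j
  simp only [logVec, Pi.add_apply, Fin.val_add, Fin.val_ofNat, Pi.mul_apply, Nat.add_mod_mod,
    Nat.mod_add_mod]
  exact (dlog_mul_modEq (u j) (w j)).of_dvd (dvd_card_sub_one hq j)

theorem logVec_unitGen_pow (hq : ∀ j, Fintype.card F ≡ 1 [MOD r j]) (y : RPrime r) :
    logVec r (fun j => unitGen F ^ (y j : ℕ)) = y := by
  ext j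
  have h := ((unitGen_pow_eq_iff _ _).1 (rfl : unitGen F ^ (y j : ℕ) = _)).of_dvd
    (dvd_card_sub_one hq j)
  rw [logVec, Fin.val_ofNat]
  exact Eq.trans h (Nat.mod_eq_of_lt (y j).2)

/-- The discrete logarithm `(F^*)ⁿ → R'` as a homomorphism. -/
noncomputable def logHom (hq : ∀ j, Fintype.card F ≡ 1 [MOD r j]) :
    (Fin n → Fˣ) →* Multiplicative (RPrime r) :=
  MonoidHom.mk' (fun u => Multiplicative.ofAdd (logVec r u)) fun u w => by
    rw [logVec_mul hq, ofAdd_add]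

theorem logHom_surjective (hq : ∀ j, Fintype.card F ≡ 1 [MOD r j]) :
    Function.Surjective (logHom hq) := fun y =>
  ⟨_, congrArg Multiplicative.ofAdd (logVec_unitGen_pow hq (Multiplicative.toAdd y))⟩

theorem pairingHom_logVec (p : SOmega r) (u : Fin n → Fˣ) :
    pairingHom p (logVec r u) = (p.pairing fun j => dlog (u j) : ℕ) := by
  rw [← p.cast_pairing_mod]
  rfl

theorem mulChar_prod_pow_eq_iff {χ : ℕ → MulChar F ℂ}
    (hχ : ∀ m, m ∣ Finset.univ.lcm r → orderOf (χ m) = m) (p : SOmega r) (u u' : Fin n → Fˣ) :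
    χ p.ell (∏ j, (u j : F) ^ (p.ell / p.s j * p.ω j)) =
        χ p.ell (∏ j, (u' j : F) ^ (p.ell / p.s j * p.ω j)) ↔
      pairingHom p (logVec r u - logVec r u') = 0 := by
  have hroot := isPrimitiveRoot_apply_unitGen (χ p.ell)
  rw [hχ _ p.ell_dvd] at hroot
  have hfin : IsOfFinOrder (χ p.ell (unitGen F : F)) :=
    isOfFinOrder_iff_pow_eq_one.2 ⟨p.ell, p.ell_pos, hroot.pow_eq_one⟩
  rw [mulChar_prod_pow, mulChar_prod_pow, map_sub, sub_eq_zero, pairingHom_logVec,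
    pairingHom_logVec, ZMod.natCast_eq_natCast_iff, hfin.pow_eq_pow_iff_modEq, ← hroot.eq_orderOf]

theorem stateValue_eq_iff {χ : ℕ → MulChar F ℂ}
    (hχ : ∀ m, m ∣ Finset.univ.lcm r → orderOf (χ m) = m) (β β' : RPrime r) (u u' : Fin n → Fˣ) :
    stateValue χ β u = stateValue χ β' u' ↔
      AddSubgroup.zmultiples β = AddSubgroup.zmultiples β' ∧
        logVec r u - logVec r u' ∈ AddSubgroup.zmultiples β := by
  rw [← ASet_eq_iff]
  constructor
  · intro h
    have hA : ASet β = ASet β' := by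
      ext p
      rw [← not_iff_not, ← stateValue_eq_zero_iff χ β u, ← stateValue_eq_zero_iff χ β' u', h]
    refine ⟨hA, mem_zmultiples_of_forall_pairing fun p hp => ?_⟩
    rw [← mem_ASet_iff] at hp
    rw [← mulChar_prod_pow_eq_iff hχ]
    simpa only [stateValue, ← hA, hp, if_true] using congrFun h p
  · rintro ⟨hA, hmem⟩
    ext p
    by_cases hp : p ∈ ASet β
    · simp only [stateValue, ← hA, hp, if_true]
      obtain ⟨k, hk⟩ := AddSubgroup.mem_zmultiples_iff.1 hmem
      rw [mulChar_prod_pow_eq_iff hχ, ← hk, map_zsmul, (mem_ASet_iff p β).1 hp, smul_zero]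
    · rw [(stateValue_eq_zero_iff χ β u p).2 hp, (stateValue_eq_zero_iff χ β' u' p).2 (hA ▸ hp)]

end Characters

/-! ### Ramification data and rootless parts -/

section NonzeroVectors

variable {n : ℕ} {r : Fin n → ℕ} [∀ j, NeZero (r j)]

@[to_additive]
theorem prod_RIdx_ite_eq {M : Type*} [CommMonoid M] (b : RPrime r) (f : RIdx r → M) :
    (∏ α : RIdx r, if b = α.1 then f α else 1) = if h : b = 0 then 1 else f ⟨b, h⟩ := by
  split_ifs with hb
  · exact Finset.prod_eq_one fun α _ => if_neg fun h => α.2 (h.symm.trans hb)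
  · rw [Finset.prod_eq_single ⟨b, hb⟩, if_pos rfl]
    · exact fun α _ hα => if_neg fun h => hα (Subtype.ext h.symm)
    · exact fun h => absurd (Finset.mem_univ _) h

theorem eq_of_forall_RIdx_iff {b b' : RPrime r} (h : ∀ α : RIdx r, b = α.1 ↔ b' = α.1) :
    b = b' := by
  by_cases hb : b = 0
  · by_contra hne
    exact hne ((h ⟨b', fun hb' => hne (hb.trans hb'.symm)⟩).2 rfl)
  · exact ((h ⟨b, hb⟩).1 rfl).symm

theorem sum_RIdx_mul_ite (b : RPrime r) (j : Fin n) :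
    ∑ α : RIdx r, (α.1 j : ℕ) * (if b = α.1 then 1 else 0) = b j := by
  simp only [mul_ite, mul_one, mul_zero]
  rw [sum_RIdx_ite_eq]
  split_ifs with hb
  · simp [hb]
  · rfl

end NonzeroVectors

section Parametrization

variable {F : Type*} [Field F]

theorem squarefree_prod_iff {ι : Type*} [Fintype ι] (f : ι → F[X]) :
    Squarefree (∏ i, f i) ↔
      (∀ i, Squarefree (f i)) ∧ ∀ i j, i ≠ j → IsCoprime (f i) (f j) := by
  classical
  constructor
  · intro h
    refine ⟨fun i => h.squarefree_of_dvd (Finset.dvd_prod_of_mem f (Finset.mem_univ i)),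
      fun i j hij => ?_⟩
    have hdvd : f i * f j ∣ ∏ l, f l := by
      rw [← Finset.mul_prod_erase _ _ (Finset.mem_univ i)]
      exact mul_dvd_mul_left _ (Finset.dvd_prod_of_mem f
        (Finset.mem_erase.2 ⟨hij.symm, Finset.mem_univ j⟩))
    exact (squarefree_mul_iff.1 (h.squarefree_of_dvd hdvd)).1.isCoprime
  · rintro ⟨hsq, hcop⟩
    exact Finset.squarefree_prod_of_pairwise_isCoprime
      (fun i _ j _ hij => (hcop i j hij).isRelPrime) fun i _ => hsq i

theorem eval_rootlessPoly_ne_zero (φ : RootlessPrime F →₀ ℕ) (x : F) :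
    (rootlessPoly φ).eval x ≠ 0 := by
  rw [eval_rootlessPoly]
  exact Units.ne_zero _

theorem isCoprime_ite_X_sub_C {x y : F} (hxy : x ≠ y) (p q : Prop) [Decidable p] [Decidable q] :
    IsCoprime (if p then X - C x else 1) (if q then X - C y else 1) := by
  split_ifs
  · exact pairwise_coprime_X_sub_C Function.injective_id hxy
  · exact isCoprime_one_right
  · exact isCoprime_one_left
  · exact isCoprime_one_left

theorem prod_rootlessPoly {ι : Type*} (T : Finset ι) (φ : ι → RootlessPrime F →₀ ℕ) :
    ∏ i ∈ T, rootlessPoly (φ i) = rootlessPoly (∑ i ∈ T, φ i) := by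
  classical
  induction T using Finset.induction_on with
  | empty => simp [polyOf]
  | insert i T hi ih =>
    rw [Finset.prod_insert hi, Finset.sum_insert hi, ih]
    exact (polyOf_add _ _).symm

variable {n : ℕ} {r : Fin n → ℕ} [∀ j, NeZero (r j)]

theorem mem_fullFamily_iff (d : RIdx r → ℕ) (cf : (Fin n → Fˣ) × (RIdx r → F[X])) :
    cf ∈ fullFamily F d ↔ (∀ α, (cf.2 α).Monic) ∧ Squarefree (∏ α, cf.2 α) ∧
      ∃ b : RPrime r, ∀ α : RIdx r, (cf.2 α).natDegree + (if b = α.1 then 1 else 0) = d α := by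
  obtain ⟨c, f⟩ := cf
  rw [squarefree_prod_iff]
  simp only [fullFamily, Set.mem_ofPred_eq, Set.mem_union, Set.mem_iUnion, tuples, tuplesDrop]
  constructor
  · rintro (⟨hf, hcop⟩ | ⟨β, hf, hβ, hdeg, hcop⟩)
    · refine ⟨fun α => (hf α).1, ⟨fun α => (hf α).2.1, hcop⟩, 0, fun α => ?_⟩
      rw [if_neg (Ne.symm α.2), (hf α).2.2, add_zero]
    · refine ⟨fun α => (hf α).1, ⟨fun α => (hf α).2, hcop⟩, β.1, fun α => ?_⟩
      by_cases h : α = β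
      · rw [h, if_pos rfl, hβ]
      · rw [if_neg fun h' => h (Subtype.ext h'.symm), hdeg α h, add_zero]
  · rintro ⟨hmonic, ⟨hsq, hcop⟩, b, hdeg⟩
    by_cases hb : b = 0
    · refine Or.inl ⟨fun α => ⟨hmonic α, hsq α, ?_⟩, hcop⟩
      rw [← hdeg α, if_neg fun h => α.2 (h.symm.trans hb), add_zero]
    · refine Or.inr ⟨⟨b, hb⟩, fun α => ⟨hmonic α, hsq α⟩, ?_, fun α hα => ?_, hcop⟩
      · rw [← hdeg ⟨b, hb⟩, if_pos rfl]
      · rw [← hdeg α, if_neg fun h => hα (Subtype.ext h.symm), add_zero]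

theorem exists_ramification {f : RIdx r → F[X]} (hcop : ∀ α β, α ≠ β → IsCoprime (f α) (f β)) :
    ∃ b : F → RPrime r, ∀ x (α : RIdx r), b x = α.1 ↔ (f α).eval x = 0 := by
  have huniq (x : F) {α β : RIdx r} (hα : (f α).eval x = 0) (hβ : (f β).eval x = 0) : α = β := by
    by_contra h
    obtain ⟨u, v, huv⟩ := hcop α β h
    simpa [hα, hβ] using congrArg (eval x) huv
  have hpoint (x : F) : ∃ b : RPrime r, ∀ α : RIdx r, b = α.1 ↔ (f α).eval x = 0 := by
    by_cases h : ∃ β, (f β).eval x = 0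
    · obtain ⟨β, hβ⟩ := h
      exact ⟨β.1, fun α => ⟨fun h => Subtype.ext h ▸ hβ, fun hα => by rw [huniq x hβ hα]⟩⟩
    · exact ⟨0, fun α => ⟨fun h => absurd h.symm α.2, fun hα => absurd ⟨α, hα⟩ h⟩⟩
  choose b hb using hpoint
  exact ⟨b, hb⟩

variable [Fintype F]

/-- The product of the linear factors assigned to `α` by the ramification data `b`. -/
noncomputable def linPart (b : F → RPrime r) (α : RIdx r) : F[X] :=
  ∏ x, if b x = α.1 then X - C x else 1

theorem monic_linPart (b : F → RPrime r) (α : RIdx r) : (linPart b α).Monic :=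
  monic_prod_of_monic _ _ fun x _ => by split_ifs; exacts [monic_X_sub_C x, monic_one]

theorem natDegree_linPart (b : F → RPrime r) (α : RIdx r) :
    (linPart b α).natDegree = ∑ x, if b x = α.1 then 1 else 0 := by
  rw [linPart, natDegree_prod_of_monic]
  · exact Finset.sum_congr rfl fun x _ => by split_ifs <;> simp
  · exact fun x _ => by split_ifs; exacts [monic_X_sub_C x, monic_one]

open Classical in
/-- The value of `linPart b α` at `x` with the factor `X - x` removed, as a unit. -/
noncomputable def linUnit (b : F → RPrime r) (α : RIdx r) (x : F) : Fˣ :=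
  ∏ y, if h : b y = α.1 ∧ x ≠ y then Units.mk0 (x - y) (sub_ne_zero.2 h.2) else 1

theorem eval_linPart_eq_zero {b : F → RPrime r} {α : RIdx r} {x : F} (h : b x = α.1) :
    (linPart b α).eval x = 0 := by
  rw [linPart, eval_prod]
  exact Finset.prod_eq_zero (Finset.mem_univ x) (by simp [h])

theorem eval_linPart {b : F → RPrime r} {α : RIdx r} {x : F} (h : b x ≠ α.1) :
    (linPart b α).eval x = linUnit b α x := by
  rw [linPart, linUnit, eval_prod, Units.coe_prod]
  refine Finset.prod_congr rfl fun y _ => ?_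
  by_cases hy : b y = α.1
  · have hxy : x ≠ y := fun hxy => h (hxy ▸ hy)
    simp [hy, hxy]
  · simp [hy]

theorem linPart_dvd {b : F → RPrime r} {α : RIdx r} {f : F[X]}
    (hf : ∀ x, b x = α.1 → f.eval x = 0) : linPart b α ∣ f := by
  refine Finset.prod_dvd_of_coprime (fun x _ y _ hxy => isCoprime_ite_X_sub_C hxy _ _)
    fun x _ => ?_
  split_ifs with h
  · exact dvd_iff_isRoot.2 (hf x h)
  · exact one_dvd _

theorem prod_linPart (b : F → RPrime r) :
    ∏ α, linPart b α = ∏ x, if b x ≠ 0 then X - C x else 1 := by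
  simp only [linPart]
  rw [Finset.prod_comm]
  refine Finset.prod_congr rfl fun x _ => ?_
  rw [prod_RIdx_ite_eq, dite_eq_ite, ite_not]

theorem squarefree_prod_linPart (b : F → RPrime r) : Squarefree (∏ α, linPart b α) := by
  rw [prod_linPart, squarefree_prod_iff]
  refine ⟨fun x => ?_, fun x y hxy => isCoprime_ite_X_sub_C hxy _ _⟩
  split_ifs
  · exact (irreducible_X_sub_C x).squarefree
  · exact squarefree_one

theorem isCoprime_prod_linPart_rootlessPoly (b : F → RPrime r) (φ : RootlessPrime F →₀ ℕ) :
    IsCoprime (∏ α, linPart b α) (rootlessPoly φ) := by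
  rw [prod_linPart]
  refine IsCoprime.prod_left fun x _ => ?_
  split_ifs
  · rw [(irreducible_X_sub_C x).coprime_iff_not_dvd, dvd_iff_isRoot]
    exact eval_rootlessPoly_ne_zero _ x
  · exact isCoprime_one_left

variable (F r) in
/-- Exponent vectors at the rootless primes with values in the tuples indexed by `R`. -/
abbrev RootlessTuple : Type _ := RootlessPrime F →₀ (RIdx r → ℕ)

/-- The part at `α` of a tuple of exponent vectors. -/
noncomputable abbrev RootlessTuple.part (g : RootlessTuple F r) (α : RIdx r) :
    RootlessPrime F →₀ ℕ := tupleEquiv (RootlessPrime F) (RIdx r) g α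

/-- The polynomials with given ramification data and given rootless parts. -/
noncomputable def mkPoly (b : F → RPrime r) (g : RootlessTuple F r) (α : RIdx r) : F[X] :=
  linPart b α * rootlessPoly (g.part α)

theorem monic_mkPoly (b : F → RPrime r) (g : RootlessTuple F r) (α : RIdx r) :
    (mkPoly b g α).Monic := (monic_linPart b α).mul (monic_rootlessPoly _)

theorem eval_mkPoly_eq_zero_iff (b : F → RPrime r) (g : RootlessTuple F r) (α : RIdx r) (x : F) :
    (mkPoly b g α).eval x = 0 ↔ b x = α.1 := by
  rw [mkPoly, eval_mul, mul_eq_zero, or_iff_left (eval_rootlessPoly_ne_zero _ x)]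
  refine ⟨fun h => by_contra fun h' => ?_, eval_linPart_eq_zero⟩
  rw [eval_linPart h'] at h
  exact Units.ne_zero _ h

theorem natDegree_mkPoly (b : F → RPrime r) (g : RootlessTuple F r) (α : RIdx r) :
    (mkPoly b g α).natDegree = (∑ x, if b x = α.1 then 1 else 0) +
      expDeg (fun P : RootlessPrime F => P.1.natDegree) (g.part α) := by
  rw [mkPoly, (monic_linPart b α).natDegree_mul (monic_rootlessPoly _), natDegree_linPart,
    natDegree_polyOf fun P : RootlessPrime F => P.2.1]

theorem squarefree_prod_mkPoly_iff (b : F → RPrime r) (g : RootlessTuple F r) :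
    Squarefree (∏ α, mkPoly b g α) ↔ ∀ P, ∑ α, g P α ≤ 1 := by
  simp only [mkPoly, Finset.prod_mul_distrib]
  rw [prod_rootlessPoly, squarefree_mul_iff,
    and_iff_right (isCoprime_prod_linPart_rootlessPoly b _).isRelPrime,
    and_iff_right (squarefree_prod_linPart b),
    squarefree_polyOf_iff Subtype.val_injective (fun P => P.2.1) fun P => P.2.2.1]
  simp [Finsupp.finsetSum_apply]

theorem exists_mkPoly_eq {f : RIdx r → F[X]} (hmonic : ∀ α, (f α).Monic)
    (hsq : Squarefree (∏ α, f α)) : ∃ b : F → RPrime r, ∃ g, mkPoly b g = f := by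
  obtain ⟨hsq, hcop⟩ := (squarefree_prod_iff f).1 hsq
  obtain ⟨b, hb⟩ := exists_ramification hcop
  choose G hG using fun α => linPart_dvd fun x => (hb x α).1
  have hG_monic (α : RIdx r) : (G α).Monic :=
    (monic_linPart b α).of_mul_monic_left (hG α ▸ hmonic α)
  have hG_eval (α : RIdx r) (x : F) : (G α).eval x ≠ 0 := by
    intro hx
    have hbx : b x = α.1 := (hb x α).2 (by rw [hG α, eval_mul, hx, mul_zero])
    have hdvd : (X - C x) * (X - C x) ∣ f α := by
      rw [hG α]
      exact mul_dvd_mul (dvd_iff_isRoot.2 (eval_linPart_eq_zero hbx)) (dvd_iff_isRoot.2 hx)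
    exact (irreducible_X_sub_C x).not_isUnit (hsq α _ hdvd)
  choose φ hφ using fun α => exists_rootlessPoly_eq (hG_monic α) (hG_eval α)
  refine ⟨b, (tupleEquiv (RootlessPrime F) (RIdx r)).symm φ, funext fun α => ?_⟩
  rw [mkPoly, RootlessTuple.part, Equiv.apply_symm_apply, hφ, ← hG]

theorem mkPoly_injective {b b' : F → RPrime r} {g g' : RootlessTuple F r}
    (h : mkPoly b g = mkPoly b' g') : b = b' ∧ g = g' := by
  obtain rfl : b = b' := funext fun x => eq_of_forall_RIdx_iff fun α => by
    rw [← eval_mkPoly_eq_zero_iff b g, h, eval_mkPoly_eq_zero_iff]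
  refine ⟨rfl, (tupleEquiv (RootlessPrime F) (RIdx r)).injective (funext fun α => ?_)⟩
  refine polyOf_injective Subtype.val_injective (fun P => P.2.1) (fun P => P.2.2.1) ?_
  exact mul_left_cancel₀ (monic_linPart b α).ne_zero (congrFun h α)

end Parametrization

/-! ### Values at the points of the projective line -/

section Values

variable {F : Type*} [Field F] {n : ℕ} {r : Fin n → ℕ}

theorem mulChar_pow_mod {χ : MulChar F ℂ} {m : ℕ} (hχ : orderOf χ = m) (u : Fˣ) (k : ℕ) :
    χ ((u : F) ^ (k % m)) = χ (u : F) ^ k := by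
  have hone : χ (u : F) ^ m = 1 := by
    rw [← MulChar.pow_apply_coe, ← hχ, pow_orderOf_eq_one, MulChar.one_apply_coe]
  rw [map_pow, ← pow_eq_pow_mod k hone]

theorem mulChar_leadCoeff {χ : MulChar F ℂ} {p : SOmega r} (hχ : orderOf χ = p.ell)
    (c : Fin n → Fˣ) :
    χ (leadCoeff c p) = χ (∏ j, (c j : F) ^ (p.ell / p.s j * p.ω j)) := by
  rw [leadCoeff, map_prod, map_prod]
  exact Finset.prod_congr rfl fun j _ => by rw [mulChar_pow_mod hχ, map_pow]

variable [∀ j, NeZero (r j)]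

theorem ell_dvd_pairing_degF_iff {d : RIdx r → ℕ}
    (hd : ∀ j, r j ∣ ∑ α : RIdx r, (α.1 j : ℕ) * d α) {f : RIdx r → F[X]} {b : RPrime r}
    (hf : ∀ α : RIdx r, (f α).natDegree + (if b = α.1 then 1 else 0) = d α) (p : SOmega r) :
    p.ell ∣ p.pairing (degF f) ↔ p ∈ ASet b := by
  have hdegF (j : Fin n) : degF f j + (b j : ℕ) = ∑ α : RIdx r, (α.1 j : ℕ) * d α := by
    rw [← sum_RIdx_mul_ite b j, degF, ← Finset.sum_add_distrib]
    exact Finset.sum_congr rfl fun α _ => by rw [← mul_add, hf]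
  have hmod : (fun j => (degF f j + (b j : ℕ)) % r j) = fun _ => 0 := funext fun j => by
    rw [hdegF, Nat.mod_eq_zero_of_dvd (hd j)]
  have hsum : ((p.pairing (degF f) : ℕ) : ZMod p.ell) + (p.pairing fun j => (b j : ℕ) : ℕ) = 0 :=
    calc ((p.pairing (degF f) : ℕ) : ZMod p.ell) + (p.pairing fun j => (b j : ℕ) : ℕ)
        = (p.pairing fun j => degF f j + (b j : ℕ) : ℕ) := by
          simp only [SOmega.pairing, mul_add, Finset.sum_add_distrib, Nat.cast_add]
      _ = 0 := by
          rw [← p.cast_pairing_mod, hmod]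
          simp [SOmega.pairing]
  rw [← ZMod.natCast_eq_zero_iff, eq_neg_of_add_eq_zero_left hsum, neg_eq_zero,
    ZMod.natCast_eq_zero_iff]
  rfl

theorem mulChar_valueAt_infty {χ : ℕ → MulChar F ℂ}
    (hχ : ∀ m, m ∣ Finset.univ.lcm r → orderOf (χ m) = m) {d : RIdx r → ℕ}
    (hd : ∀ j, r j ∣ ∑ α : RIdx r, (α.1 j : ℕ) * d α) (c : Fin n → Fˣ) {f : RIdx r → F[X]}
    {b : RPrime r} (hf : ∀ α : RIdx r, (f α).natDegree + (if b = α.1 then 1 else 0) = d α)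
    (p : SOmega r) :
    χ p.ell (valueAt c f p OnePoint.infty) = stateValue χ b c p := by
  classical
  have hval : valueAt c f p OnePoint.infty =
      if p.ell ∣ p.pairing (degF f) then leadCoeff c p else 0 := rfl
  rw [hval]
  by_cases hp : p ∈ ASet b
  · rw [if_pos ((ell_dvd_pairing_degF_iff hd hf p).2 hp), mulChar_leadCoeff (hχ _ p.ell_dvd)]
    simp only [stateValue, hp, if_true]
  · rw [if_neg fun h => hp ((ell_dvd_pairing_degF_iff hd hf p).1 h),
      (stateValue_eq_zero_iff _ _ _ _).2 hp, MulChar.map_zero]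

variable [Fintype F]

/-- The unit vector that governs the values at a point: at infinity it is the vector of leading
coefficients, and at a finite point it is built from the units `a x α`. -/
noncomputable def pointUnit (c : Fin n → Fˣ) (b : Option F → RPrime r) (a : F → RIdx r → Fˣ) :
    Option F → Fin n → Fˣ
  | none => c
  | some x => fun j => c j * ∏ α : RIdx r, (linUnit (fun z => b (some z)) α x * a x α) ^ (α.1 j : ℕ)

theorem mulChar_eval_FPoly_eq_zero {χ : MulChar F ℂ} (c : Fin n → Fˣ) {b : F → RPrime r}
    (g : RootlessTuple F r) {p : SOmega r} {x : F} (hp : p ∉ ASet (b x)) :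
    χ ((FPoly c (mkPoly b g) p).eval x) = 0 := by
  have hb : b x ≠ 0 := fun hb => hp (by rw [hb, mem_ASet_iff, map_zero])
  have hexp : (p.pairing fun j => (b x j : ℕ)) % p.ell ≠ 0 := fun h =>
    hp (Nat.dvd_of_mod_eq_zero h)
  rw [FPoly, eval_mul, eval_prod, Finset.prod_eq_zero (Finset.mem_univ (⟨b x, hb⟩ : RIdx r)),
    mul_zero, MulChar.map_zero]
  rw [eval_pow, (eval_mkPoly_eq_zero_iff b g _ x).2 rfl, zero_pow hexp]

theorem mulChar_eval_mkPoly_pow {χ : MulChar F ℂ} {p : SOmega r} (hχ : orderOf χ = p.ell)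
    {b : F → RPrime r} (g : RootlessTuple F r) {x : F} (hp : p ∈ ASet (b x)) (α : RIdx r) :
    χ ((mkPoly b g α ^ ((p.pairing fun j => (α.1 j : ℕ)) % p.ell)).eval x) =
      χ ((linUnit b α x * expCls RootlessPrime.values (g.part α) x : Fˣ) : F) ^
        (p.pairing fun j => (α.1 j : ℕ)) := by
  rw [eval_pow]
  by_cases hα : b x = α.1
  · have hdvd : p.ell ∣ p.pairing fun j => (α.1 j : ℕ) := hα ▸ hp
    rw [← mulChar_pow_mod hχ, Nat.mod_eq_zero_of_dvd hdvd, pow_zero, pow_zero]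
  · rw [mkPoly, eval_mul, eval_linPart hα, eval_rootlessPoly, ← Units.val_mul, mulChar_pow_mod hχ]

theorem mulChar_valueAt_some {χ : ℕ → MulChar F ℂ}
    (hχ : ∀ m, m ∣ Finset.univ.lcm r → orderOf (χ m) = m) (c : Fin n → Fˣ)
    (b : Option F → RPrime r) (g : RootlessTuple F r) (a : F → RIdx r → Fˣ)
    (ha : ∀ x α, a x α = expCls RootlessPrime.values (g.part α) x) (p : SOmega r) (x : F) :
    χ p.ell (valueAt c (mkPoly (fun z => b (some z)) g) p (OnePoint.some x)) =
      stateValue χ (b (some x)) (pointUnit c b a (some x)) p := by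
  have hord := hχ _ p.ell_dvd
  have hval : valueAt c (mkPoly (fun z => b (some z)) g) p (OnePoint.some x) =
      (FPoly c (mkPoly (fun z => b (some z)) g) p).eval x := rfl
  rw [hval]
  by_cases hp : p ∈ ASet (b (some x))
  · rw [FPoly, eval_mul, eval_C, eval_prod, map_mul, mulChar_leadCoeff hord, map_prod, map_prod,
      Finset.prod_congr rfl fun α _ =>
        mulChar_eval_mkPoly_pow (b := fun z => b (some z)) hord g hp α]
    simp only [stateValue, hp, if_true, pointUnit, ← ha, map_prod, map_pow, Units.val_mul,
      Units.coe_prod, Units.val_pow_eq_pow_val, mul_pow, map_mul, Finset.prod_mul_distrib,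
      SOmega.pairing, ← Finset.prod_pow_eq_pow_sum, ← Finset.prod_pow, ← pow_mul]
    congr 1
    rw [Finset.prod_comm (γ := RIdx r), Finset.prod_comm (γ := RIdx r)]
    simp only [mul_comm]
  · rw [(stateValue_eq_zero_iff _ _ _ _).2 hp]
    exact mulChar_eval_FPoly_eq_zero (b := fun z => b (some z)) c g hp

end Values

/-! ### Counting the members with given local data -/

section Ramification

variable (F : Type*) [Fintype F] {n : ℕ} {r : Fin n → ℕ} [∀ j, NeZero (r j)]

/-- The weight of the ramification vector `γ` at one point: each ramified point costs one power of
`q`, since it lowers the degrees left to the rootless parts by one. -/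
noncomputable def ramFactor (γ : RPrime r) : ℝ := if γ = 0 then 1 else (Fintype.card F : ℝ)⁻¹

variable {F}

/-- The weight `q ^ (-t)` of ramification data with `t` ramified points. -/
noncomputable def ramWeight (b : Option F → RPrime r) : ℝ := ∏ y, ramFactor F (b y)

/-- The number of points of the projective line with ramification vector `α`. -/
def ramCount (b : Option F → RPrime r) (α : RIdx r) : ℕ := ∑ y, if b y = α.1 then 1 else 0

theorem inv_pow_sum_ramCount (b : Option F → RPrime r) :
    (Fintype.card F : ℝ)⁻¹ ^ ∑ α, ramCount b α = ramWeight b := by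
  simp only [ramCount, ramWeight]
  rw [Finset.sum_comm, ← Finset.prod_pow_eq_pow_sum]
  refine Finset.prod_congr rfl fun y _ => ?_
  rw [sum_RIdx_ite_eq, ramFactor]
  split_ifs
  exacts [pow_zero _, pow_one _]

theorem ramCount_le (b : Option F → RPrime r) (α : RIdx r) :
    ramCount b α ≤ Fintype.card F + 1 := by
  have hle : ramCount b α ≤ ∑ _y : Option F, 1 :=
    Finset.sum_le_sum fun y _ => by split_ifs <;> lia
  simpa using hle

theorem ramWeight_nonneg (b : Option F → RPrime r) : 0 ≤ ramWeight b := by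
  rw [← inv_pow_sum_ramCount]
  positivity

theorem ramWeight_le_one [Nonempty F] (b : Option F → RPrime r) : ramWeight b ≤ 1 := by
  rw [← inv_pow_sum_ramCount]
  exact pow_le_one₀ (by positivity) (inv_le_one_of_one_le₀
    (by exact_mod_cast Fintype.card_pos (α := F)))

theorem pow_sum_sub_ramCount [Nonempty F] {b : Option F → RPrime r} {d : RIdx r → ℕ}
    (hle : ∀ α, ramCount b α ≤ d α) :
    (Fintype.card F : ℝ) ^ (∑ α, (d α - ramCount b α)) =
      (Fintype.card F : ℝ) ^ (∑ α, d α) * ramWeight b := by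
  have hsum : ∑ α, (d α - ramCount b α) + ∑ α, ramCount b α = ∑ α, d α := by
    rw [← Finset.sum_add_distrib]
    exact Finset.sum_congr rfl fun α _ => Nat.sub_add_cancel (hle α)
  have hq : (Fintype.card F : ℝ) ≠ 0 := Nat.cast_ne_zero.2 Fintype.card_ne_zero
  rw [← inv_pow_sum_ramCount, ← hsum, pow_add, mul_assoc, ← mul_pow, mul_inv_cancel₀ hq, one_pow,
    mul_one]

end Ramification

section Counting

variable {F : Type*} [Field F] [Fintype F] {n : ℕ} {r : Fin n → ℕ} [∀ j, NeZero (r j)]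

variable (F r) in
/-- The local data of a member of the full family: the leading coefficients, the ramification
vectors at the points of the projective line, and the values of the rootless parts at the finite
points. -/
abbrev LocalData : Type _ := (Fin n → Fˣ) × (Option F → RPrime r) × (F → RIdx r → Fˣ)

/-- The rootless tuples that, with the local data `ω`, give a member of the full family. -/
def fiber (d : RIdx r → ℕ) (ω : LocalData F r) : Set (RootlessTuple F r) :=
  {g | (∀ P, ∑ α, g P α ≤ 1) ∧ ∀ α,
    expDeg (fun P : RootlessPrime F => P.1.natDegree) (g.part α) + ramCount ω.2.1 α = d α ∧
      expCls RootlessPrime.values (g.part α) = fun x => ω.2.2 x α}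

/-- The member of the full family with given local data and rootless parts. -/
noncomputable def assemble (z : LocalData F r × RootlessTuple F r) :
    (Fin n → Fˣ) × (RIdx r → F[X]) :=
  (z.1.1, mkPoly (fun x => z.1.2.1 (some x)) z.2)

/-- The members of the full family whose local data lie in `Q`. -/
def membersWith (d : RIdx r → ℕ) (Q : Finset (LocalData F r)) :
    Set ((Fin n → Fˣ) × (RIdx r → F[X])) :=
  assemble '' {z | z.1 ∈ Q ∧ z.2 ∈ fiber d z.1}

theorem natDegree_add_of_mem_fiber {d : RIdx r → ℕ} {ω : LocalData F r} {g : RootlessTuple F r}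
    (hg : g ∈ fiber d ω) (α : RIdx r) :
    (mkPoly (fun x => ω.2.1 (some x)) g α).natDegree +
      (if ω.2.1 none = α.1 then 1 else 0) = d α := by
  rw [← (hg.2 α).1, natDegree_mkPoly, ramCount, Fintype.sum_option]
  ring

theorem assemble_injOn (d : RIdx r → ℕ) :
    Set.InjOn (assemble (F := F)) {z | z.2 ∈ fiber d z.1} := by
  rintro ⟨⟨c, b, a⟩, g⟩ hz ⟨⟨c', b', a'⟩, g'⟩ hz' h
  simp only [assemble, Prod.mk.injEq] at h
  obtain ⟨rfl, h⟩ := h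
  obtain ⟨hb_some, rfl⟩ := mkPoly_injective h
  have hb_none : b none = b' none := eq_of_forall_RIdx_iff fun α => by
    have hdeg := (natDegree_add_of_mem_fiber hz α).trans (natDegree_add_of_mem_fiber hz' α).symm
    simp only [← h] at hdeg
    split_ifs at hdeg <;> simp_all
  obtain rfl : b = b' := funext fun y => by
    cases y with
    | none => exact hb_none
    | some x => exact congrFun hb_some x
  obtain rfl : a = a' := funext₂ fun x α =>
    (congrFun (hz.2 α).2 x).symm.trans (congrFun (hz'.2 α).2 x)
  rfl

theorem assemble_image (d : RIdx r → ℕ) :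
    assemble '' {z : LocalData F r × RootlessTuple F r | z.2 ∈ fiber d z.1} = fullFamily F d := by
  ext cf
  rw [mem_fullFamily_iff]
  constructor
  · rintro ⟨⟨ω, g⟩, hz, rfl⟩
    exact ⟨monic_mkPoly _ _, (squarefree_prod_mkPoly_iff _ _).2 hz.1, ω.2.1 none,
      natDegree_add_of_mem_fiber hz⟩
  · rintro ⟨hmonic, hsq, b_infty, hdeg⟩
    obtain ⟨c, f⟩ := cf
    obtain ⟨b, g, rfl⟩ := exists_mkPoly_eq hmonic hsq
    refine ⟨((c, fun y => y.elim b_infty b,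
        fun x α => expCls RootlessPrime.values (g.part α) x), g),
      ⟨(squarefree_prod_mkPoly_iff _ _).1 hsq, fun α => ⟨?_, rfl⟩⟩, rfl⟩
    rw [← hdeg α, natDegree_mkPoly, ramCount, Fintype.sum_option, add_comm, add_assoc,
      add_comm (ite _ _ _)]
    rfl

theorem finite_fiber (d : RIdx r → ℕ) (ω : LocalData F r) : (fiber d ω).Finite :=
  (finite_setOf_tupleEquiv_mem fun α => (primeSystem_rootlessPrime (F := F)).finite
    (d α - ramCount ω.2.1 α) fun x => ω.2.2 x α).subset fun _ hg α =>
      ⟨Nat.eq_sub_of_add_eq (hg.2 α).1, (hg.2 α).2⟩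

theorem ncard_membersWith (d : RIdx r → ℕ) (Q : Finset (LocalData F r)) :
    (membersWith d Q).ncard = ∑ ω ∈ Q, (fiber d ω).ncard := by
  have hfin (ω : Q) : Finite (fiber d ω.1) := finite_fiber d ω.1
  rw [membersWith, ((assemble_injOn d).mono fun z hz => hz.2).ncard_image, ← Finset.sum_coe_sort Q]
  simp only [← Nat.card_coe_set_eq]
  rw [← Nat.card_sigma]
  exact Nat.card_congr
    { toFun := fun z => ⟨⟨z.1.1, z.2.1⟩, z.1.2, z.2.2⟩
      invFun := fun z => ⟨(z.1.1, z.2.1), z.1.2, z.2.2⟩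
      left_inv := fun _ => rfl
      right_inv := fun _ => rfl }

theorem fiber_eq_sqfreeTuples {d : RIdx r → ℕ} {ω : LocalData F r}
    (hle : ∀ α, ramCount ω.2.1 α ≤ d α) :
    fiber d ω = PrimeSystem.sqfreeTuples (fun P : RootlessPrime F => P.1.natDegree)
      RootlessPrime.values (fun α => d α - ramCount ω.2.1 α) (fun α x => ω.2.2 x α) := by
  ext g
  refine and_congr Iff.rfl (forall_congr' fun α => and_congr ?_ Iff.rfl)
  exact ⟨Nat.eq_sub_of_add_eq, fun h => (congrArg (· + _) h).trans (Nat.sub_add_cancel (hle α))⟩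

theorem fiber_eq_empty {d : RIdx r → ℕ} {ω : LocalData F r} {α : RIdx r}
    (hlt : d α < ramCount ω.2.1 α) : fiber d ω = ∅ := by
  refine Set.eq_empty_of_forall_notMem fun g hg => ?_
  have := (hg.2 α).1
  lia

theorem inv_pow_le_pow_mul_inv_pow_iInf {s : ℝ} (hs : 1 ≤ s) {ι : Type*} {d : ι → ℕ} {i : ι}
    {m k : ℕ} (hd : d i ≤ m + k) : s⁻¹ ^ m ≤ s ^ k * s⁻¹ ^ (⨅ i, d i) := by
  have hs_pos : 0 < s := one_pos.trans_le hs
  calc s⁻¹ ^ m = s ^ k * s⁻¹ ^ (m + k) := by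
        rw [pow_add, mul_left_comm, ← mul_pow, mul_inv_cancel₀ hs_pos.ne', one_pow, mul_one]
    _ ≤ s ^ k * s⁻¹ ^ (⨅ i, d i) := by
        refine mul_le_mul_of_nonneg_left (pow_le_pow_of_le_one (by positivity)
          (inv_le_one_of_one_le₀ hs) ?_) (by positivity)
        exact (ciInf_le (OrderBot.bddBelow _) i).trans hd

variable (F r) in
/-- The leading constant in the number of rootless tuples with given local data. -/
noncomputable def fiberDensity : ℝ :=
  ((Fintype.card F : ℝ) ^ Fintype.card F)⁻¹ ^ Fintype.card (RIdx r) *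
    PrimeSystem.tupleDensity (RIdx r) (fun P : RootlessPrime F => P.1.natDegree) (Fintype.card F)

variable (F r) in
theorem exists_abs_ncard_fiber_sub_le_of_ramCount_le :
    ∃ C : ℝ, 0 ≤ C ∧ ∀ (d : RIdx r → ℕ) (ω : LocalData F r), (∀ α, ramCount ω.2.1 α ≤ d α) →
      |((fiber d ω).ncard : ℝ) -
          fiberDensity F r * (Fintype.card F : ℝ) ^ (∑ α, d α) * ramWeight ω.2.1| ≤
        C * (Fintype.card F : ℝ) ^ (∑ α, d α) * (√(Fintype.card F : ℝ))⁻¹ ^ (⨅ α, d α) := by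
  have hsys := primeSystem_rootlessPrime (F := F)
  obtain ⟨C, hC, hest⟩ := hsys.exists_abs_ncard_sqfreeTuples_sub_le (RIdx r)
  set q : ℝ := (Fintype.card F : ℝ)
  set B := √q ^ (Fintype.card F + 1)
  have hB : 0 ≤ B := pow_nonneg (Real.sqrt_nonneg q) _
  refine ⟨C * (Fintype.card (RIdx r) * B), by positivity, fun d ω hle => ?_⟩
  have herr : ∑ α, (√q)⁻¹ ^ (d α - ramCount ω.2.1 α) ≤
      Fintype.card (RIdx r) * (B * (√q)⁻¹ ^ (⨅ α, d α)) := by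
    rw [← nsmul_eq_mul, ← Finset.card_univ]
    refine Finset.sum_le_card_nsmul _ _ _ fun α _ =>
      inv_pow_le_pow_mul_inv_pow_iInf (i := α) hsys.one_lt_sqrt.le ?_
    have := ramCount_le ω.2.1 α
    lia
  have h := hest (fun α => d α - ramCount ω.2.1 α) (fun α x => ω.2.2 x α)
  rw [← fiber_eq_sqfreeTuples hle, pow_sum_sub_ramCount hle, ← mul_assoc] at h
  calc _ ≤ C * (q ^ (∑ α, d α) * ramWeight ω.2.1) * ∑ α, (√q)⁻¹ ^ (d α - ramCount ω.2.1 α) := h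
    _ ≤ C * (q ^ (∑ α, d α) * 1) *
          (Fintype.card (RIdx r) * (B * (√q)⁻¹ ^ (⨅ α, d α))) := by
        have := ramWeight_nonneg ω.2.1
        have := ramWeight_le_one ω.2.1
        gcongr
    _ = C * (Fintype.card (RIdx r) * B) * q ^ (∑ α, d α) * (√q)⁻¹ ^ (⨅ α, d α) := by ring

theorem abs_ncard_fiber_sub_le_of_lt_ramCount {d : RIdx r → ℕ} {ω : LocalData F r} {α : RIdx r}
    (hlt : d α < ramCount ω.2.1 α) :
    |((fiber d ω).ncard : ℝ) -
        fiberDensity F r * (Fintype.card F : ℝ) ^ (∑ α, d α) * ramWeight ω.2.1| ≤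
      |fiberDensity F r| * √(Fintype.card F : ℝ) ^ (Fintype.card F + 1) *
        (Fintype.card F : ℝ) ^ (∑ α, d α) * (√(Fintype.card F : ℝ))⁻¹ ^ (⨅ α, d α) := by
  set q : ℝ := (Fintype.card F : ℝ)
  have hq : 0 ≤ q := Nat.cast_nonneg _
  have hmin : 1 ≤ √q ^ (Fintype.card F + 1) * (√q)⁻¹ ^ (⨅ α, d α) := by
    have := ramCount_le ω.2.1 α
    simpa only [pow_zero] using inv_pow_le_pow_mul_inv_pow_iInf (i := α) (m := 0)
      primeSystem_rootlessPrime.one_lt_sqrt.le (by lia : d α ≤ 0 + (Fintype.card F + 1))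
  rw [fiber_eq_empty hlt, Set.ncard_empty, Nat.cast_zero, zero_sub, abs_neg, abs_mul, abs_mul,
    abs_of_nonneg (ramWeight_nonneg _), abs_of_nonneg (pow_nonneg hq _)]
  calc |fiberDensity F r| * q ^ (∑ α, d α) * ramWeight ω.2.1
      ≤ |fiberDensity F r| * q ^ (∑ α, d α) *
          (√q ^ (Fintype.card F + 1) * (√q)⁻¹ ^ (⨅ α, d α)) := by
        gcongr
        exact (ramWeight_le_one _).trans hmin
    _ = _ := by ring

variable (F r) in
theorem exists_abs_ncard_fiber_sub_le :
    ∃ C : ℝ, 0 ≤ C ∧ ∀ (d : RIdx r → ℕ) (ω : LocalData F r),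
      |((fiber d ω).ncard : ℝ) -
          fiberDensity F r * (Fintype.card F : ℝ) ^ (∑ α, d α) * ramWeight ω.2.1| ≤
        C * (Fintype.card F : ℝ) ^ (∑ α, d α) * (√(Fintype.card F : ℝ))⁻¹ ^ (⨅ α, d α) := by
  obtain ⟨C, hC, hest⟩ := exists_abs_ncard_fiber_sub_le_of_ramCount_le F r
  refine ⟨max C (|fiberDensity F r| * √(Fintype.card F : ℝ) ^ (Fintype.card F + 1)),
    hC.trans (le_max_left _ _), fun d ω => ?_⟩
  by_cases hle : ∀ α, ramCount ω.2.1 α ≤ d α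
  · refine (hest d ω hle).trans ?_
    gcongr
    exact le_max_left _ _
  · push Not at hle
    obtain ⟨α, hα⟩ := hle
    refine (abs_ncard_fiber_sub_le_of_lt_ramCount hα).trans ?_
    gcongr
    exact le_max_right _ _

variable (F r) in
theorem exists_abs_ncard_membersWith_sub_le :
    ∃ C : ℝ, 0 ≤ C ∧ ∀ (d : RIdx r → ℕ) (Q : Finset (LocalData F r)),
      |((membersWith d Q).ncard : ℝ) -
          fiberDensity F r * (Fintype.card F : ℝ) ^ (∑ α, d α) * ∑ ω ∈ Q, ramWeight ω.2.1| ≤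
        C * (Fintype.card F : ℝ) ^ (∑ α, d α) * (√(Fintype.card F : ℝ))⁻¹ ^ (⨅ α, d α) := by
  obtain ⟨C, hC, hest⟩ := exists_abs_ncard_fiber_sub_le F r
  refine ⟨Nat.card (LocalData F r) * C, by positivity, fun d Q => ?_⟩
  rw [ncard_membersWith, Finset.mul_sum, Nat.cast_sum, ← Finset.sum_sub_distrib]
  refine (Finset.abs_sum_le_sum_abs _ _).trans ?_
  refine (Finset.sum_le_card_nsmul _ _ _ fun ω _ => hest d ω).trans ?_
  rw [nsmul_eq_mul, mul_assoc, mul_assoc, mul_assoc]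
  gcongr
  rw [← Set.ncard_coe_finset]
  exact Set.ncard_le_card _

end Counting

theorem finite_fullFamily (F : Type*) [Field F] [Finite F] {n : ℕ} {r : Fin n → ℕ}
    [∀ j, NeZero (r j)] (d : RIdx r → ℕ) : (fullFamily F d).Finite := by
  have := Fintype.ofFinite F
  rw [← assemble_image]
  exact ((Set.finite_univ.prod (Set.finite_iUnion fun ω => finite_fiber d ω)).subset fun z hz =>
    ⟨Set.mem_univ z.1, Set.mem_iUnion.2 ⟨z.1, hz⟩⟩).image _

/-! ### Local weights -/

theorem card_filter_add_mem {A G : Type*} [CommGroup A] [Fintype A] [AddCommGroup G] [Finite G]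
    {θ : A →* Multiplicative G} (hθ : Function.Surjective θ) (H : AddSubgroup G) (t : G)
    [DecidablePred fun v : A => (θ v).toAdd + t ∈ H] :
    (((Finset.univ.filter fun v : A => (θ v).toAdd + t ∈ H).card : ℕ) : ℝ) =
      Fintype.card A * ((Nat.card H : ℝ) / Nat.card G) := by
  obtain ⟨w, hw⟩ := hθ (Multiplicative.ofAdd t)
  set K := (AddSubgroup.toSubgroup H).comap θ
  have hfilter : (Finset.univ.filter fun v : A => (θ v).toAdd + t ∈ H).card = Nat.card K := by
    rw [← Fintype.card_subtype, ← Nat.card_eq_fintype_card]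
    refine Nat.card_congr ((Equiv.mulRight w).subtypeEquiv fun v => ?_)
    rw [Equiv.coe_mulRight, Subgroup.mem_comap, map_mul, hw]
    rfl
  have hK : Nat.card K * H.index = Fintype.card A := by
    rw [← Nat.card_eq_fintype_card, ← K.card_mul_index, Subgroup.index_comap_of_surjective _ hθ]
    rfl
  have hH := H.card_mul_index
  have hcard_H : (Nat.card H : ℝ) ≠ 0 := Nat.cast_ne_zero.2 Nat.card_pos.ne'
  have hindex : (H.index : ℝ) ≠ 0 := Nat.cast_ne_zero.2 AddSubgroup.FiniteIndex.index_ne_zero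
  rw [hfilter, ← hK, ← hH]
  push_cast
  field_simp

section UnitParts

variable {F : Type*} [Field F] [Fintype F] {n : ℕ} {r : Fin n → ℕ} [∀ j, NeZero (r j)]

variable (F r) in
/-- The homomorphism `v ↦ (∏_α v_α ^ α_j)_j`. -/
def monomialHom : (RIdx r → Fˣ) →* (Fin n → Fˣ) where
  toFun v j := ∏ α : RIdx r, v α ^ (α.1 j : ℕ)
  map_one' := by ext; simp
  map_mul' v w := by ext; simp [mul_pow, Finset.prod_mul_distrib]

theorem pointUnit_some (c : Fin n → Fˣ) (b : Option F → RPrime r) (a : F → RIdx r → Fˣ) (x : F) :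
    pointUnit c b a (some x) =
      monomialHom F r (a x) * (c * monomialHom F r fun α => linUnit (fun z => b (some z)) α x) := by
  ext j
  simp only [pointUnit, monomialHom, mul_pow, Finset.prod_mul_distrib, MonoidHom.coe_mk,
    OneHom.coe_mk, Pi.mul_apply, Units.val_mul]
  ring

theorem logHom_comp_monomialHom_surjective (hq : ∀ j, Fintype.card F ≡ 1 [MOD r j]) :
    Function.Surjective ((logHom hq).comp (monomialHom F r)) := by
  classical
  intro y
  by_cases hy : y.toAdd = 0
  · exact ⟨1, (map_one _).trans (Multiplicative.toAdd.injective hy).symm⟩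
  have hmonomial : monomialHom F r (Pi.mulSingle ⟨y.toAdd, hy⟩ (unitGen F)) =
      fun j => unitGen F ^ (y.toAdd j : ℕ) := by
    funext j
    refine (Finset.prod_eq_single (⟨y.toAdd, hy⟩ : RIdx r) (fun α _ hα => ?_) ?_).trans ?_
    · rw [Pi.mulSingle_eq_of_ne hα, one_pow]
    · exact fun h => absurd (Finset.mem_univ _) h
    · rw [Pi.mulSingle_eq_same]
  refine ⟨Pi.mulSingle ⟨y.toAdd, hy⟩ (unitGen F), ?_⟩
  rw [MonoidHom.comp_apply, hmonomial]
  exact congrArg Multiplicative.ofAdd (logVec_unitGen_pow hq y.toAdd)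

theorem cast_card_units_fun (ι : Type*) [Fintype ι] [DecidableEq ι] [Fintype Fˣ] :
    (Fintype.card (ι → Fˣ) : ℝ) = ((Fintype.card F : ℝ) - 1) ^ Fintype.card ι := by
  rw [Fintype.card_fun, Nat.cast_pow, ← Nat.card_eq_fintype_card, Nat.card_units,
    Nat.card_eq_fintype_card, Nat.cast_sub Fintype.card_pos, Nat.cast_one]

variable (F r) in
/-- The number of choices of the unit parts in the local data. -/
noncomputable def unitChoices : ℝ :=
  ((Fintype.card F : ℝ) - 1) ^ n * (((Fintype.card F : ℝ) - 1) ^ Fintype.card (RIdx r)) ^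
    Fintype.card F

open Classical in
theorem card_filter_pointUnit_some (hq : ∀ j, Fintype.card F ≡ 1 [MOD r j])
    (b : Option F → RPrime r) (H : RPrime r → AddSubgroup (RPrime r)) (t : Option F → RPrime r)
    (c : Fin n → Fˣ) :
    (((Finset.univ.filter fun a : F → RIdx r → Fˣ => ∀ x : F,
      logVec r (pointUnit c b a (some x)) - t (some x) ∈ H (b (some x))).card : ℕ) : ℝ) =
      ∏ x : F, (((Fintype.card F : ℝ) - 1) ^ Fintype.card (RIdx r) *
        ((Nat.card (H (b (some x))) : ℝ) / groupOrder r)) := by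
  set S : F → Finset (RIdx r → Fˣ) := fun x => Finset.univ.filter fun v =>
    (((logHom hq).comp (monomialHom F r)) v).toAdd +
      (logVec r (c * monomialHom F r fun α => linUnit (fun z => b (some z)) α x) - t (some x)) ∈
        H (b (some x)) with hS
  have hpi : (Finset.univ.filter fun a : F → RIdx r → Fˣ => ∀ x : F,
      logVec r (pointUnit c b a (some x)) - t (some x) ∈ H (b (some x))) =
      Fintype.piFinset S := by
    ext a
    simp only [Finset.mem_filter, Finset.mem_univ, true_and, Fintype.mem_piFinset, hS]
    refine forall_congr' fun x => ?_
    rw [pointUnit_some, logVec_mul hq, add_sub_assoc]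
    rfl
  rw [hpi, Fintype.card_piFinset, Nat.cast_prod]
  refine Finset.prod_congr rfl fun x _ => ?_
  rw [card_filter_add_mem (logHom_comp_monomialHom_surjective (F := F) hq), cast_card_units_fun,
    Nat.card_eq_fintype_card (α := RPrime r), card_RPrime]

open Classical in
theorem card_filter_pointUnit (hq : ∀ j, Fintype.card F ≡ 1 [MOD r j]) (b : Option F → RPrime r)
    (H : RPrime r → AddSubgroup (RPrime r)) (t : Option F → RPrime r) :
    (((Finset.univ.filter fun z : (Fin n → Fˣ) × (F → RIdx r → Fˣ) =>
      ∀ y, logVec r (pointUnit z.1 b z.2 y) - t y ∈ H (b y)).card : ℕ) : ℝ) =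
      unitChoices F r * ∏ y, ((Nat.card (H (b y)) : ℝ) / groupOrder r) := by
  have hinner (c : Fin n → Fˣ) : (∑ a : F → RIdx r → Fˣ, ((if ∀ y,
      logVec r (pointUnit c b a y) - t y ∈ H (b y) then 1 else 0 : ℕ) : ℝ)) =
      if (logHom hq c).toAdd + (-t none) ∈ H (b none) then
        ∏ x : F, (((Fintype.card F : ℝ) - 1) ^ Fintype.card (RIdx r) *
          ((Nat.card (H (b (some x))) : ℝ) / groupOrder r)) else 0 := by
    have hinfty : (logHom hq c).toAdd + (-t none) ∈ H (b none) ↔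
        logVec r c - t none ∈ H (b none) := by
      rw [sub_eq_add_neg]
      rfl
    rw [← card_filter_pointUnit_some hq b H t c, ← Nat.cast_sum, ← Finset.card_filter]
    simp only [Option.forall, hinfty, pointUnit]
    split_ifs with h <;> simp [h]
  rw [Finset.card_filter, Nat.cast_sum, Fintype.sum_prod_type,
    Finset.sum_congr rfl fun c _ => hinner c, ← Finset.sum_filter, Finset.sum_const, nsmul_eq_mul,
    card_filter_add_mem (logHom_surjective hq), cast_card_units_fun, Fintype.card_fin,
    Nat.card_eq_fintype_card (α := RPrime r), card_RPrime, Fintype.prod_option,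
    Finset.prod_mul_distrib, Finset.prod_const, Finset.card_univ, unitChoices]
  ring

open Classical in
/-- The local data with ramification vectors in the sets `T y` and with the logarithm of the unit
vector at `y` in the coset of `t y` modulo the subgroup attached to the ramification vector. -/
noncomputable def localCondition (T : Option F → Finset (RPrime r))
    (H : RPrime r → AddSubgroup (RPrime r)) (t : Option F → RPrime r) : Finset (LocalData F r) :=
  Finset.univ.filter fun ω => (∀ y, ω.2.1 y ∈ T y) ∧
    ∀ y, logVec r (pointUnit ω.1 ω.2.1 ω.2.2 y) - t y ∈ H (ω.2.1 y)

theorem mem_localCondition {T : Option F → Finset (RPrime r)}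
    {H : RPrime r → AddSubgroup (RPrime r)} {t : Option F → RPrime r} {ω : LocalData F r} :
    ω ∈ localCondition T H t ↔ (∀ y, ω.2.1 y ∈ T y) ∧
      ∀ y, logVec r (pointUnit ω.1 ω.2.1 ω.2.2 y) - t y ∈ H (ω.2.1 y) := by
  simp [localCondition]

open Classical in
theorem card_filter_localCondition (hq : ∀ j, Fintype.card F ≡ 1 [MOD r j])
    {T : Option F → Finset (RPrime r)} (H : RPrime r → AddSubgroup (RPrime r))
    (t : Option F → RPrime r) {b : Option F → RPrime r} (hb : ∀ y, b y ∈ T y) :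
    ((((localCondition T H t).filter fun ω => ω.2.1 = b).card : ℕ) : ℝ) =
      unitChoices F r * ∏ y, ((Nat.card (H (b y)) : ℝ) / groupOrder r) := by
  rw [← card_filter_pointUnit hq b H t, Nat.cast_inj]
  refine Finset.card_bij' (fun ω _ => (ω.1, ω.2.2)) (fun z _ => (z.1, b, z.2)) ?_ ?_ ?_ ?_ <;>
    simp only [Finset.mem_filter, mem_localCondition, Finset.mem_univ, true_and]
  · rintro ⟨c, _, a⟩ ⟨h, rfl⟩
    exact h.2
  · exact fun z h => ⟨⟨hb, h⟩, trivial⟩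
  · rintro ⟨c, _, a⟩ ⟨-, rfl⟩
    rfl
  · exact fun _ _ => trivial

variable (F) in
/-- The weight at one point of the condition that the ramification vector `γ` lies in `T` and that
the logarithm of the unit vector lies in a given coset of `H γ`. -/
noncomputable def localWeight (T : Finset (RPrime r)) (H : RPrime r → AddSubgroup (RPrime r)) :
    ℝ :=
  ∑ γ ∈ T, (Nat.card (H γ) : ℝ) / groupOrder r * ramFactor F γ

theorem sum_ramWeight_localCondition (hq : ∀ j, Fintype.card F ≡ 1 [MOD r j])
    (T : Option F → Finset (RPrime r)) (H : RPrime r → AddSubgroup (RPrime r))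
    (t : Option F → RPrime r) :
    ∑ ω ∈ localCondition T H t, ramWeight ω.2.1 =
      unitChoices F r * ∏ y, localWeight F (T y) H := by
  classical
  have hmaps : ∀ ω ∈ localCondition T H t, ω.2.1 ∈ Fintype.piFinset T := fun ω hω =>
    Fintype.mem_piFinset.2 (mem_localCondition.1 hω).1
  simp only [localWeight]
  rw [Finset.prod_univ_sum, Finset.mul_sum, ← Finset.sum_fiberwise_of_maps_to hmaps]
  refine Finset.sum_congr rfl fun b hb => ?_
  rw [Finset.sum_congr rfl (g := fun _ => ramWeight b)
    fun ω hω => congrArg ramWeight (Finset.mem_filter.1 hω).2, Finset.sum_const, nsmul_eq_mul,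
    card_filter_localCondition hq H t (Fintype.mem_piFinset.1 hb), Finset.prod_mul_distrib,
    ramWeight, mul_assoc]

end UnitParts

section ClassWeights

variable (F : Type*) [Fintype F] {n : ℕ} {r : Fin n → ℕ} [∀ j, NeZero (r j)]

theorem cast_groupOrder : (groupOrder r : ℝ) = Fintype.card (RIdx r) + 1 := by
  exact_mod_cast (card_RIdx_add_one (r := r)).symm

theorem cast_groupOrder_pos : (0 : ℝ) < groupOrder r := by
  rw [cast_groupOrder]
  positivity

variable (r) in
/-- The weight `(q + |G| - 1) / q` of all the local data at one point. -/
noncomputable def totalWeight : ℝ := 1 + Fintype.card (RIdx r) * (Fintype.card F : ℝ)⁻¹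

variable (r) in
theorem totalWeight_pos : 0 < totalWeight F r := by
  rw [totalWeight]
  positivity

variable (r) in
theorem localWeight_univ_top :
    localWeight F (Finset.univ : Finset (RPrime r)) (fun _ => ⊤) = totalWeight F r := by
  simp only [localWeight, AddSubgroup.card_top]
  rw [Nat.card_eq_fintype_card, card_RPrime,
    div_self (cast_groupOrder_pos (r := r)).ne']
  simp only [one_mul, ramFactor]
  rw [← Finset.add_sum_erase _ _ (Finset.mem_univ 0), if_pos rfl,
    Finset.sum_congr rfl fun γ hγ => if_neg (Finset.ne_of_mem_erase hγ), Finset.sum_const,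
    nsmul_eq_mul, Finset.card_erase_of_mem (Finset.mem_univ _), Finset.card_univ, card_RPrime,
    ← card_RIdx_add_one, Nat.add_sub_cancel, totalWeight]

open Classical in
/-- The class of `β`: the vectors that generate the same cyclic group as `β`. -/
noncomputable def sameClass (β : RPrime r) : Finset (RPrime r) :=
  Finset.univ.filter fun γ => AddSubgroup.zmultiples γ = AddSubgroup.zmultiples β

theorem mem_sameClass {β γ : RPrime r} :
    γ ∈ sameClass β ↔ AddSubgroup.zmultiples γ = AddSubgroup.zmultiples β := by
  simp [sameClass]

theorem card_sameClass (β : RPrime r) : (sameClass β).card = Nat.totient (addOrderOf β) := by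
  rw [← ncard_zmultiples_eq β, ← Set.ncard_coe_finset]
  congr 1
  ext γ
  exact mem_sameClass

theorem addOrderOf_eq_of_zmultiples_eq {G : Type*} [AddGroup G] {β γ : G}
    (h : AddSubgroup.zmultiples γ = AddSubgroup.zmultiples β) : addOrderOf γ = addOrderOf β := by
  rw [← Nat.card_zmultiples, h, Nat.card_zmultiples]

theorem ramFactor_eq_of_zmultiples_eq {β γ : RPrime r}
    (h : AddSubgroup.zmultiples γ = AddSubgroup.zmultiples β) : ramFactor F γ = ramFactor F β := by
  have hzero : γ = 0 ↔ β = 0 := by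
    rw [← AddSubgroup.zmultiples_eq_bot, h, AddSubgroup.zmultiples_eq_bot]
  simp only [ramFactor, hzero]

/-- The weight at one point of the local data that give a prescribed family of values of the class
of `β`. -/
noncomputable def classWeight (β : RPrime r) : ℝ :=
  (Nat.totient (addOrderOf β ^ 2) : ℝ) / groupOrder r * ramFactor F β

theorem localWeight_sameClass (β : RPrime r) :
    localWeight F (sameClass β) AddSubgroup.zmultiples = classWeight F β := by
  have hterm : ∀ γ ∈ sameClass β,
      (Nat.card (AddSubgroup.zmultiples γ) : ℝ) / groupOrder r * ramFactor F γ =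
        addOrderOf β / groupOrder r * ramFactor F β := fun γ hγ => by
    rw [Nat.card_zmultiples, addOrderOf_eq_of_zmultiples_eq (mem_sameClass.1 hγ),
      ramFactor_eq_of_zmultiples_eq F (mem_sameClass.1 hγ)]
  rw [localWeight, Finset.sum_congr rfl hterm, Finset.sum_const, card_sameClass, nsmul_eq_mul,
    classWeight, totient_sq (addOrderOf_pos β), Nat.cast_mul]
  ring

end ClassWeights

/-! ### Densities and the main estimate -/

section Prescribed

variable {F : Type*} [Field F] [Fintype F] {n : ℕ} {r : Fin n → ℕ} [∀ j, NeZero (r j)]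
  {χ : ℕ → MulChar F ℂ} {d : RIdx r → ℕ}

theorem mulChar_valueAt_assemble (hχ : ∀ m, m ∣ Finset.univ.lcm r → orderOf (χ m) = m)
    (hd : ∀ j, r j ∣ ∑ α : RIdx r, (α.1 j : ℕ) * d α) {z : LocalData F r × RootlessTuple F r}
    (hz : z.2 ∈ fiber d z.1) (p : SOmega r) (y : Option F) :
    χ p.ell (valueAt (assemble z).1 (assemble z).2 p (show OnePoint F from y)) =
      stateValue χ (z.1.2.1 y) (pointUnit z.1.1 z.1.2.1 z.1.2.2 y) p := by
  cases y with
  | none => exact mulChar_valueAt_infty hχ hd z.1.1 (natDegree_add_of_mem_fiber hz) p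
  | some x =>
    exact mulChar_valueAt_some hχ z.1.1 z.1.2.1 z.2 z.1.2.2
      (fun x α => (congrFun (hz.2 α).2 x).symm) p x

theorem attaining_eq_membersWith (hχ : ∀ m, m ∣ Finset.univ.lcm r → orderOf (χ m) = m)
    (hd : ∀ j, r j ∣ ∑ α : RIdx r, (α.1 j : ℕ) * d α) {ε : OnePoint F → SOmega r → ℂ}
    {β : Option F → RPrime r} {u : Option F → Fin n → Fˣ}
    (hε : ∀ y : Option F, ε y = stateValue χ (β y) (u y)) :
    attaining χ d ε = membersWith d (localCondition (fun y => sameClass (β y))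
      AddSubgroup.zmultiples fun y => logVec r (u y)) := by
  have hvalues (z : LocalData F r × RootlessTuple F r) (hz : z.2 ∈ fiber d z.1) :
      (∀ (x : OnePoint F) (p : SOmega r),
        χ p.ell (valueAt (assemble z).1 (assemble z).2 p x) = ε x p) ↔
      z.1 ∈ localCondition (fun y => sameClass (β y)) AddSubgroup.zmultiples
        fun y => logVec r (u y) := by
    rw [mem_localCondition, ← forall_and]
    change (∀ y : Option F, _) ↔ _
    refine forall_congr' fun y => ?_
    rw [mem_sameClass, ← stateValue_eq_iff hχ, ← hε y, funext_iff]
    exact forall_congr' fun p => by rw [← mulChar_valueAt_assemble hχ hd hz p y]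
  ext cf
  constructor
  · rintro ⟨hcf, hval⟩
    rw [← assemble_image] at hcf
    obtain ⟨z, hz, rfl⟩ := hcf
    exact ⟨z, ⟨(hvalues z hz).1 hval, hz⟩, rfl⟩
  · rintro ⟨z, ⟨hlocal, hz⟩, rfl⟩
    exact ⟨assemble_image (F := F) d ▸ ⟨z, hz, rfl⟩, (hvalues z hz).2 hlocal⟩

variable (F d) in
theorem fullFamily_eq_membersWith :
    fullFamily F d = membersWith d (localCondition (fun _ => Finset.univ) (fun _ => ⊤) 0) := by
  rw [← assemble_image, membersWith]
  simp [mem_localCondition]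

end Prescribed

theorem IsAdmissible.exists_stateValue {F : Type*} [Field F] [Finite F] {n : ℕ} {r : Fin n → ℕ}
    [∀ j, NeZero (r j)] {χ : ℕ → MulChar F ℂ} {d : RIdx r → ℕ}
    (hχ : ∀ m, m ∣ Finset.univ.lcm r → orderOf (χ m) = m)
    (hd : ∀ j, r j ∣ ∑ α : RIdx r, (α.1 j : ℕ) * d α) {ε : SOmega r → ℂ}
    (hadm : IsAdmissible χ d ε) : ∃ (β : RPrime r) (u : Fin n → Fˣ), ε = stateValue χ β u := by
  have := Fintype.ofFinite F
  obtain ⟨cf, hcf, x, hx⟩ := hadm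
  rw [← assemble_image] at hcf
  obtain ⟨z, hz, rfl⟩ := hcf
  exact ⟨_, _, funext fun p => (hx p).trans (mulChar_valueAt_assemble hχ hd hz p x)⟩

/-- The class `[β]`. -/
def toClass {n : ℕ} {r : Fin n → ℕ} (β : RPrime r) : RTilde r := Quotient.mk (simSetoid r) β

theorem toClass_eq_iff {n : ℕ} {r : Fin n → ℕ} (β : RPrime r) (b : RTilde r) :
    toClass β = b ↔ ASet β = ASet b.rep := by
  conv_lhs => rw [← Quotient.out_eq b]
  exact Quotient.eq

section Density

variable {F : Type*} [Field F] [Fintype F] {n : ℕ} {r : Fin n → ℕ} [∀ j, NeZero (r j)]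
  {χ : ℕ → MulChar F ℂ} {d : RIdx r → ℕ} {ε : OnePoint F → SOmega r → ℂ}

theorem toClass_eq_zeroClass_iff (β : RPrime r) : toClass β = zeroClass r ↔ β = 0 := by
  have hclass : toClass β = zeroClass r ↔ ASet β = ASet 0 := Quotient.eq
  rw [hclass, ASet_eq_iff, AddSubgroup.zmultiples_zero_eq_bot, AddSubgroup.zmultiples_eq_bot]

theorem mult_eq_card_filter {β : Option F → RPrime r} {u : Option F → Fin n → Fˣ}
    (hadm : ∀ x, IsAdmissible χ d (ε x))
    (hε : ∀ y : Option F, ε y = stateValue χ (β y) (u y)) (b : RTilde r) :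
    mult χ d ε b = (Finset.univ.filter fun y => toClass (β y) = b).card := by
  rw [← Set.ncard_coe_finset, mult]
  congr 1
  ext y
  simp only [Finset.coe_filter, Finset.mem_univ, true_and, Set.mem_ofPred_eq, toClass_eq_iff]
  constructor
  · rintro ⟨-, hzero⟩
    ext p
    rw [← not_iff_not, ← hzero p, hε y, stateValue_eq_zero_iff]
  · intro hclass
    refine ⟨hadm y, fun p => ?_⟩
    rw [← hclass, hε y, stateValue_eq_zero_iff]

variable (F) in
/-- The factor of `density` at a point whose family of values has class `b`. -/
noncomputable def classDensity (b : RTilde r) : ℝ :=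
  if b = zeroClass r then
    (Fintype.card F : ℝ) / (groupOrder r * (Fintype.card F + groupOrder r - 1))
  else (Nat.totient (ramIndex r (fun j => (b.rep j : ℕ)) ^ 2) : ℝ) /
    (groupOrder r * (Fintype.card F + groupOrder r - 1))

theorem density_eq_prod_classDensity_pow :
    density χ d ε = ∏ b, classDensity F b ^ mult χ d ε b := by
  rw [Fintype.prod_eq_mul_prod_compl (zeroClass r), mul_comm, density]
  congr 1
  · refine Finset.prod_congr rfl fun b hb => ?_
    rw [classDensity, if_neg (by simpa using hb)]
  · rw [classDensity, if_pos rfl]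

variable (F) in
theorem classDensity_toClass (β : RPrime r) :
    classDensity F (toClass β) = classWeight F β / totalWeight F r := by
  have : (0 : ℝ) < Fintype.card F := Nat.cast_pos.2 Fintype.card_pos
  have hden : (Fintype.card F : ℝ) + groupOrder r - 1 = Fintype.card F * totalWeight F r := by
    rw [cast_groupOrder, totalWeight]
    field_simp
    ring
  have hG := (cast_groupOrder_pos (r := r)).ne'
  have htotal := (totalWeight_pos F r).ne'
  have hrep : addOrderOf ((toClass β).rep) = addOrderOf β :=
    addOrderOf_eq_of_zmultiples_eq ((ASet_eq_iff _ _).1 ((toClass_eq_iff β _).1 rfl).symm)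
  rw [classDensity, hden, classWeight, ramFactor, ramIndex_eq_addOrderOf, hrep]
  simp only [toClass_eq_zeroClass_iff]
  split_ifs with hβ
  · rw [hβ, addOrderOf_zero, one_pow, Nat.totient_one, Nat.cast_one]
    field_simp
  · field_simp

theorem density_eq_prod {β : Option F → RPrime r} {u : Option F → Fin n → Fˣ}
    (hadm : ∀ x, IsAdmissible χ d (ε x))
    (hε : ∀ y : Option F, ε y = stateValue χ (β y) (u y)) :
    density χ d ε = ∏ y, classWeight F (β y) / totalWeight F r := by
  classical
  simp only [← classDensity_toClass]
  rw [density_eq_prod_classDensity_pow,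
    ← Finset.prod_fiberwise' Finset.univ (fun y => toClass (β y))]
  exact Finset.prod_congr rfl fun b _ => by
    rw [Finset.prod_const, mult_eq_card_filter hadm hε]

variable (F) in
theorem inv_le_classWeight (β : RPrime r) :
    ((groupOrder r : ℝ) * Fintype.card F)⁻¹ ≤ classWeight F β := by
  have hq : (1 : ℝ) ≤ Fintype.card F := by exact_mod_cast Fintype.card_pos (α := F)
  have hG := cast_groupOrder_pos (r := r)
  have htotient : (1 : ℝ) ≤ Nat.totient (addOrderOf β ^ 2) := by
    exact_mod_cast Nat.totient_pos.2 (pow_pos (addOrderOf_pos β) 2)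
  have hram : (Fintype.card F : ℝ)⁻¹ ≤ ramFactor F β := by
    rw [ramFactor]
    split_ifs
    · exact inv_le_one_of_one_le₀ hq
    · exact le_rfl
  rw [classWeight, mul_inv, ← one_div (groupOrder r : ℝ)]
  gcongr

variable (F r) in
theorem exists_pos_le_density :
    ∃ δ : ℝ, 0 < δ ∧ ∀ χ : ℕ → MulChar F ℂ,
      (∀ m, m ∣ Finset.univ.lcm r → orderOf (χ m) = m) → ∀ d : RIdx r → ℕ,
        (∀ j, r j ∣ ∑ α : RIdx r, (α.1 j : ℕ) * d α) → ∀ ε : OnePoint F → SOmega r → ℂ,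
          (∀ x, IsAdmissible χ d (ε x)) → δ ≤ density χ d ε := by
  have hfactor : 0 < ((groupOrder r : ℝ) * Fintype.card F)⁻¹ / totalWeight F r :=
    div_pos (inv_pos.2 (mul_pos cast_groupOrder_pos (Nat.cast_pos.2 Fintype.card_pos)))
      (totalWeight_pos F r)
  refine ⟨∏ _y : Option F, ((groupOrder r : ℝ) * Fintype.card F)⁻¹ / totalWeight F r,
    Finset.prod_pos fun _ _ => hfactor, fun χ hχ d hd ε hadm => ?_⟩
  choose β u hε using fun x => (hadm x).exists_stateValue hχ hd
  rw [density_eq_prod (β := β) (u := u) hadm hε]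
  exact Finset.prod_le_prod (fun _ _ => hfactor.le) fun y _ =>
    div_le_div_of_nonneg_right (inv_le_classWeight F _) (totalWeight_pos F r).le

end Density

section MainTerm

variable (F : Type*) [Field F] [Fintype F] {n : ℕ} {r : Fin n → ℕ} [∀ j, NeZero (r j)]

theorem mainSize_pos (d : RIdx r → ℕ) : 0 < mainSize F d := by
  have hq : (0 : ℝ) < Fintype.card F - 1 :=
    sub_pos.2 (by exact_mod_cast Fintype.one_lt_card (α := F))
  have hqG : (0 : ℝ) < Fintype.card F + groupOrder r - 1 := by
    linarith [cast_groupOrder_pos (r := r)]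
  have hL := LConst_pos F (groupOrder r - 2)
  have hzeta := zetaF_two_pos F
  rw [mainSize]
  positivity

theorem mainSize_eq_mainSize_zero_mul (d : RIdx r → ℕ) :
    mainSize F d = mainSize F (0 : RIdx r → ℕ) * (Fintype.card F : ℝ) ^ (∑ α, d α) := by
  simp only [mainSize, Pi.zero_apply, Finset.sum_const_zero, pow_zero]
  ring

theorem mainSize_eq_fiberDensity_mul (d : RIdx r → ℕ) :
    mainSize F d = fiberDensity F r * (Fintype.card F : ℝ) ^ (∑ α, d α) *
      (unitChoices F r * totalWeight F r ^ (Fintype.card F + 1)) := by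
  have hq : (Fintype.card F : ℝ) ≠ 0 := Nat.cast_ne_zero.2 Fintype.card_ne_zero
  have hsub_one : groupOrder r - 1 = Fintype.card (RIdx r) := by
    rw [← card_RIdx_add_one, Nat.add_sub_cancel]
  have hsub_two : groupOrder r - 2 = Fintype.card (RIdx r) - 1 := by
    rw [← card_RIdx_add_one]
    lia
  rw [mainSize, hsub_one, hsub_two, mul_div_right_comm (LConst F _),
    ← linear_factor_mul_tupleDensity F (RIdx r), cast_groupOrder, unitChoices, fiberDensity,
    totalWeight]
  set q : ℝ := (Fintype.card F : ℝ)
  set k := Fintype.card (RIdx r)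
  have hlinear : 1 - q⁻¹ = (q - 1) * q⁻¹ := by field_simp
  have htotal : (q + (k + 1) - 1) / q = 1 + k * q⁻¹ := by
    field_simp
    ring
  rw [mul_div_assoc, htotal, hlinear, mul_pow, mul_pow (q - 1), mul_pow ((q - 1) ^ k),
    pow_succ (1 + k * q⁻¹), ← inv_pow, ← pow_mul, ← pow_mul, ← pow_mul,
    mul_comm (Fintype.card F) k]
  ring

theorem mainSize_mul_prod_localWeight (hq : ∀ j, Fintype.card F ≡ 1 [MOD r j]) (d : RIdx r → ℕ)
    (T : Option F → Finset (RPrime r)) (H : RPrime r → AddSubgroup (RPrime r))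
    (t : Option F → RPrime r) :
    mainSize F d * ∏ y, localWeight F (T y) H / totalWeight F r =
      fiberDensity F r * (Fintype.card F : ℝ) ^ (∑ α, d α) *
        ∑ ω ∈ localCondition T H t, ramWeight ω.2.1 := by
  have htotal := pow_ne_zero (Fintype.card F + 1) (totalWeight_pos F r).ne'
  rw [sum_ramWeight_localCondition hq, mainSize_eq_fiberDensity_mul, Finset.prod_div_distrib,
    Finset.prod_const, Finset.card_univ, Fintype.card_option]
  field_simp

end MainTerm

section MainEstimate

theorem inv_sqrt_pow_eq_rpow {q : ℝ} (hq : 0 ≤ q) (m : ℕ) :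
    (√q)⁻¹ ^ m = q ^ (-(m : ℝ) / 2) := by
  rw [Real.sqrt_eq_rpow, ← Real.rpow_neg hq, ← Real.rpow_natCast, ← Real.rpow_mul hq]
  congr 1
  ring

-- `M (N / T - Δ) = (N - M Δ) - (N / T) (T - M)`, and `N / T ≤ 1`.
theorem abs_div_sub_le {N T M Δ η : ℝ} (hM : 0 < M) (hN : 0 ≤ N) (hNT : N ≤ T)
    (hcount : |N - M * Δ| ≤ η * M) (htotal : |T - M| ≤ η * M) : |N / T - Δ| ≤ 2 * η := by
  have hratio : |N / T| ≤ 1 := by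
    rw [abs_of_nonneg (div_nonneg hN (hN.trans hNT))]
    exact div_le_one_of_le₀ hNT (hN.trans hNT)
  have hcancel : N / T * T = N := by
    rcases eq_or_ne T 0 with hT | hT
    · rw [hT, mul_zero, le_antisymm (hNT.trans hT.le) hN]
    · exact div_mul_cancel₀ N hT
  refine le_of_mul_le_mul_right ?_ hM
  calc |N / T - Δ| * M = |(N - M * Δ) - N / T * (T - M)| := by
        rw [← abs_of_pos hM, ← abs_mul, abs_of_pos hM, mul_sub (N / T), hcancel]
        ring_nf
    _ ≤ |N - M * Δ| + |N / T| * |T - M| := by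
        rw [← abs_mul]
        exact abs_sub _ _
    _ ≤ η * M + 1 * (η * M) := by gcongr
    _ = 2 * η * M := by ring

theorem relative_error_bounds {N T M Δ δ η : ℝ} (hδ : 0 < δ) (hΔ : δ ≤ Δ) (hM : 0 < M)
    (hη : 0 ≤ η) (hN : 0 ≤ N) (hNT : N ≤ T) (hcount : |N - M * Δ| ≤ η * M)
    (htotal : |T - M| ≤ η * M) :
    |N - M * Δ| ≤ 2 / δ * η * (M * Δ) ∧ |N / T - Δ| ≤ 2 / δ * η * Δ := by
  have hrelative : 2 * η ≤ 2 / δ * η * Δ :=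
    calc 2 * η = 2 / δ * η * δ := by field_simp
      _ ≤ 2 / δ * η * Δ := by gcongr
  refine ⟨?_, (abs_div_sub_le hM hN hNT hcount htotal).trans hrelative⟩
  calc |N - M * Δ| ≤ η * M := hcount
    _ ≤ 2 / δ * η * Δ * M := by
        gcongr
        linarith
    _ = 2 / δ * η * (M * Δ) := by ring

variable (F : Type*) [Field F] [Fintype F] {n : ℕ} {r : Fin n → ℕ} [∀ j, NeZero (r j)]

theorem exists_abs_ncard_localCondition_sub_le (hq : ∀ j, Fintype.card F ≡ 1 [MOD r j]) :
    ∃ C : ℝ, 0 ≤ C ∧ ∀ (d : RIdx r → ℕ) (T : Option F → Finset (RPrime r))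
      (H : RPrime r → AddSubgroup (RPrime r)) (t : Option F → RPrime r),
      |((membersWith d (localCondition T H t)).ncard : ℝ) -
          mainSize F d * ∏ y, localWeight F (T y) H / totalWeight F r| ≤
        C * (Fintype.card F : ℝ) ^ (-((⨅ α, d α : ℕ) : ℝ) / 2) * mainSize F d := by
  obtain ⟨C, hC, hest⟩ := exists_abs_ncard_membersWith_sub_le F r
  have hpos := mainSize_pos F (0 : RIdx r → ℕ)
  refine ⟨C / mainSize F (0 : RIdx r → ℕ), by positivity, fun d T H t => ?_⟩
  rw [mainSize_mul_prod_localWeight F hq d T H t, ← inv_sqrt_pow_eq_rpow (Nat.cast_nonneg _)]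
  refine (hest d _).trans_eq ?_
  rw [mainSize_eq_mainSize_zero_mul F d]
  field_simp

theorem exists_abs_ncard_attaining_sub_le (hq : ∀ j, Fintype.card F ≡ 1 [MOD r j]) :
    ∃ C : ℝ, 0 ≤ C ∧ ∀ χ : ℕ → MulChar F ℂ,
      (∀ m, m ∣ Finset.univ.lcm r → orderOf (χ m) = m) → ∀ d : RIdx r → ℕ,
        (∀ j, r j ∣ ∑ α : RIdx r, (α.1 j : ℕ) * d α) → ∀ ε : OnePoint F → SOmega r → ℂ,
          (∀ x, IsAdmissible χ d (ε x)) →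
          |((attaining χ d ε).ncard : ℝ) - mainSize F d * density χ d ε| ≤
              C * (Fintype.card F : ℝ) ^ (-((⨅ α, d α : ℕ) : ℝ) / 2) * mainSize F d ∧
            |((fullFamily F d).ncard : ℝ) - mainSize F d| ≤
              C * (Fintype.card F : ℝ) ^ (-((⨅ α, d α : ℕ) : ℝ) / 2) * mainSize F d := by
  obtain ⟨C, hC, hest⟩ := exists_abs_ncard_localCondition_sub_le F hq
  refine ⟨C, hC, fun χ hχ d hd ε hadm => ⟨?_, ?_⟩⟩
  · choose β u hε using fun x => (hadm x).exists_stateValue hχ hd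
    rw [attaining_eq_membersWith (β := β) (u := u) hχ hd hε,
      density_eq_prod (β := β) (u := u) hadm hε]
    simp only [← localWeight_sameClass]
    exact hest d _ _ _
  · have h := hest d (fun _ => Finset.univ) (fun _ => ⊤) 0
    simpa only [← fullFamily_eq_membersWith, localWeight_univ_top,
      div_self (totalWeight_pos F r).ne', Finset.prod_const_one, mul_one] using h

end MainEstimate

end AbelianCovers

theorem proposition5p4_general {F : Type*} [Field F] [Fintype F] {n : ℕ} (r : Fin n → ℕ)
    [∀ j, NeZero (r j)] (hq : ∀ j, Fintype.card F ≡ 1 [MOD r j]) :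
    ∃ K : ℝ, ∀ χ : ℕ → MulChar F ℂ, (∀ m, m ∣ Finset.univ.lcm r → orderOf (χ m) = m) →
      ∀ d : AbelianCovers.RIdx r → ℕ,
        (∀ j, r j ∣ ∑ α : AbelianCovers.RIdx r, (α.1 j : ℕ) * d α) →
        ∀ ε : OnePoint F → AbelianCovers.SOmega r → ℂ,
          (∀ x, AbelianCovers.IsAdmissible χ d (ε x)) →
          |((AbelianCovers.attaining χ d ε).ncard : ℝ) -
              AbelianCovers.mainSize F d * AbelianCovers.density χ d ε| ≤
            K * (Fintype.card F : ℝ) ^ (-((⨅ α, d α : ℕ) : ℝ) / 2) *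
              (AbelianCovers.mainSize F d * AbelianCovers.density χ d ε) ∧
          |((AbelianCovers.attaining χ d ε).ncard : ℝ) /
                ((AbelianCovers.fullFamily F d).ncard : ℝ) - AbelianCovers.density χ d ε| ≤
            K * (Fintype.card F : ℝ) ^ (-((⨅ α, d α : ℕ) : ℝ) / 2) *
              AbelianCovers.density χ d ε := by
  obtain ⟨C, hC, hest⟩ := AbelianCovers.exists_abs_ncard_attaining_sub_le F hq
  obtain ⟨δ, hδ, hdensity⟩ := AbelianCovers.exists_pos_le_density F r
  refine ⟨2 / δ * C, fun χ hχ d hd ε hadm => ?_⟩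
  obtain ⟨hcount, htotal⟩ := hest χ hχ d hd ε hadm
  have hle : (AbelianCovers.attaining χ d ε).ncard ≤ (AbelianCovers.fullFamily F d).ncard :=
    Set.ncard_le_ncard (Set.sep_subset _ _) (AbelianCovers.finite_fullFamily F d)
  simpa only [mul_assoc] using AbelianCovers.relative_error_bounds hδ (hdensity χ hχ d hd ε hadm)
    (AbelianCovers.mainSize_pos F d) (by positivity) (Nat.cast_nonneg _) (Nat.cast_le.2 hle)
    hcount htotal

theorem proposition5p4 {F : Type*} [Field F] [Fintype F] {n : ℕ} (r : Fin n → ℕ)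
    [∀ j, NeZero (r j)] (hr : ∀ i j, i ≤ j → r i ∣ r j)
    (hq : ∀ j, Fintype.card F ≡ 1 [MOD r j]) :
    ∃ K : ℝ, ∀ χ : ℕ → MulChar F ℂ, (∀ m, m ∣ Finset.univ.lcm r → orderOf (χ m) = m) →
      ∀ d : AbelianCovers.RIdx r → ℕ,
        (∀ j, r j ∣ ∑ α : AbelianCovers.RIdx r, (α.1 j : ℕ) * d α) →
        ∀ ε : OnePoint F → AbelianCovers.SOmega r → ℂ,
          (∀ x, AbelianCovers.IsAdmissible χ d (ε x)) →
          |((AbelianCovers.attaining χ d ε).ncard : ℝ) -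
              AbelianCovers.mainSize F d * AbelianCovers.density χ d ε| ≤
            K * (Fintype.card F : ℝ) ^ (-((⨅ α, d α : ℕ) : ℝ) / 2) *
              (AbelianCovers.mainSize F d * AbelianCovers.density χ d ε) ∧
          |((AbelianCovers.attaining χ d ε).ncard : ℝ) /
                ((AbelianCovers.fullFamily F d).ncard : ℝ) - AbelianCovers.density χ d ε| ≤
            K * (Fintype.card F : ℝ) ^ (-((⨅ α, d α : ℕ) : ℝ) / 2) *
              AbelianCovers.density χ d ε :=
  proposition5p4_general r hq
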